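/- Let $d\ge 6$ be an even integer, let $q$ be a prime power, let $V$ be a $d$-dimensional vector space over the field $\mathbb{F}_q$ with $q$ elements, and let $Q$ be a non-degenerate quadratic form on $V$ of plus type (that is, of Witt defect $0$: $V$ has a totally singular subspace of dimension $d/2$). For $1\le k\le d/2$ let $\Omega_k$ be the set of $k$-dimensional totally singular subspaces of $V$. Let $\Omega_{d/2,1}$ and $\Omega_{d/2,2}$ be the two families into which $\Omega_{d/2}$ splits, where $X,Y\in\Omega_{d/2}$ are in the same family if and only if $X\cap Y$ has even codimension in $X$. Let $\Omega$ be either $\Omega_k$ with $1\le k<d/2$, or one of the two families $\Omega_{d/2,1},\Omega_{d/2,2}$, in which case we put $k=d/2$. Let $G_0=\mathrm{P}\Omega_d^+(q)$, regarded as the permutation group on $\Omega$ induced by the derived subgroup of the isometry group of $Q$, and let $G\le\mathrm{Sym}(\Omega)$ be an almost simple group with socle $G_0$. A base of $G$ is a sequence $(\omega_1,\dots,\omega_\ell)$ of points of $\Omega$ whose pointwise stabilizer in $G$ is trivial; it is irredundant if no $\omega_i$ is fixed by the pointwise stabilizer in $G$ of $\omega_1,\dots,\omega_{i-1}$; and $G$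 is IBIS if all its irredundant bases have the same size. Then $G$ is IBIS if and only if $(d,q,k)=(6,2,3)$. -/

import Mathlib

namespace IbisOrth

/-! ### Permutation groups, irredundant bases, IBIS groups -/

section Permutation

variable {Ω : Type*}

/-- `ω = (ω 0, …, ω (n - 1))` is an irredundant base for the permutation group `G` on `Ω`: its
pointwise stabilizer is trivial, and no entry is fixed by the pointwise stabilizer of its
predecessors. -/
structure IsIrredundantBase (G : Subgroup (Equiv.Perm Ω)) {n : ℕ} (ω : Fin n → Ω) : Prop where
  base : ∀ g ∈ G, (∀ i, g (ω i) = ω i) → g = 1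
  irredundant : ∀ i, ∃ g ∈ G, (∀ j < i, g (ω j) = ω j) ∧ g (ω i) ≠ ω i

/-- A permutation group is IBIS if all its irredundant bases have the same size. -/
def IsIBIS (G : Subgroup (Equiv.Perm Ω)) : Prop :=
  ∀ (m n : ℕ) (ω : Fin m → Ω) (ω' : Fin n → Ω),
    IsIrredundantBase G ω → IsIrredundantBase G ω' → m = n

end Permutation

/-! ### Socle and almost simple groups -/

section Socle

/-- A minimal normal subgroup: minimal among the nontrivial normal subgroups. -/
def IsMinimalNormal {A : Type*} [Group A] (N : Subgroup A) : Prop :=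
  Minimal (fun K : Subgroup A => K.Normal ∧ K ≠ ⊥) N

/-- The socle of a group: the subgroup generated by its minimal normal subgroups. -/
def socle (A : Type*) [Group A] : Subgroup A :=
  sSup {N : Subgroup A | IsMinimalNormal N}

/-- A finite group is almost simple if its socle is a nonabelian simple group. -/
def IsAlmostSimple (A : Type*) [Group A] : Prop :=
  Finite A ∧ IsSimpleGroup (socle A) ∧ ∃ x ∈ socle A, ∃ y ∈ socle A, x * y ≠ y * x

end Socle

/-! ### Quadratic spaces of plus type and their totally singular subspaces -/

section Orthogonal

variable {F V : Type*} [Field F] [AddCommGroup V] [Module F V]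

/-- A subspace on which the quadratic form vanishes identically. -/
def IsTotallySingular (Q : QuadraticForm F V) (U : Submodule F V) : Prop :=
  ∀ u ∈ U, Q u = 0

/-- `Q` is non-degenerate (its polar form `(u, v) ↦ Q (u + v) - Q u - Q v` has trivial radical),
of plus type (Witt defect `0`: there is a totally singular subspace of half the dimension). -/
def IsPlusType (Q : QuadraticForm F V) : Prop :=
  (∀ u : V, (∀ v : V, QuadraticMap.polar Q u v = 0) → u = 0) ∧
    ∃ U : Submodule F V, IsTotallySingular Q U ∧ 2 * Module.finrank F U = Module.finrank F V

/-- The isometry group `O(V, Q)`. -/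
def isometryGroup (Q : QuadraticForm F V) : Subgroup (V ≃ₗ[F] V) where
  carrier := {g | ∀ v, Q (g v) = Q v}
  one_mem' := fun _ => rfl
  mul_mem' := fun {a b} ha hb v => (ha (b v)).trans (hb v)
  inv_mem' := fun {a} ha v => by
    have h := ha (a⁻¹ v)
    rw [← h]
    exact congrArg Q (a.apply_symm_apply v)

/-- The group `Ω(V, Q)`, the derived subgroup of `O(V, Q)`. For `Q` of plus type on a space of
even dimension at least `6` over the field with `q` elements this is `Ω_d^+(q)`. -/
def omegaGroup (Q : QuadraticForm F V) : Subgroup (V ≃ₗ[F] V) :=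
  ⁅isometryGroup Q, isometryGroup Q⁆

/-- The set `Ω_k` of all `k`-dimensional totally singular subspaces. -/
def totallySingular (Q : QuadraticForm F V) (k : ℕ) : Set (Submodule F V) :=
  {U | IsTotallySingular Q U ∧ Module.finrank F U = k}

/-- `𝒮` is one of the families of `m`-dimensional totally singular subspaces, where `m` is half
the dimension of the space: an equivalence class of the relation
"`X ⊓ Y` has even codimension in `X`". -/
def IsFamily (Q : QuadraticForm F V) (m : ℕ) (𝒮 : Set (Submodule F V)) : Prop :=
  ∃ X ∈ totallySingular Q m, 𝒮 = {Y | Y ∈ totallySingular Q m ∧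
    Even (Module.finrank F X - Module.finrank F (X ⊓ Y : Submodule F V))}

/-- The permutation group on a set `𝒮` of subspaces that is induced by the elements of a linear
group `L` preserving `𝒮`. For `L = Ω(V, Q)` all of `L` preserves the sets `𝒮` above, the kernel
of the action consists of the scalars in `L`, and the induced group is `PΩ(V, Q)`. -/
def inducedPerm (L : Subgroup (V ≃ₗ[F] V)) (𝒮 : Set (Submodule F V)) :
    Subgroup (Equiv.Perm 𝒮) where
  carrier := {σ | ∃ g ∈ L, ∀ U : 𝒮,
    ((σ U : 𝒮) : Submodule F V) = (U : Submodule F V).map (g : V →ₗ[F] V)}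
  one_mem' := ⟨1, L.one_mem, fun U => (Submodule.map_id (U : Submodule F V)).symm⟩
  mul_mem' := by
    rintro σ τ ⟨g, hg, hσ⟩ ⟨h, hh, hτ⟩
    refine ⟨g * h, L.mul_mem hg hh, fun U => ?_⟩
    rw [Equiv.Perm.mul_apply, hσ, hτ, ← Submodule.map_comp]
    rfl
  inv_mem' := by
    rintro σ ⟨g, hg, hσ⟩
    refine ⟨g⁻¹, L.inv_mem hg, fun U => ?_⟩
    have h := hσ (σ⁻¹ U)
    rw [show σ (σ⁻¹ U) = U from σ.apply_symm_apply U] at h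
    rw [h, ← Submodule.map_comp]
    have e : ((g⁻¹ : V ≃ₗ[F] V) : V →ₗ[F] V) ∘ₗ (g : V →ₗ[F] V) = LinearMap.id :=
      LinearMap.ext fun v => g.symm_apply_apply v
    rw [e, Submodule.map_id]

end Orthogonal

end IbisOrth

/-! Write N for PΩ(V, Q), a normal subgroup of G. A group is not IBIS as soon as some irredundant
sequence contains a point fixed by the stabilizer of the remaining ones (`not_isIBIS_of_dependent`):
complete the sequence to a base, drop that point, thin out the rest, and a strictly shorter
irredundant base appears.

Irredundance may be checked in N, with explicit products of long root elements. Dependence has to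
hold for all of G, which may contain semilinear and graph automorphisms. No description of these is
needed. Let cl(A) be the set of points fixed by the pointwise stabilizer of A in N (`fixedClosure`).
Since G normalizes N, it permutes closures: if x lies in cl(A) and g in G fixes A pointwise, then g
x lies in cl(A), and every relation expressed by closures passes from x to g x. In each case the
closure is small enough for such relations to force g x = x. Upper bounds on closures use only root
elements, which lie in Ω(V, Q) by `root_mem_omegaGroup`; lower bounds use only that elements of Ω(V,
Q) are isometries.

The dependent points are as follows. For 2 ≤ k < d/2, the midpoint W + ⟨e₁, e₂⟩ of W + ⟨e₀, e₁⟩ and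
W + ⟨f₀, e₂⟩. For k = 1 and q > 2, ⟨e₁⟩ with respect to ⟨e₀⟩, ⟨e₀ + e₁⟩, ⟨f₀⟩. For k = 1 and q = 2,
⟨e₀ + f₀ + e₁ + f₁⟩ with respect to the basis points other than ⟨e₀⟩ and ⟨f₀⟩, orthogonality being
visible in closures. For k = d/2 and q > 2, the intersection of two lines of a frame in a projective
plane of members adjacent to a subspace Z of the opposite family. For k = d/2, q = 2 and d ≥ 8, a
twisted member determined by its distances to six others.

In the case (6, 2, 3) the family is the point set of PG(3, 2), two points being joined by the line
of the members that contain their intersection. Each term of an irredundant sequence at least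
doubles the number of fixed points plus one, so a base has at most four points
(`two_pow_le_card_add_one`), while three points always have a nontrivial stabilizer
(`exists_ne_one_fixing`). Hence all irredundant bases have size four. -/

namespace IbisOrth

/-! ### Irredundant lists and dependence in permutation groups -/

section Irredundance

variable {Ω : Type*}

/-- A list of points, read from its end to its head, in which no entry is fixed by the pointwise
stabilizer in `G` of the entries after it. -/
def IrredundantList (G : Subgroup (Equiv.Perm Ω)) : List Ω → Prop
  | [] => True
  | a :: L => IrredundantList G L ∧ ∃ g ∈ G, (∀ x ∈ L, g x = x) ∧ g a ≠ a

theorem IrredundantList.mono {G H : Subgroup (Equiv.Perm Ω)} (h : G ≤ H) :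
    ∀ {L : List Ω}, IrredundantList G L → IrredundantList H L
  | [], _ => trivial
  | _ :: _, ⟨h1, g, hg, h2⟩ => ⟨h1.mono h, g, h hg, h2⟩

/-- Points each of which is moved by an element fixing the others may be added in any order. -/
theorem IrredundantList.append_map {N : Subgroup (Equiv.Perm Ω)} {ι : Type*} {y : ι → Ω}
    {L : List Ω} (hL : IrredundantList N L) : ∀ {J : List ι}, J.Nodup →
      (∀ i ∈ J, ∃ n ∈ N, (∀ x ∈ L, n x = x) ∧ (∀ j ∈ J, j ≠ i → n (y j) = y j) ∧ n (y i) ≠ y i) →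
      IrredundantList N (J.map y ++ L)
  | [], _, _ => hL
  | i :: J, hJ, h => by
    have hJ' := List.nodup_cons.1 hJ
    refine ⟨hL.append_map hJ'.2 fun j hj => ?_, ?_⟩
    · obtain ⟨n, hn, h1, h2, h3⟩ := h j (List.mem_cons_of_mem _ hj)
      exact ⟨n, hn, h1, fun l hl => h2 l (List.mem_cons_of_mem _ hl), h3⟩
    · obtain ⟨n, hn, h1, h2, h3⟩ := h i List.mem_cons_self
      refine ⟨n, hn, fun x hx => ?_, h3⟩
      rcases List.mem_append.1 hx with hx | hx
      · obtain ⟨j, hj, rfl⟩ := List.mem_map.1 hx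
        exact h2 j (List.mem_cons_of_mem _ hj) fun he => hJ'.1 (he ▸ hj)
      · exact h1 x hx

theorem exists_irredundantBase_of_list {G : Subgroup (Equiv.Perm Ω)} :
    ∀ {L : List Ω}, IrredundantList G L →
      ∃ ω : Fin L.length → Ω,
        (∀ i, ∃ g ∈ G, (∀ j < i, g (ω j) = ω j) ∧ g (ω i) ≠ ω i) ∧ ∀ x, x ∈ L ↔ ∃ i, ω i = x
  | [], _ => ⟨Fin.elim0, fun i => i.elim0, by simp⟩
  | a :: L, ⟨hL, g, hg, hfix, hmove⟩ => by
    obtain ⟨ω, h1, h2⟩ := exists_irredundantBase_of_list hL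
    refine ⟨Fin.snoc (α := fun _ => Ω) ω a, ?_, ?_⟩
    · intro i
      refine Fin.lastCases ?_ (fun i => ?_) i
      · refine ⟨g, hg, ?_, by simpa using hmove⟩
        intro j
        refine Fin.lastCases (fun hj => absurd hj (lt_irrefl _)) (fun j _ => ?_) j
        simpa using hfix _ ((h2 _).2 ⟨j, rfl⟩)
      · obtain ⟨g', hg', h3, h4⟩ := h1 i
        refine ⟨g', hg', ?_, by simpa using h4⟩
        intro j
        refine Fin.lastCases (fun hj => ?_) (fun j hj => ?_) j
        · exact absurd hj (not_lt.2 (Fin.le_last _))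
        · simpa using h3 j (by simpa using hj)
    · intro x
      rw [List.mem_cons, h2]
      constructor
      · rintro (rfl | ⟨i, rfl⟩)
        · exact ⟨Fin.last _, by simp⟩
        · exact ⟨i.castSucc, by simp⟩
      · rintro ⟨i, rfl⟩
        refine Fin.lastCases (Or.inl (by simp)) (fun i => Or.inr ⟨i, by simp⟩) i

/-- Greedy selection: a point of `M` is kept exactly when the points already kept do not fix it. The
length bound is what later makes one base shorter than another. -/
theorem exists_irredundantList_append {G : Subgroup (Equiv.Perm Ω)} {L : List Ω}
    (hL : IrredundantList G L) :
    ∀ M : List Ω, ∃ M' : List Ω, M'.length ≤ M.length ∧ IrredundantList G (M' ++ L) ∧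
      ∀ g ∈ G, (∀ x ∈ M' ++ L, g x = x) → ∀ x ∈ M, g x = x
  | [] => ⟨[], le_rfl, hL, by simp⟩
  | a :: M => by
    obtain ⟨M', h1, h2, h3⟩ := exists_irredundantList_append hL M
    by_cases h : ∃ g ∈ G, (∀ x ∈ M' ++ L, g x = x) ∧ g a ≠ a
    · refine ⟨a :: M', by simpa using h1, ⟨h2, h⟩, ?_⟩
      intro g hg hfix x hx
      rcases List.mem_cons.1 hx with rfl | hx
      · exact hfix _ (by simp)
      · exact h3 g hg (fun y hy => hfix y (List.mem_cons_of_mem _ hy)) x hx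
    · push Not at h
      refine ⟨M', h1.trans (by simp), h2, ?_⟩
      intro g hg hfix x hx
      rcases List.mem_cons.1 hx with rfl | hx
      · exact h g hg hfix
      · exact h3 g hg hfix x hx

/-- In an IBIS group no entry of an irredundant list is fixed by the stabilizer of the others. -/
theorem not_isIBIS_of_dependent [Finite Ω] {G : Subgroup (Equiv.Perm Ω)} {L₁ L₂ : List Ω} {a : Ω}
    (hL : IrredundantList G (L₁ ++ a :: L₂))
    (ha : ∀ g ∈ G, (∀ x ∈ L₁ ++ L₂, g x = x) → g a = a) : ¬ IsIBIS G := by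
  intro hG
  cases nonempty_fintype Ω
  -- Running through all points completes the sequence to a base.
  obtain ⟨M, -, h2, h3⟩ := exists_irredundantList_append hL (Finset.univ : Finset Ω).toList
  -- The same base without `a` is still a base; thinning it out gives an irredundant one with at
  -- least one point fewer.
  obtain ⟨M', h4, h5, h6⟩ := exists_irredundantList_append (G := G) (L := []) trivial
    (M ++ (L₁ ++ L₂))
  rw [List.append_nil] at h5 h6
  obtain ⟨ω, w1, w2⟩ := exists_irredundantBase_of_list h2
  obtain ⟨ω', w1', w2'⟩ := exists_irredundantBase_of_list h5
  have hbase : ∀ g ∈ G, (∀ x ∈ M ++ (L₁ ++ a :: L₂), g x = x) → g = 1 := fun g hg hfix =>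
    Equiv.ext fun x => h3 g hg hfix x (by simp)
  have key := hG _ _ ω ω' ⟨fun g hg hfix => hbase g hg fun x hx => by
      obtain ⟨i, rfl⟩ := (w2 x).1 hx
      exact hfix i, w1⟩ ⟨fun g hg hfix => by
      have h7 := h6 g hg fun x hx => by
        obtain ⟨i, rfl⟩ := (w2' x).1 hx
        exact hfix i
      have h8 := ha g hg fun x hx => h7 x (List.mem_append_right _ hx)
      refine hbase g hg fun x hx => ?_
      simp only [List.mem_append, List.mem_cons] at hx h7
      rcases hx with hx | hx | rfl | hx
      · exact h7 x (Or.inl hx)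
      · exact h7 x (Or.inr (Or.inl hx))
      · exact h8
      · exact h7 x (Or.inr (Or.inr hx)), w1'⟩
  simp only [List.length_append, List.length_cons] at key h4
  omega

/-- The points fixed by the pointwise stabilizer of `A` in `N`. -/
def fixedClosure (N : Subgroup (Equiv.Perm Ω)) (A : Set Ω) : Set Ω :=
  {t | ∀ n ∈ N, (∀ a ∈ A, n a = a) → n t = t}

theorem subset_fixedClosure (N : Subgroup (Equiv.Perm Ω)) (A : Set Ω) : A ⊆ fixedClosure N A :=
  fun _ ha _ _ h => h _ ha

theorem fixedClosure_subset {N : Subgroup (Equiv.Perm Ω)} {A B : Set Ω}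
    (h : A ⊆ fixedClosure N B) : fixedClosure N A ⊆ fixedClosure N B :=
  fun _ ht n hn hB => ht n hn fun _ ha => h ha n hn hB

theorem image_mem_fixedClosure {N : Subgroup (Equiv.Perm Ω)} {A : Set Ω} {g : Equiv.Perm Ω}
    (hg : ∀ n ∈ N, g⁻¹ * n * g ∈ N) {t : Ω} (ht : t ∈ fixedClosure N A) :
    g t ∈ fixedClosure N (g '' A) := by
  intro n hn hfix
  have h := ht _ (hg n hn) fun a ha => by
    simp [Equiv.Perm.mul_apply, hfix _ (Set.mem_image_of_mem g ha)]
  have h' := congrArg g h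
  simpa [Equiv.Perm.mul_apply] using h'

theorem mem_fixedClosure_of_image {N : Subgroup (Equiv.Perm Ω)} {A : Set Ω} {g : Equiv.Perm Ω}
    (hg : ∀ n ∈ N, g * n * g⁻¹ ∈ N) {t : Ω} (ht : g t ∈ fixedClosure N (g '' A)) :
    t ∈ fixedClosure N A := by
  have h := image_mem_fixedClosure (g := g⁻¹) (by simpa using hg) ht
  simpa [Set.image_image] using h

/-- A conjugate of a closed set inside a closed set: equality by cardinality. -/
theorem fixedClosure_image_eq [Finite Ω] {N : Subgroup (Equiv.Perm Ω)} {A : Set Ω}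
    {u : Equiv.Perm Ω} (hu : u ∈ N) (h : u '' A ⊆ fixedClosure N A) :
    A ⊆ fixedClosure N (u '' A) := by
  have h1 : fixedClosure N (u '' A) ⊆ fixedClosure N A := fixedClosure_subset h
  have h2 : u '' fixedClosure N A ⊆ fixedClosure N (u '' A) := by
    rintro _ ⟨t, ht, rfl⟩
    exact image_mem_fixedClosure (fun n hn => N.mul_mem (N.mul_mem (N.inv_mem hu) hn) hu) ht
  -- cl(u A) lies in cl(A) and contains the translate u cl(A), which has the same finite size.
  have h3 : fixedClosure N (u '' A) = fixedClosure N A := by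
    refine Set.eq_of_subset_of_ncard_le h1 ?_ (Set.toFinite _)
    rw [← Set.ncard_image_of_injective (fixedClosure N A) u.injective]
    exact Set.ncard_le_ncard h2 (Set.toFinite _)
  rw [h3]
  exact subset_fixedClosure N A

theorem socle_normal (A : Type*) [Group A] : (socle A).Normal :=
  Subgroup.sSup_normal _ fun _ hN => hN.1.1

theorem conj_mem_map_socle {G : Subgroup (Equiv.Perm Ω)} {g n : Equiv.Perm Ω} (hg : g ∈ G)
    (hn : n ∈ (socle G).map G.subtype) : g * n * g⁻¹ ∈ (socle G).map G.subtype := by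
  obtain ⟨x, hx, rfl⟩ := hn
  exact ⟨⟨g, hg⟩ * x * ⟨g, hg⟩⁻¹, (socle_normal G).conj_mem x hx _, rfl⟩

/-- This transport is the only way in which elements of G outside N are ever handled. -/
theorem apply_mem_fixedClosure_iff {N G : Subgroup (Equiv.Perm Ω)}
    (hnorm : ∀ g ∈ G, ∀ n ∈ N, g * n * g⁻¹ ∈ N) {g : Equiv.Perm Ω} (hg : g ∈ G) {A : Set Ω}
    {t : Ω} : g t ∈ fixedClosure N (g '' A) ↔ t ∈ fixedClosure N A :=
  ⟨mem_fixedClosure_of_image (hnorm g hg), image_mem_fixedClosure fun n hn => by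
    simpa using hnorm _ (G.inv_mem hg) n hn⟩

end Irredundance

end IbisOrth

namespace IbisOrth

/-! ### Quadratic spaces of plus type -/

section Geometry

open QuadraticMap Module

variable {F V : Type*} [Field F] [AddCommGroup V] [Module F V] {Q : QuadraticForm F V} {m : ℕ}

/-- The orthogonal space of `W` with respect to the polar form of `Q`. -/
def perp (Q : QuadraticForm F V) (W : Submodule F V) : Submodule F V :=
  LinearMap.BilinForm.orthogonal (polarBilin Q) W

theorem mem_perp {W : Submodule F V} {x : V} : x ∈ perp Q W ↔ ∀ w ∈ W, polar Q w x = 0 := Iff.rfl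

theorem perp_anti {W W' : Submodule F V} (h : W ≤ W') : perp Q W' ≤ perp Q W :=
  fun _ hx w hw => hx w (h hw)

theorem mem_perp_span {s : Set V} {x : V} :
    x ∈ perp Q (Submodule.span F s) ↔ ∀ w ∈ s, polar Q w x = 0 := by
  refine ⟨fun h w hw => h w (Submodule.subset_span hw), fun h w hw => ?_⟩
  induction hw using Submodule.span_induction with
  | mem w hw => exact h w hw
  | zero => simp
  | add a b _ _ ha hb =>
    change polar Q _ _ = 0
    rw [polar_add_left]; exact (congrArg₂ (· + ·) ha hb).trans (add_zero _)
  | smul c a _ ha =>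
    change polar Q _ _ = 0
    rw [polar_smul_left]; exact (congrArg (c • ·) ha).trans (smul_zero _)

theorem IsTotallySingular.polar_eq_zero {W : Submodule F V} (h : IsTotallySingular Q W) {u v : V}
    (hu : u ∈ W) (hv : v ∈ W) : polar Q u v = 0 := by
  simp [polar, h _ (W.add_mem hu hv), h _ hu, h _ hv]

theorem IsTotallySingular.le_perp {W : Submodule F V} (h : IsTotallySingular Q W) :
    W ≤ perp Q W := fun _ hx _ hw => h.polar_eq_zero hw hx

theorem IsTotallySingular.mono {W W' : Submodule F V} (h : IsTotallySingular Q W') (hW : W ≤ W') :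
    IsTotallySingular Q W := fun u hu => h u (hW hu)

theorem IsTotallySingular.sup {W W' : Submodule F V} (h : IsTotallySingular Q W)
    (h' : IsTotallySingular Q W') (hp : W' ≤ perp Q W) : IsTotallySingular Q (W ⊔ W') := by
  intro x hx
  obtain ⟨w, hw, w', hw', rfl⟩ := Submodule.mem_sup.1 hx
  have := hp hw' w hw
  change polar Q w w' = 0 at this
  rw [QuadraticMap.map_add (f := Q), h w hw, h' w' hw', this]; simp

theorem isTotallySingular_span {s : Set V} (h : ∀ a ∈ s, Q a = 0)
    (h' : ∀ a ∈ s, ∀ b ∈ s, polar Q a b = 0) : IsTotallySingular Q (Submodule.span F s) := by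
  intro x hx
  have hp : ∀ a ∈ s, ∀ y ∈ Submodule.span F s, polar Q y a = 0 := fun a ha y hy =>
    mem_perp_span.2 (fun w hw => h' w hw a ha) y hy
  suffices Q x = 0 ∧ x ∈ Submodule.span F s from this.1
  induction hx using Submodule.span_induction with
  | mem w hw => exact ⟨h w hw, Submodule.subset_span hw⟩
  | zero => simp
  | add a b ha hb iha ihb =>
    have : polar Q b a = 0 := by
      have h2 : b ∈ perp Q (Submodule.span F s) := mem_perp_span.2 fun w hw => by
        rw [polar_comm]; exact hp w hw b hb
      rw [polar_comm]; exact h2 a ha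
    rw [QuadraticMap.map_add (f := Q), iha.1, ihb.1, polar_comm, this]
    exact ⟨by simp, Submodule.add_mem _ ha hb⟩
  | smul c a ha iha =>
    rw [QuadraticMap.map_smul, iha.1]
    exact ⟨by simp, Submodule.smul_mem _ _ ha⟩

theorem isTotallySingular_span_singleton {u : V} (h : Q u = 0) :
    IsTotallySingular Q (Submodule.span F {u}) := by
  refine isTotallySingular_span (by simpa using h) ?_
  rintro a rfl b rfl
  simp [polar_self, h]

theorem isTotallySingular_span_pair {u v : V} (hu : Q u = 0) (hv : Q v = 0)
    (huv : polar Q u v = 0) : IsTotallySingular Q (Submodule.span F {u, v}) := by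
  refine isTotallySingular_span (by simp [hu, hv]) ?_
  rintro a (rfl | rfl) b (rfl | rfl)
  · simp [polar_self, hu]
  · exact huv
  · rw [polar_comm]; exact huv
  · simp [polar_self, hv]

/-- A non-degenerate quadratic space of plus type and dimension `2 * m`, with `m ≥ 3`. -/
structure PlusSpace (Q : QuadraticForm F V) (m : ℕ) : Prop where
  plus : IsPlusType Q
  dim : finrank F V = 2 * m
  three_le : 3 ≤ m

/-- The maximal totally singular subspaces. -/
def IsMaxTS (Q : QuadraticForm F V) (m : ℕ) (X : Submodule F V) : Prop :=
  IsTotallySingular Q X ∧ finrank F X = m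

namespace PlusSpace

theorem finite (h : PlusSpace Q m) : FiniteDimensional F V :=
  Module.finite_of_finrank_pos (by have := h.dim; have := h.three_le; omega)

theorem nondegenerate (h : PlusSpace Q m) :
    LinearMap.BilinForm.Nondegenerate (polarBilin Q) :=
  ⟨h.plus.1, fun u hu => h.plus.1 u fun v => (polar_comm Q u v).trans (hu v)⟩

theorem isRefl (Q : QuadraticForm F V) : LinearMap.BilinForm.IsRefl (polarBilin Q) :=
  fun x y h => (polar_comm Q y x).trans h

theorem finrank_perp (h : PlusSpace Q m) (W : Submodule F V) :
    finrank F (perp Q W) + finrank F W = 2 * m := by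
  have := h.finite
  have h1 := LinearMap.BilinForm.finrank_orthogonal h.nondegenerate W
  have h2 := Submodule.finrank_le W
  have h3 := h.dim
  change finrank F (perp Q W) = _ at h1
  omega

theorem perp_perp (h : PlusSpace Q m) (W : Submodule F V) : perp Q (perp Q W) = W := by
  have := h.finite
  exact LinearMap.BilinForm.orthogonal_orthogonal h.nondegenerate (isRefl Q) W

theorem perp_inf (_h : PlusSpace Q m) (W W' : Submodule F V) :
    perp Q W ⊓ perp Q W' = perp Q (W ⊔ W') := by
  refine le_antisymm (fun x hx w hw => ?_) (le_inf (perp_anti le_sup_left) (perp_anti le_sup_right))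
  obtain ⟨a, ha, b, hb, rfl⟩ := Submodule.mem_sup.1 hw
  have h1 : polar Q a x = 0 := hx.1 a ha
  have h2 : polar Q b x = 0 := hx.2 b hb
  change polar Q (a + b) x = 0
  rw [polar_add_left, h1, h2, add_zero]

theorem perp_eq (h : PlusSpace Q m) {X : Submodule F V} (hX : IsMaxTS Q m X) : perp Q X = X := by
  have := h.finite
  refine (Submodule.eq_of_le_of_finrank_eq hX.1.le_perp ?_).symm
  have h2 := h.finrank_perp X
  have h3 := hX.2
  omega

theorem mem_of_perp (h : PlusSpace Q m) {X : Submodule F V} (hX : IsMaxTS Q m X) {x : V}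
    (hx : ∀ s ∈ X, polar Q s x = 0) : x ∈ X := by
  rw [← h.perp_eq hX]; exact hx

/-- For any maximal U, the subspace W + (U ∩ W^⊥) has dimension m, because U ∩ W^⊥ = (U + W)^⊥. -/
theorem exists_isMaxTS (h : PlusSpace Q m) {W : Submodule F V} (hW : IsTotallySingular Q W) :
    ∃ X, IsMaxTS Q m X ∧ W ≤ X := by
  have := h.finite
  obtain ⟨U, hU, hdim⟩ := h.plus.2
  rw [h.dim] at hdim
  have hU' : IsMaxTS Q m U := ⟨hU, by omega⟩
  refine ⟨W ⊔ (U ⊓ perp Q W), ⟨hW.sup (hU.mono inf_le_left) inf_le_right, ?_⟩, le_sup_left⟩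
  have h1 := Submodule.finrank_sup_add_finrank_inf_eq W (U ⊓ perp Q W)
  have h2 : W ⊓ (U ⊓ perp Q W) = U ⊓ W := by
    refine le_antisymm (le_inf (inf_le_right.trans inf_le_left) inf_le_left)
      (le_inf inf_le_right (le_inf inf_le_left (inf_le_right.trans hW.le_perp)))
  have h3 : U ⊓ perp Q W = perp Q (U ⊔ W) := by
    rw [← h.perp_inf, h.perp_eq hU']
  have h4 := h.finrank_perp (U ⊔ W)
  have h5 := Submodule.finrank_sup_add_finrank_inf_eq U W
  rw [← h3] at h4
  rw [h2] at h1
  omega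

theorem exists_dual (h : PlusSpace Q m) {W : Submodule F V} {t : V} (ht : t ∉ W) :
    ∃ v ∈ perp Q W, polar Q t v = 1 := by
  rw [← h.perp_perp W, mem_perp] at ht
  push Not at ht
  obtain ⟨v, hv, hne⟩ := ht
  refine ⟨(polar Q v t)⁻¹ • v, Submodule.smul_mem _ _ hv, ?_⟩
  rw [polar_smul_right, polar_comm Q t v, smul_eq_mul, inv_mul_cancel₀ hne]

theorem exists_singular_dual (h : PlusSpace Q m) {W : Submodule F V} {t : V} (ht : t ∉ W)
    (hs : Q t = 0) (htW : t ∈ perp Q W) : ∃ v ∈ perp Q W, Q v = 0 ∧ polar Q t v = 1 := by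
  obtain ⟨v, hv, h1⟩ := h.exists_dual ht
  -- Since t is singular and pairs to 1 with v, subtracting Q(v) t cancels Q(v) and keeps the
  -- pairing with t.
  refine ⟨v - Q v • t, Submodule.sub_mem _ hv (Submodule.smul_mem _ _ htW), ?_, ?_⟩
  · rw [sub_eq_add_neg, QuadraticMap.map_add (f := Q), QuadraticMap.map_neg, QuadraticMap.map_smul,
      hs, polar_neg_right, polar_smul_right, polar_comm, h1]
    simp
  · rw [polar_sub_right, polar_smul_right, polar_self, hs, h1]; simp

/-- A singular vector is moved off its perp by a singular vector of a prescribed perp. -/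
theorem exists_singular_polar_ne_zero (h : PlusSpace Q m) {P : Submodule F V}
    (hP : IsTotallySingular Q P) {t : V} (ht : t ∉ P) :
    ∃ v ∈ perp Q P, Q v = 0 ∧ polar Q t v ≠ 0 := by
  obtain ⟨X, hX, hPX⟩ := h.exists_isMaxTS hP
  -- Either t lies in X, and then it has a singular dual, or some vector of X itself is not
  -- orthogonal to t.
  by_cases h1 : ∀ s ∈ X, polar Q s t = 0
  · have htX := h.mem_of_perp hX h1
    obtain ⟨v, hv, hv0, h2⟩ := h.exists_singular_dual ht (hX.1 t htX)
      (fun w hw => hX.1.polar_eq_zero (hPX hw) htX)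
    exact ⟨v, hv, hv0, by simp [h2]⟩
  · push Not at h1
    obtain ⟨v, hv, hne⟩ := h1
    exact ⟨v, fun w hw => hX.1.polar_eq_zero (hPX hw) hv, hX.1 v hv, by rwa [polar_comm]⟩

end PlusSpace

/-! ### Long root elements -/

/-- The linear map `z ↦ z + B(z,u) v - B(z,v) u`. -/
def rootMap (Q : QuadraticForm F V) (u v : V) : V →ₗ[F] V :=
  LinearMap.id + (((polarBilin Q) u).smulRight v - ((polarBilin Q) v).smulRight u)

theorem rootMap_apply (u v z : V) :
    rootMap Q u v z = z + (polar Q u z • v - polar Q v z • u) := rfl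

/-- A pair of orthogonal singular vectors. -/
def SingularPair (Q : QuadraticForm F V) (u v : V) : Prop :=
  Q u = 0 ∧ Q v = 0 ∧ polar Q u v = 0

theorem SingularPair.symm {u v : V} (h : SingularPair Q u v) : SingularPair Q v u :=
  ⟨h.2.1, h.1, by rw [polar_comm]; exact h.2.2⟩

theorem SingularPair.smul_left {u v : V} (h : SingularPair Q u v) (c : F) :
    SingularPair Q (c • u) v :=
  ⟨by rw [QuadraticMap.map_smul, h.1, smul_zero], h.2.1, by rw [polar_smul_left, h.2.2, smul_zero]⟩

theorem IsTotallySingular.singularPair {X : Submodule F V} (h : IsTotallySingular Q X) {u v : V}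
    (hu : u ∈ X) (hv : v ∈ X) : SingularPair Q u v := ⟨h u hu, h v hv, h.polar_eq_zero hu hv⟩

theorem rootMap_rootMap {u v : V} (h : SingularPair Q u v) (z : V) :
    rootMap Q v u (rootMap Q u v z) = z := by
  obtain ⟨h1, h2, h3⟩ := h
  have h4 : polar Q v u = 0 := by rw [polar_comm]; exact h3
  simp only [rootMap_apply, polar_add_right, polar_sub_right, polar_smul_right, polar_self, h1, h2,
    h3, h4, smul_zero]
  module

/-- The long root element attached to a pair of orthogonal singular vectors. -/
def root (u v : V) (h : SingularPair Q u v) : V ≃ₗ[F] V :=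
  LinearEquiv.ofLinearMap (rootMap Q u v) (rootMap Q v u)
    (LinearMap.ext fun z => rootMap_rootMap h.symm z) (LinearMap.ext fun z => rootMap_rootMap h z)

theorem root_apply {u v : V} (h : SingularPair Q u v) (z : V) :
    root u v h z = z + (polar Q u z • v - polar Q v z • u) := rfl

theorem root_mem_isometryGroup {u v : V} (h : SingularPair Q u v) :
    root u v h ∈ isometryGroup Q := by
  intro z
  have h1 := h.1
  have h2 := h.2.1
  have h3 := h.2.2
  rw [root_apply, QuadraticMap.map_add (f := Q), sub_eq_add_neg, QuadraticMap.map_add (f := Q),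
    QuadraticMap.map_neg, QuadraticMap.map_smul, QuadraticMap.map_smul, polar_add_right,
    polar_neg_right, polar_neg_right, polar_smul_right, polar_smul_right, polar_smul_right,
    polar_smul_left, polar_comm Q v u, polar_comm Q z u, polar_comm Q z v, h1, h2, h3]
  simp only [smul_eq_mul]
  ring

/-- The group generated by the long root elements. -/
def rootGroup (Q : QuadraticForm F V) : Subgroup (V ≃ₗ[F] V) :=
  Subgroup.closure {g | ∃ u v, ∃ h : SingularPair Q u v, g = root u v h}

theorem root_mem_rootGroup {u v : V} (h : SingularPair Q u v) : root u v h ∈ rootGroup Q :=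
  Subgroup.subset_closure ⟨u, v, h, rfl⟩

open scoped commutatorElement in
-- If w, y is a hyperbolic pair orthogonal to u and v, the root element of (u, v) is the commutator
-- of those of (v, w) and (y, u). Such a w exists because a maximal subspace through u and v has
-- dimension m ≥ 3.
theorem root_mem_omegaGroup (hQ : PlusSpace Q m) {u v : V} (h : SingularPair Q u v) :
    root u v h ∈ omegaGroup Q := by
  have := hQ.finite
  have hts := isTotallySingular_span_pair h.1 h.2.1 h.2.2
  obtain ⟨X, hX, hle⟩ := hQ.exists_isMaxTS hts
  have h2 : finrank F (Submodule.span F {u, v}) ≤ 2 := by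
    classical
    have := finrank_span_finset_le_card (R := F) ({u, v} : Finset V)
    rw [Finset.coe_pair] at this
    exact this.trans Finset.card_le_two
  have hlt : ¬ X ≤ Submodule.span F {u, v} := fun hle' => by
    have h3 := Submodule.finrank_mono hle'
    have h4 := hX.2
    have := hQ.three_le
    omega
  obtain ⟨w, hwX, hw⟩ := Set.not_subset.1 hlt
  obtain ⟨y, hy, hy0, hwy⟩ := hQ.exists_singular_dual hw (hX.1 w hwX)
    (perp_anti hle (hX.1.le_perp hwX))
  have huX := hle (Submodule.subset_span (Set.mem_insert u {v}))
  have hvX := hle (Submodule.subset_span (Set.mem_insert_of_mem u rfl))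
  have huy : polar Q u y = 0 := mem_perp_span.1 hy u (by simp)
  have hvy : polar Q v y = 0 := mem_perp_span.1 hy v (by simp)
  have p1 : SingularPair Q v w := hX.1.singularPair hvX hwX
  have p2 : SingularPair Q y u := ⟨hy0, h.1, by rw [polar_comm]; exact huy⟩
  have e : root u v h = ⁅root v w p1, root y u p2⁆ := by
    rw [commutatorElement_def, eq_mul_inv_iff_mul_eq, eq_mul_inv_iff_mul_eq]
    ext z
    have e1 := p1.2.2
    have e4 : polar Q w u = 0 := hX.1.polar_eq_zero hwX huX
    have e5 : polar Q u w = 0 := hX.1.polar_eq_zero huX hwX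
    have e6 : polar Q v u = 0 := hX.1.polar_eq_zero hvX huX
    have e7 : polar Q y w = 1 := by rw [polar_comm]; exact hwy
    have e8 : polar Q y v = 0 := by rw [polar_comm]; exact hvy
    simp only [LinearEquiv.mul_apply, root_apply, polar_add_right, polar_sub_right,
      polar_smul_right, polar_self, h.1, h.2.1, h.2.2, hwy, huy, hvy, e1, e4, e5, e6, e7,
      e8, smul_eq_mul, mul_zero, mul_one, smul_zero]
    module
  rw [e]
  exact Subgroup.commutator_mem_commutator (root_mem_isometryGroup p1) (root_mem_isometryGroup p2)

theorem rootGroup_le_omegaGroup (hQ : PlusSpace Q m) : rootGroup Q ≤ omegaGroup Q := by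
  rw [rootGroup, Subgroup.closure_le]
  rintro _ ⟨u, v, h, rfl⟩
  exact root_mem_omegaGroup hQ h

theorem omegaGroup_le_isometryGroup (Q : QuadraticForm F V) : omegaGroup Q ≤ isometryGroup Q :=
  Subgroup.commutator_le_self _

theorem polar_map_of_mem_isometryGroup {g : V ≃ₗ[F] V} (hg : g ∈ isometryGroup Q) (x y : V) :
    polar Q (g x) (g y) = polar Q x y := by
  have hg' : ∀ v, Q (g v) = Q v := hg
  simp only [polar, ← map_add, hg']

theorem map_eq_of_le {g : V ≃ₗ[F] V} [FiniteDimensional F V] {X : Submodule F V}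
    (h : ∀ x ∈ X, g x ∈ X) : X.map (g : V →ₗ[F] V) = X := by
  refine Submodule.eq_of_le_of_finrank_eq ?_ (LinearEquiv.finrank_map_eq g X)
  rintro _ ⟨x, hx, rfl⟩
  exact h x hx

theorem isTotallySingular_map {g : V ≃ₗ[F] V} (hg : g ∈ isometryGroup Q) {X : Submodule F V}
    (hX : IsTotallySingular Q X) : IsTotallySingular Q (X.map (g : V →ₗ[F] V)) := by
  rintro _ ⟨x, hx, rfl⟩
  exact (hg x).trans (hX x hx)

end Geometry
end IbisOrth

namespace IbisOrth
-- Parity of intersections of maximal totally singular subspaces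
section Families

open QuadraticMap Module

variable {F V : Type*} [Field F] [AddCommGroup V] [Module F V] {Q : QuadraticForm F V} {m : ℕ}

namespace PlusSpace

theorem isMaxTS_sup_inf (h : PlusSpace Q m) {X W : Submodule F V} (hX : IsMaxTS Q m X)
    (hW : IsTotallySingular Q W) : IsMaxTS Q m (W ⊔ (X ⊓ perp Q W)) := by
  have := h.finite
  refine ⟨hW.sup (hX.1.mono inf_le_left) inf_le_right, ?_⟩
  have h1 := Submodule.finrank_sup_add_finrank_inf_eq W (X ⊓ perp Q W)
  have h2 : W ⊓ (X ⊓ perp Q W) = X ⊓ W := by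
    refine le_antisymm (le_inf (inf_le_right.trans inf_le_left) inf_le_left)
      (le_inf inf_le_right (le_inf inf_le_left (inf_le_right.trans hW.le_perp)))
  have h3 : X ⊓ perp Q W = perp Q (X ⊔ W) := by
    rw [← h.perp_inf, h.perp_eq hX]
  have h4 := h.finrank_perp (X ⊔ W)
  have h5 := Submodule.finrank_sup_add_finrank_inf_eq X W
  have h6 := hX.2
  rw [← h3] at h4
  rw [h2] at h1
  omega

/-- `dim (X ⊓ perp W)` for maximal `X`. -/
theorem finrank_inf_perp (h : PlusSpace Q m) {X : Submodule F V} (hX : IsMaxTS Q m X)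
    (W : Submodule F V) :
    finrank F (X ⊓ perp Q W : Submodule F V) + finrank F W =
      m + finrank F (X ⊓ W : Submodule F V) := by
  have := h.finite
  have h3 : X ⊓ perp Q W = perp Q (X ⊔ W) := by
    rw [← h.perp_inf, h.perp_eq hX]
  have h4 := h.finrank_perp (X ⊔ W)
  have h5 := Submodule.finrank_sup_add_finrank_inf_eq X W
  have h6 := hX.2
  rw [← h3] at h4
  omega

theorem eq_of_le (h : PlusSpace Q m) {X Y : Submodule F V} (hX : IsMaxTS Q m X)
    (hY : IsMaxTS Q m Y) (hle : X ≤ Y) : X = Y := by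
  have := h.finite
  exact Submodule.eq_of_le_of_finrank_eq hle (hX.2.trans hY.2.symm)

/-- Two maximal totally singular subspaces meeting in a hyperplane `H` are the only ones that
contain `H`. -/
theorem eq_or_eq_of_hyperplane (h : PlusSpace Q m) {X Y Z : Submodule F V} (hX : IsMaxTS Q m X)
    (hY : IsMaxTS Q m Y) (hZ : IsMaxTS Q m Z)
    (hYZ : finrank F (Y ⊓ Z : Submodule F V) + 1 = m) (hle : Y ⊓ Z ≤ X) : X = Y ∨ X = Z := by
  have := h.finite
  have hXp : X ≤ Y ⊔ Z := by
    have h1 : perp Q (Y ⊓ Z) = Y ⊔ Z := by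
      rw [← h.perp_perp (Y ⊔ Z), ← h.perp_inf, h.perp_eq hY, h.perp_eq hZ]
    rw [← h1]
    exact hX.1.le_perp.trans (perp_anti hle)
  -- Write x = y + z; then Q(x) = 0 says that y and z are orthogonal. If y is not in Z, then Y is
  -- spanned by Y ∩ Z and y, so z is orthogonal to Y and hence lies in it.
  have key : ∀ x ∈ X, x ∈ Y ∨ x ∈ Z := by
    intro x hx
    obtain ⟨y, hy, z, hz, rfl⟩ := Submodule.mem_sup.1 (hXp hx)
    by_cases hyz : y ∈ Z
    · exact Or.inr (Z.add_mem hyz hz)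
    left
    refine Y.add_mem hy (h.mem_of_perp hY ?_)
    have h1 : Y ⊓ Z ⊔ Submodule.span F {y} = Y := by
      refine Submodule.eq_of_le_of_finrank_le
        (sup_le inf_le_left ((Submodule.span_singleton_le_iff_mem _ _).2 hy)) ?_
      have h2 : Y ⊓ Z < Y ⊓ Z ⊔ Submodule.span F {y} :=
        Submodule.lt_sup_iff_notMem.2 fun h3 => hyz h3.2
      have h3 := Submodule.finrank_lt_finrank_of_lt h2
      have h4 := hY.2
      omega
    intro s hs
    rw [← h1] at hs
    obtain ⟨a, ha, b, hb, rfl⟩ := Submodule.mem_sup.1 hs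
    obtain ⟨c, rfl⟩ := Submodule.mem_span_singleton.1 hb
    have h5 : polar Q y z = 0 := by
      have h6 := hX.1 _ hx
      rwa [QuadraticMap.map_add (f := Q), hY.1 y hy, hZ.1 z hz, zero_add, zero_add] at h6
    rw [polar_add_left, polar_smul_left, h5, hZ.1.polar_eq_zero ha.2 hz]; simp
  -- A subspace covered by two subspaces lies in one of them.
  by_cases hXY : X ≤ Y
  · exact Or.inl (h.eq_of_le hX hY hXY)
  right
  refine h.eq_of_le hX hZ fun z hz => ?_
  obtain ⟨x, hx, hxY⟩ := Set.not_subset.1 hXY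
  have hxZ := (key x hx).resolve_left hxY
  rcases key z hz with hzY | hzZ
  · have h1 : x + z ∉ Y := fun h2 => hxY (by simpa using Y.sub_mem h2 hzY)
    simpa using Z.sub_mem ((key _ (X.add_mem hx hz)).resolve_left h1) hxZ
  · exact hzZ

/-- With H = Y ∩ Z, the subspace H + (X ∩ H^⊥) is maximal and contains H, so it is Y or Z. That one
contains X ∩ H^⊥, which exceeds X ∩ H by one dimension, while the other meets X in X ∩ H. -/
theorem finrank_inf_of_hyperplane (h : PlusSpace Q m) {X Y Z : Submodule F V} (hX : IsMaxTS Q m X)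
    (hY : IsMaxTS Q m Y) (hZ : IsMaxTS Q m Z)
    (hYZ : finrank F (Y ⊓ Z : Submodule F V) + 1 = m) :
    finrank F (X ⊓ Y : Submodule F V) = finrank F (X ⊓ Z : Submodule F V) + 1 ∨
      finrank F (X ⊓ Z : Submodule F V) = finrank F (X ⊓ Y : Submodule F V) + 1 := by
  have aux : ∀ {Y Z : Submodule F V}, IsMaxTS Q m Y → IsMaxTS Q m Z →
      finrank F (Y ⊓ Z : Submodule F V) + 1 = m → Y ⊓ Z ⊔ (X ⊓ perp Q (Y ⊓ Z)) = Y →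
      finrank F (X ⊓ Y : Submodule F V) = finrank F (X ⊓ Z : Submodule F V) + 1 := by
    intro Y Z hY hZ hYZ he
    have h1 : X ⊓ perp Q (Y ⊓ Z) ≤ Y := le_sup_right.trans he.le
    have h2 : X ⊓ Y = X ⊓ perp Q (Y ⊓ Z) :=
      le_antisymm (inf_le_inf_left X (hY.1.le_perp.trans (perp_anti inf_le_left)))
        (le_inf inf_le_left h1)
    have h3 : X ⊓ Z = X ⊓ (Y ⊓ Z) := by
      refine le_antisymm (le_inf inf_le_left (le_inf ?_ inf_le_right))
        (inf_le_inf_left X inf_le_right)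
      exact (inf_le_inf_left X (hZ.1.le_perp.trans (perp_anti inf_le_right))).trans h1
    have h4 := h.finrank_inf_perp hX (Y ⊓ Z)
    rw [← h2, ← h3] at h4
    omega
  rcases h.eq_or_eq_of_hyperplane (h.isMaxTS_sup_inf hX (hY.1.mono inf_le_left)) hY hZ hYZ
    le_sup_left with h1 | h1
  · exact Or.inl (aux hY hZ hYZ h1)
  · refine Or.inr (aux hZ hY (by rwa [inf_comm]) ?_)
    rwa [inf_comm Z Y]

/-- Induction on the codimension `r` of Y ∩ Z. A vector y of Y outside Z gives the maximal subspace
Y' = ⟨y⟩ + (Z ∩ y^⊥), which meets Z in a hyperplane and is one step closer to Y; each such step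
changes the parity of the intersection with X. -/
theorem even_finrank_inf (h : PlusSpace Q m) {X : Submodule F V} (hX : IsMaxTS Q m X) :
    ∀ (r : ℕ) {Y Z : Submodule F V}, IsMaxTS Q m Y → IsMaxTS Q m Z →
      finrank F (Y ⊓ Z : Submodule F V) + r = m →
      Even (finrank F (X ⊓ Y : Submodule F V) + finrank F (X ⊓ Z : Submodule F V) + r) := by
  have := h.finite
  intro r
  induction r with
  | zero =>
    intro Y Z hY hZ hr
    have h1 : Y ⊓ Z = Y := Submodule.eq_of_le_of_finrank_eq inf_le_left (by have := hY.2; omega)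
    have h2 : Y = Z := h.eq_of_le hY hZ (inf_eq_left.1 h1)
    subst h2
    exact ⟨_, rfl⟩
  | succ r ih =>
    intro Y Z hY hZ hr
    have hYZ : ¬ Y ≤ Z := fun hle => by
      rw [inf_eq_left.2 hle, hY.2] at hr; omega
    obtain ⟨y, hy, hyZ⟩ := Set.not_subset.1 hYZ
    have hyZ' : y ∉ Z := hyZ
    have hts := isTotallySingular_span_singleton (hY.1 y hy)
    have hY' := h.isMaxTS_sup_inf hZ hts
    have hne : y ≠ 0 := fun h0 => hyZ' (h0 ▸ Z.zero_mem)
    have d1 := h.finrank_inf_perp hZ (Submodule.span F {y})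
    have d2 : Z ⊓ Submodule.span F {y} = ⊥ := by
      rw [eq_bot_iff]
      rintro x ⟨hx1, hx2⟩
      obtain ⟨c, rfl⟩ := Submodule.mem_span_singleton.1 hx2
      by_cases hc : c = 0
      · simp [hc]
      · exact absurd ((Z.smul_mem_iff hc).1 hx1) hyZ'
    rw [d2, finrank_bot, finrank_span_singleton hne] at d1
    set Y' := Submodule.span F {y} ⊔ (Z ⊓ perp Q (Submodule.span F {y})) with hY'def
    have hyY' : y ∈ Y' := Submodule.mem_sup_left (Submodule.mem_span_singleton_self y)
    have d3 : finrank F (Z ⊓ Y' : Submodule F V) + 1 = m := by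
      have e1 : Z ⊓ perp Q (Submodule.span F {y}) ≤ Z ⊓ Y' := le_inf inf_le_left le_sup_right
      have e2 := Submodule.finrank_mono e1
      have e3 : Z ⊓ Y' < Y' := lt_of_le_of_ne inf_le_right fun he =>
        hyZ' ((he.symm ▸ hyY' : y ∈ Z ⊓ Y').1)
      have e4 := Submodule.finrank_lt_finrank_of_lt e3
      have e5 := hY'.2
      omega
    have d4 : Y ⊓ Z ≤ Y ⊓ Y' := by
      refine le_inf inf_le_left (le_trans (le_inf inf_le_right ?_) le_sup_right)
      rintro x ⟨hx, -⟩
      exact mem_perp_span.2 (by rintro w rfl; exact hY.1.polar_eq_zero hy hx)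
    have d5 : Y ⊓ Z < Y ⊓ Y' := lt_of_le_of_ne d4 fun he =>
      hyZ' ((he.symm ▸ (⟨hy, hyY'⟩ : y ∈ Y ⊓ Y') : y ∈ Y ⊓ Z).2)
    have d6 := Submodule.finrank_lt_finrank_of_lt d5
    have d7 := h.finrank_inf_of_hyperplane hY hZ hY' d3
    have d8 := ih hY hY' (by omega)
    have d9 := h.finrank_inf_of_hyperplane hX hZ hY' d3
    rw [Nat.even_iff] at d8 ⊢
    omega

/-- Parity of the pairwise intersections of three maximal totally singular subspaces. -/
theorem even_finrank (h : PlusSpace Q m) {X Y Z : Submodule F V} (hX : IsMaxTS Q m X)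
    (hY : IsMaxTS Q m Y) (hZ : IsMaxTS Q m Z) :
    Even (finrank F (X ⊓ Y : Submodule F V) + finrank F (X ⊓ Z : Submodule F V) +
      finrank F (Y ⊓ Z : Submodule F V) + m) := by
  have := h.finite
  have h1 := Submodule.finrank_mono (inf_le_left : Y ⊓ Z ≤ Y)
  have h2 := hY.2
  have h3 := h.even_finrank_inf hX (m - finrank F (Y ⊓ Z : Submodule F V)) hY hZ (by omega)
  rw [Nat.even_iff] at h3 ⊢
  omega

end PlusSpace

/-! ### Root elements and maximal totally singular subspaces -/

/-- A vector z of X is orthogonal to a u + b v, and this makes its displacement B(u, z) v - B(v, z)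
u a multiple of a u + b v. -/
theorem map_root_eq_of_mem [FiniteDimensional F V] {X : Submodule F V}
    (hX : IsTotallySingular Q X) {u v : V} (h : SingularPair Q u v) {a b : F}
    (hab : a ≠ 0 ∨ b ≠ 0) (hmem : a • u + b • v ∈ X) :
    X.map (root u v h : V →ₗ[F] V) = X := by
  refine map_eq_of_le fun z hz => X.add_mem hz ?_
  change polar Q u z • v - polar Q v z • u ∈ X
  have h1 := hX.polar_eq_zero hmem hz
  rw [polar_add_left, polar_smul_left, polar_smul_left, smul_eq_mul, smul_eq_mul] at h1
  rcases hab with ha | hb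
  · have e : polar Q u z • v - polar Q v z • u = (-(polar Q v z) * a⁻¹) • (a • u + b • v) := by
      have : polar Q u z = -(polar Q v z) * a⁻¹ * b := by field_simp; linear_combination h1
      rw [this]
      match_scalars <;> field_simp
    rw [e]; exact X.smul_mem _ hmem
  · have e : polar Q u z • v - polar Q v z • u = (polar Q u z * b⁻¹) • (a • u + b • v) := by
      have : polar Q v z = -(polar Q u z) * b⁻¹ * a := by field_simp; linear_combination h1
      rw [this]
      match_scalars <;> field_simp
    rw [e]; exact X.smul_mem _ hmem

theorem polar_eq_zero_of_root_sub_mem {X : Submodule F V} {u v z : V}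
    (hind : ∀ a b : F, a • u + b • v ∈ X → a = 0 ∧ b = 0)
    (hz : polar Q u z • v - polar Q v z • u ∈ X) : polar Q u z = 0 ∧ polar Q v z = 0 := by
  have h1 := hind (-polar Q v z) (polar Q u z) (by convert hz using 1; module)
  exact ⟨h1.2, neg_eq_zero.1 h1.1⟩

/-- Converse of `map_root_eq_of_mem` for maximal X. If X contained no such combination, the
displacements of its vectors, which lie in X, would all vanish; then u would be in X^⊥ = X. -/
theorem PlusSpace.exists_mem_of_map_root_eq (hQ : PlusSpace Q m) {X : Submodule F V}
    (hX : IsMaxTS Q m X) {u v : V} (h : SingularPair Q u v)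
    (hmap : X.map (root u v h : V →ₗ[F] V) = X) :
    ∃ a b : F, (a ≠ 0 ∨ b ≠ 0) ∧ a • u + b • v ∈ X := by
  by_contra! hcon
  have hind : ∀ a b : F, a • u + b • v ∈ X → a = 0 ∧ b = 0 := fun a b hab => by
    by_contra hne
    exact hcon a b (by tauto) hab
  have hu : u ∈ X := by
    refine hQ.mem_of_perp hX fun s hs => ?_
    have h1 : root u v h s ∈ X := by
      rw [← hmap]; exact ⟨s, hs, rfl⟩
    rw [root_apply] at h1
    rw [polar_comm]
    exact (polar_eq_zero_of_root_sub_mem hind ((X.add_mem_iff_right hs).1 h1)).1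
  exact one_ne_zero (hind 1 0 (by simpa using hu)).1

/-- Root elements preserve each family: X equals its image, or X misses ⟨u, v⟩ and meets its image
in X ∩ ⟨u, v⟩^⊥, of codimension two. -/
theorem PlusSpace.even_finrank_inf_map_root (hQ : PlusSpace Q m) {X : Submodule F V}
    (hX : IsMaxTS Q m X) {u v : V} (h : SingularPair Q u v) :
    Even (finrank F (X ⊓ X.map (root u v h : V →ₗ[F] V) : Submodule F V) + m) := by
  have := hQ.finite
  by_cases hmap : X.map (root u v h : V →ₗ[F] V) = X
  · rw [hmap, inf_idem, hX.2]; exact ⟨_, rfl⟩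
  have hind : ∀ a b : F, a • u + b • v ∈ X → a = 0 ∧ b = 0 := fun a b hab => by
    by_contra hne
    exact hmap (map_root_eq_of_mem hX.1 h (by tauto) hab)
  have h1 : X ⊓ X.map (root u v h : V →ₗ[F] V) = X ⊓ perp Q (Submodule.span F {u, v}) := by
    ext z
    constructor
    · rintro ⟨hz, y, hy, rfl⟩
      have h2 : root u v h y ∈ X := hz
      rw [root_apply] at h2
      have h3 := polar_eq_zero_of_root_sub_mem hind ((X.add_mem_iff_right hy).1 h2)
      have h4 : root u v h y = y := by rw [root_apply, h3.1, h3.2]; simp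
      refine ⟨hz, ?_⟩
      change root u v h y ∈ _
      rw [h4]
      exact mem_perp_span.2 (by rintro w (rfl | rfl); exacts [h3.1, h3.2])
    · rintro ⟨hz, hp⟩
      refine ⟨hz, z, hz, ?_⟩
      change root u v h z = z
      have h3 : polar Q u z = 0 := mem_perp_span.1 hp u (by simp)
      have h4 : polar Q v z = 0 := mem_perp_span.1 hp v (by simp)
      rw [root_apply, h3, h4]; simp
  have h2 : X ⊓ Submodule.span F {u, v} = ⊥ := by
    rw [eq_bot_iff]
    rintro x ⟨hx1, hx2⟩
    obtain ⟨a, b, rfl⟩ := Submodule.mem_span_pair.1 hx2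
    obtain ⟨rfl, rfl⟩ := hind a b hx1
    simp
  have h3 : finrank F (Submodule.span F {u, v}) = 2 := by
    have h4 : LinearIndependent F ![u, v] :=
      LinearIndependent.pair_iff.2 fun a b hab => hind a b (hab ▸ X.zero_mem)
    have h5 := finrank_span_eq_card h4
    rwa [Matrix.range_cons, Matrix.range_cons, Matrix.range_empty, Set.union_empty,
      Set.singleton_union, Fintype.card_fin] at h5
  have h4 := hQ.finrank_inf_perp hX (Submodule.span F {u, v})
  rw [h2, finrank_bot, h3] at h4
  rw [h1, Nat.even_iff]
  omega

end Families
end IbisOrth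

namespace IbisOrth
section Action

open QuadraticMap Module

variable {F V : Type*} [Field F] [AddCommGroup V] [Module F V] {Q : QuadraticForm F V} {m : ℕ}

/-! ### The action on a set of subspaces that is stable under root elements -/

/-- A set of subspaces mapped to itself by all long root elements. -/
def RootStable (Q : QuadraticForm F V) (𝒮 : Set (Submodule F V)) : Prop :=
  ∀ u v, ∀ h : SingularPair Q u v, ∀ U ∈ 𝒮, U.map (root u v h : V →ₗ[F] V) ∈ 𝒮

theorem map_mul_eq (g h : V ≃ₗ[F] V) (U : Submodule F V) :
    U.map ((g * h : V ≃ₗ[F] V) : V →ₗ[F] V) = (U.map (h : V →ₗ[F] V)).map (g : V →ₗ[F] V) := by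
  rw [← Submodule.map_comp]; rfl

theorem map_one_eq (U : Submodule F V) : U.map ((1 : V ≃ₗ[F] V) : V →ₗ[F] V) = U :=
  Submodule.map_id U

theorem map_inv_map (g : V ≃ₗ[F] V) (U : Submodule F V) :
    (U.map (g : V →ₗ[F] V)).map ((g⁻¹ : V ≃ₗ[F] V) : V →ₗ[F] V) = U := by
  rw [← map_mul_eq, inv_mul_cancel, map_one_eq]

theorem map_map_inv (g : V ≃ₗ[F] V) (U : Submodule F V) :
    (U.map ((g⁻¹ : V ≃ₗ[F] V) : V →ₗ[F] V)).map (g : V →ₗ[F] V) = U := by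
  rw [← map_mul_eq, mul_inv_cancel, map_one_eq]

theorem root_inv {u v : V} (h : SingularPair Q u v) : (root u v h)⁻¹ = root v u h.symm :=
  LinearEquiv.ext fun _ => rfl

theorem RootStable.map_mem_iff {𝒮 : Set (Submodule F V)} (h : RootStable Q 𝒮) {g : V ≃ₗ[F] V}
    (hg : g ∈ rootGroup Q) : ∀ U : Submodule F V, U.map (g : V →ₗ[F] V) ∈ 𝒮 ↔ U ∈ 𝒮 := by
  induction hg using Subgroup.closure_induction with
  | mem g hg =>
    obtain ⟨u, v, hs, rfl⟩ := hg
    refine fun U => ⟨fun hU => ?_, h u v hs U⟩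
    have := h v u hs.symm _ hU
    rwa [← root_inv hs, map_inv_map] at this
  | one => intro U; rw [map_one_eq]
  | mul a b _ _ iha ihb => intro U; rw [map_mul_eq, iha, ihb]
  | inv a _ iha => intro U; rw [← iha, map_map_inv]

theorem RootStable.exists_perm (hQ : PlusSpace Q m) {𝒮 : Set (Submodule F V)}
    (h : RootStable Q 𝒮) {g : V ≃ₗ[F] V} (hg : g ∈ rootGroup Q) :
    ∃ σ ∈ inducedPerm (omegaGroup Q) 𝒮, ∀ U : 𝒮,
      ((σ U : 𝒮) : Submodule F V) = (U : Submodule F V).map (g : V →ₗ[F] V) := by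
  refine ⟨⟨fun U => ⟨(U : Submodule F V).map (g : V →ₗ[F] V), (h.map_mem_iff hg _).2 U.2⟩,
    fun U => ⟨(U : Submodule F V).map ((g⁻¹ : V ≃ₗ[F] V) : V →ₗ[F] V),
      (h.map_mem_iff ((rootGroup Q).inv_mem hg) _).2 U.2⟩, fun U => Subtype.ext (map_inv_map g _),
    fun U => Subtype.ext (map_map_inv g _)⟩, ⟨g, rootGroup_le_omegaGroup hQ hg, fun _ => rfl⟩,
    fun _ => rfl⟩

variable {𝒮 : Set (Submodule F V)}

/-- The points fixed by the pointwise stabilizer of `A` in `PΩ(V, Q)`. -/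
abbrev omegaClosure (Q : QuadraticForm F V) (𝒮 : Set (Submodule F V)) (A : Set 𝒮) : Set 𝒮 :=
  fixedClosure (inducedPerm (omegaGroup Q) 𝒮) A

theorem RootStable.map_eq_of_mem_omegaClosure (h : RootStable Q 𝒮) (hQ : PlusSpace Q m)
    {A : Set 𝒮} {T : 𝒮} (hT : T ∈ omegaClosure Q 𝒮 A) {g : V ≃ₗ[F] V} (hg : g ∈ rootGroup Q)
    (hA : ∀ a ∈ A, (a : Submodule F V).map (g : V →ₗ[F] V) = a) :
    (T : Submodule F V).map (g : V →ₗ[F] V) = T := by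
  obtain ⟨σ, hσ, hσg⟩ := h.exists_perm hQ hg
  rw [← hσg, hT σ hσ fun a ha => Subtype.ext ((hσg a).trans (hA a ha))]

/-- The source of most upper bounds on closures: a root element that stabilizes each member of `A`
stabilizes `T`, so its displacements on `T` are further vectors of `T`. -/
theorem RootStable.root_sub_mem (h : RootStable Q 𝒮) (hQ : PlusSpace Q m) {A : Set 𝒮} {T : 𝒮}
    (hT : T ∈ omegaClosure Q 𝒮 A) {u v : V} (huv : SingularPair Q u v)
    (hA : ∀ a ∈ A, ∀ z ∈ (a : Submodule F V), polar Q u z • v - polar Q v z • u ∈ a.1) {t : V}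
    (ht : t ∈ T.1) : polar Q u t • v - polar Q v t • u ∈ T.1 := by
  have := hQ.finite
  have h1 := h.map_eq_of_mem_omegaClosure hQ hT (root_mem_rootGroup huv) fun a ha =>
    map_eq_of_le fun z hz => a.1.add_mem hz (hA a ha z hz)
  have h2 : root u v huv t ∈ T.1 := by
    have h3 : root u v huv t ∈ T.1.map (root u v huv : V →ₗ[F] V) := ⟨t, ht, rfl⟩
    rwa [h1] at h3
  exact (T.1.add_mem_iff_right ht).1 h2

/-- The source of lower bounds on closures: a linear argument about isometries is enough. -/
theorem mem_omegaClosure {A : Set 𝒮} {T : 𝒮}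
    (h : ∀ g ∈ isometryGroup Q, (∀ a ∈ A, (a : Submodule F V).map (g : V →ₗ[F] V) = a) →
      (T : Submodule F V).map (g : V →ₗ[F] V) = T) : T ∈ omegaClosure Q 𝒮 A := by
  rintro σ ⟨g, hg, hσ⟩ hA
  refine Subtype.ext ?_
  rw [hσ]
  exact h g (omegaGroup_le_isometryGroup Q hg) fun a ha => by rw [← hσ, hA a ha]

/-- A single long root element showing that `x` is not fixed by the stabilizer of `L`. -/
theorem RootStable.exists_move (h : RootStable Q 𝒮) (hQ : PlusSpace Q m)
    {g : V ≃ₗ[F] V} (hg : g ∈ rootGroup Q) {L : Set 𝒮}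
    (hL : ∀ a ∈ L, ∀ z ∈ a.1, g z ∈ a.1) {x : 𝒮} {z : V} (hz : z ∈ x.1) (hgz : g z ∉ x.1) :
    ∃ σ ∈ inducedPerm (omegaGroup Q) 𝒮, (∀ a ∈ L, σ a = a) ∧ σ x ≠ x := by
  have := hQ.finite
  obtain ⟨σ, hσ, hσg⟩ := h.exists_perm hQ hg
  refine ⟨σ, hσ, fun a ha => Subtype.ext ((hσg a).trans (map_eq_of_le (hL a ha))), fun hx => ?_⟩
  have h1 := hσg x
  rw [hx] at h1
  exact hgz (by rw [h1]; exact ⟨z, hz, rfl⟩)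

theorem RootStable.exists_move_root (h : RootStable Q 𝒮) (hQ : PlusSpace Q m)
    {u v : V} (huv : SingularPair Q u v) {L : Set 𝒮}
    (hL : ∀ a ∈ L, ∀ z ∈ a.1, polar Q u z • v - polar Q v z • u ∈ a.1) {x : 𝒮} {z : V}
    (hz : z ∈ x.1) (hgz : polar Q u z • v - polar Q v z • u ∉ x.1) :
    ∃ σ ∈ inducedPerm (omegaGroup Q) 𝒮, (∀ a ∈ L, σ a = a) ∧ σ x ≠ x :=
  h.exists_move hQ (root_mem_rootGroup huv) (fun a ha z hz => a.1.add_mem hz (hL a ha z hz)) hz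
    fun h1 => hgz ((x.1.add_mem_iff_right hz).1 h1)

theorem rootStable_totallySingular [FiniteDimensional F V] (k : ℕ) :
    RootStable Q (totallySingular Q k) := fun _ _ h U hU =>
  ⟨isTotallySingular_map (root_mem_isometryGroup h) hU.1,
    (LinearEquiv.finrank_map_eq _ U).trans hU.2⟩

/-- By `PlusSpace.even_finrank` the relation that defines the families is transitive, so any member
can serve as the reference member. -/
theorem mem_of_isFamily (hQ : PlusSpace Q m) (h𝒮 : IsFamily Q m 𝒮) {A : Submodule F V}
    (hA : A ∈ 𝒮) (Y : Submodule F V) :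
    Y ∈ 𝒮 ↔ IsMaxTS Q m Y ∧ Even (finrank F (A ⊓ Y : Submodule F V) + m) := by
  have := hQ.finite
  obtain ⟨X, hX, rfl⟩ := h𝒮
  have hX' : IsMaxTS Q m X := hX
  obtain ⟨hA1, hA2⟩ := hA
  have hA1' : IsMaxTS Q m A := hA1
  have key : ∀ {Y : Submodule F V}, Even (finrank F X - finrank F (X ⊓ Y : Submodule F V)) ↔
      Even (finrank F (X ⊓ Y : Submodule F V) + m) := by
    intro Y
    have h1 := Submodule.finrank_mono (inf_le_left : X ⊓ Y ≤ X)
    have h2 := hX'.2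
    rw [Nat.even_iff, Nat.even_iff]
    omega
  rw [key, Nat.even_iff] at hA2
  rw [Set.mem_ofPred_eq, key]
  refine and_congr_right fun hY => ?_
  have hY' : IsMaxTS Q m Y := hY
  have h3 := hQ.even_finrank hX' hA1' hY'
  rw [Nat.even_iff] at h3 ⊢
  rw [Nat.even_iff]
  omega

theorem isMaxTS_of_isFamily (h𝒮 : IsFamily Q m 𝒮) {A : Submodule F V} (hA : A ∈ 𝒮) :
    IsMaxTS Q m A := by
  obtain ⟨X, -, rfl⟩ := h𝒮
  exact hA.1

theorem even_of_isFamily (hQ : PlusSpace Q m) (h𝒮 : IsFamily Q m 𝒮) {A B : Submodule F V}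
    (hA : A ∈ 𝒮) (hB : B ∈ 𝒮) : Even (finrank F (A ⊓ B : Submodule F V) + m) :=
  ((mem_of_isFamily hQ h𝒮 hA B).1 hB).2

theorem rootStable_of_isFamily (hQ : PlusSpace Q m) (h𝒮 : IsFamily Q m 𝒮) : RootStable Q 𝒮 := by
  have := hQ.finite
  intro u v h U hU
  have hU' := isMaxTS_of_isFamily h𝒮 hU
  exact (mem_of_isFamily hQ h𝒮 hU _).2
    ⟨⟨isTotallySingular_map (root_mem_isometryGroup h) hU'.1,
      (LinearEquiv.finrank_map_eq _ U).trans hU'.2⟩, hQ.even_finrank_inf_map_root hU' h⟩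

theorem exists_mem_of_isFamily (h𝒮 : IsFamily Q m 𝒮) : ∃ A, A ∈ 𝒮 := by
  obtain ⟨X, hX, rfl⟩ := h𝒮
  refine ⟨X, hX, ?_⟩
  rw [inf_idem, Nat.sub_self]
  exact Even.zero

/-- If `W` meets `X` trivially, then `W ⊔ (X ⊓ perp W)` meets `X` in codimension `finrank W`. -/
theorem finrank_inf_sup_inf_perp (hQ : PlusSpace Q m) {X W : Submodule F V} (hX : IsMaxTS Q m X)
    (hXW : X ⊓ W = ⊥) :
    finrank F (X ⊓ (W ⊔ (X ⊓ perp Q W)) : Submodule F V) + finrank F W = m := by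
  have h1 : X ⊓ (W ⊔ (X ⊓ perp Q W)) = X ⊓ perp Q W := by
    rw [inf_comm, sup_comm, sup_inf_assoc_of_le W (inf_le_left : X ⊓ perp Q W ≤ X), inf_comm W X,
      hXW, sup_bot_eq]
  have h2 := hQ.finrank_inf_perp hX W
  rw [h1, h2, hXW, finrank_bot, add_zero]

/-! ### Hyperbolic pairs -/

/-- Pairwise orthogonal hyperbolic pairs. -/
structure HypPairs (Q : QuadraticForm F V) {r : ℕ} (e f : Fin r → V) : Prop where
  qe : ∀ i, Q (e i) = 0
  qf : ∀ i, Q (f i) = 0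
  ee : ∀ i j, polar Q (e i) (e j) = 0
  ff : ∀ i j, polar Q (f i) (f j) = 0
  ef : ∀ i j, polar Q (e i) (f j) = if i = j then 1 else 0

namespace HypPairs

variable {r : ℕ} {e f : Fin r → V}

theorem fe (h : HypPairs Q e f) (i j : Fin r) :
    polar Q (f i) (e j) = if i = j then 1 else 0 := by
  rw [polar_comm, h.ef]; exact if_congr eq_comm rfl rfl

theorem symm (h : HypPairs Q e f) : HypPairs Q f e := ⟨h.qf, h.qe, h.ff, h.ee, h.fe⟩

theorem eq_sum (h : HypPairs Q e f) {z : V}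
    (hz : z ∈ Submodule.span F (Set.range e ∪ Set.range f)) :
    z = ∑ i, polar Q (f i) z • e i + ∑ i, polar Q (e i) z • f i := by
  induction hz using Submodule.span_induction with
  | mem w hw =>
    rcases hw with ⟨i, rfl⟩ | ⟨i, rfl⟩
    · simp [h.fe, h.ee]
    · simp [h.ef, h.ff]
  | zero => simp
  | add a b _ _ ha hb =>
    simp only [polar_add_right, add_smul, Finset.sum_add_distrib]
    conv_lhs => rw [ha, hb]
    abel
  | smul c a _ ha =>
    simp only [polar_smul_right, smul_eq_mul, mul_smul, ← Finset.smul_sum, ← smul_add]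
    conv_lhs => rw [ha]

theorem linearIndependent_right (h : HypPairs Q e f) : LinearIndependent F f := by
  rw [Fintype.linearIndependent_iff]
  intro c hc i
  have h1 : polar Q (e i) (∑ j, c j • f j) = c i := by
    have : polar Q (e i) (∑ j, c j • f j) = (polarBilin Q (e i)) (∑ j, c j • f j) := rfl
    rw [this, map_sum]
    simp only [map_smul, polarBilin_apply_apply, h.ef]
    simp
  rw [← h1, hc, polar_zero_right]

theorem finrank_span_right (h : HypPairs Q e f) : finrank F (Submodule.span F (Set.range f)) = r := by
  rw [finrank_span_eq_card h.linearIndependent_right, Fintype.card_fin]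

theorem inf_span_right (h : HypPairs Q e f) {X : Submodule F V} (hX : IsTotallySingular Q X)
    (he : ∀ i, e i ∈ X) : X ⊓ Submodule.span F (Set.range f) = ⊥ := by
  rw [eq_bot_iff]
  rintro x ⟨hx, hxf⟩
  have h1 := h.eq_sum (Submodule.span_mono Set.subset_union_right hxf)
  have h2 : ∀ i, polar Q (f i) x = 0 := fun i => by
    have h3 : f i ∈ perp Q (Submodule.span F (Set.range f)) :=
      mem_perp_span.2 (by rintro _ ⟨j, rfl⟩; exact h.ff j i)
    rw [polar_comm]
    exact h3 x hxf
  have h3 : ∀ i, polar Q (e i) x = 0 := fun i => hX.polar_eq_zero (he i) hx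
  simp only [h2, h3, zero_smul, Finset.sum_const_zero, add_zero] at h1
  exact h1

theorem finrank_inf_perp (h : HypPairs Q e f) (hQ : PlusSpace Q m) {X : Submodule F V}
    (hX : IsMaxTS Q m X) (he : ∀ i, e i ∈ X) :
    finrank F (X ⊓ perp Q (Submodule.span F (Set.range f)) : Submodule F V) + r = m := by
  have h1 := hQ.finrank_inf_perp hX (Submodule.span F (Set.range f))
  rwa [h.inf_span_right hX.1 he, h.finrank_span_right, finrank_bot, add_zero] at h1

end HypPairs

/-- One pair at a time: X ∩ ⟨f⟩^⊥ has dimension m - r > 0, and a nonzero vector in it has a singular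
dual orthogonal to the pairs found so far. -/
theorem PlusSpace.exists_hypPairs (hQ : PlusSpace Q m) {X : Submodule F V} (hX : IsMaxTS Q m X) :
    ∀ r ≤ m, ∃ e f : Fin r → V, HypPairs Q e f ∧ ∀ i, e i ∈ X
  | 0, _ => ⟨Fin.elim0, Fin.elim0, ⟨fun i => i.elim0, fun i => i.elim0, fun i => i.elim0,
      fun i => i.elim0, fun i => i.elim0⟩, fun i => i.elim0⟩
  | r + 1, hr => by
    have := hQ.finite
    obtain ⟨e, f, h, he⟩ := hQ.exists_hypPairs hX r (by omega)
    have hU := h.finrank_inf_perp hQ hX he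
    set U := X ⊓ perp Q (Submodule.span F (Set.range f))
    have hU0 : U ≠ ⊥ := fun h0 => by rw [h0, finrank_bot] at hU; omega
    obtain ⟨x, hx, hx0⟩ := Submodule.exists_mem_ne_zero_of_ne_bot hU0
    have hfx : ∀ i, polar Q (f i) x = 0 := fun i => mem_perp_span.1 hx.2 _ ⟨i, rfl⟩
    have hex : ∀ i, polar Q (e i) x = 0 := fun i => hX.1.polar_eq_zero (he i) hx.1
    have hxW : x ∉ Submodule.span F (Set.range e ∪ Set.range f) := fun hx' => by
      have h1 := h.eq_sum hx'
      simp only [hfx, hex, zero_smul, Finset.sum_const_zero, add_zero] at h1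
      exact hx0 h1
    have hxp : x ∈ perp Q (Submodule.span F (Set.range e ∪ Set.range f)) :=
      mem_perp_span.2 (by rintro _ (⟨i, rfl⟩ | ⟨i, rfl⟩); exacts [hex i, hfx i])
    obtain ⟨y, hy, hy0, hxy⟩ := hQ.exists_singular_dual hxW (hX.1 x hx.1) hxp
    have hfy : ∀ i, polar Q (f i) y = 0 := fun i => mem_perp_span.1 hy _ (Or.inr ⟨i, rfl⟩)
    have hey : ∀ i, polar Q (e i) y = 0 := fun i => mem_perp_span.1 hy _ (Or.inl ⟨i, rfl⟩)
    refine ⟨Fin.snoc (α := fun _ => V) e x, Fin.snoc (α := fun _ => V) f y, ⟨?_, ?_, ?_, ?_, ?_⟩,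
      ?_⟩
    · exact fun i => Fin.lastCases (by simpa using hX.1 x hx.1) (fun i => by simpa using h.qe i) i
    · exact fun i => Fin.lastCases (by simpa using hy0) (fun i => by simpa using h.qf i) i
    · refine fun i j => Fin.lastCases ?_ (fun i => ?_) i <;>
        refine Fin.lastCases ?_ (fun j => ?_) j
      · simp [polar_self, hX.1 x hx.1]
      · simpa [polar_comm Q x] using hex j
      · simpa using hex i
      · simpa using h.ee i j
    · refine fun i j => Fin.lastCases ?_ (fun i => ?_) i <;>
        refine Fin.lastCases ?_ (fun j => ?_) j
      · simp [polar_self, hy0]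
      · simpa [polar_comm Q y] using hfy j
      · simpa using hfy i
      · simpa using h.ff i j
    · refine fun i j => Fin.lastCases ?_ (fun i => ?_) i <;>
        refine Fin.lastCases ?_ (fun j => ?_) j
      · simpa using hxy
      · have : Fin.last r ≠ j.castSucc := (Fin.castSucc_lt_last j).ne'
        simpa [polar_comm Q x, this] using hfx j
      · have : i.castSucc ≠ Fin.last r := (Fin.castSucc_lt_last i).ne
        simpa [this] using hey i
      · simpa using h.ef i j
    · exact fun i => Fin.lastCases (by simpa using hx.1) (fun i => by simpa using he i) i

theorem finrank_sup_span_singleton [FiniteDimensional F V] {W : Submodule F V} {a : V}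
    (ha : a ∉ W) : finrank F (W ⊔ Submodule.span F {a} : Submodule F V) = finrank F W + 1 := by
  have h0 : a ≠ 0 := fun h => ha (h ▸ W.zero_mem)
  have h1 := Submodule.finrank_sup_add_finrank_inf_eq W (Submodule.span F {a})
  have h2 : W ⊓ Submodule.span F {a} = ⊥ := by
    rw [eq_bot_iff]
    rintro x ⟨hx1, hx2⟩
    obtain ⟨c, rfl⟩ := Submodule.mem_span_singleton.1 hx2
    by_cases hc : c = 0
    · simp [hc]
    · exact absurd ((W.smul_mem_iff hc).1 hx1) ha
  rw [h2, finrank_bot, finrank_span_singleton h0] at h1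
  omega

theorem finrank_span_singleton_le_one [FiniteDimensional F V] (a : V) :
    finrank F (Submodule.span F {a}) ≤ 1 := by
  by_cases h : a = 0
  · rw [h, Submodule.span_zero_singleton, finrank_bot]; exact zero_le_one
  · rw [finrank_span_singleton h]

/-- A vector in all members of `A` lies in every member of the closure of `A`. -/
theorem RootStable.mem_of_mem_omegaClosure (h : RootStable Q 𝒮) (hQ : PlusSpace Q m)
    {A : Set 𝒮} {T : 𝒮} (hT : T ∈ omegaClosure Q 𝒮 A) (hTs : IsTotallySingular Q T.1)
    (hT2 : 2 ≤ finrank F T.1) {w : V}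
    (hAs : ∀ a ∈ A, IsTotallySingular Q a.1) (hw : ∀ a ∈ A, w ∈ a.1) (hws : Q w = 0) :
    w ∈ T.1 := by
  have := hQ.finite
  by_contra hwT
  -- The root element of (w, v) stabilizes every totally singular subspace through w.
  have key : ∀ v, Q v = 0 → polar Q w v = 0 → ∀ t ∈ T.1,
      polar Q w t • v - polar Q v t • w ∈ T.1 := by
    intro v hv hwv t ht
    refine h.root_sub_mem hQ hT ⟨hws, hv, hwv⟩ (fun a ha z hz => ?_) ht
    rw [(hAs a ha).polar_eq_zero (hw a ha) hz, zero_smul, zero_sub]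
    exact a.1.neg_mem (a.1.smul_mem _ (hw a ha))
  by_cases hp : ∀ t ∈ T.1, polar Q w t = 0
  · obtain ⟨t, ht, htw⟩ : ∃ t ∈ T.1, t ∉ Submodule.span F {w} := by
      by_contra! hcon
      have h1 : finrank F T.1 ≤ finrank F (Submodule.span F {w}) := Submodule.finrank_mono hcon
      have h2 := finrank_span_singleton_le_one (F := F) w
      omega
    obtain ⟨v, hv, hv0, hne⟩ := hQ.exists_singular_polar_ne_zero
      (isTotallySingular_span_singleton hws) htw
    have h1 := key v hv0 (mem_perp_span.1 hv w rfl) t ht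
    rw [hp t ht, zero_smul, zero_sub, T.1.neg_mem_iff, polar_comm, T.1.smul_mem_iff hne] at h1
    exact hwT h1
  · push Not at hp
    obtain ⟨t, ht, hne⟩ := hp
    obtain ⟨X, hX, hwX⟩ := hQ.exists_isMaxTS (isTotallySingular_span_singleton hws)
    have hwX' : w ∈ X := hwX (Submodule.mem_span_singleton_self w)
    obtain ⟨x, hx, hxw⟩ : ∃ x ∈ X, x ∉ Submodule.span F {w} := by
      by_contra! hcon
      have h1 : finrank F X ≤ finrank F (Submodule.span F {w}) := Submodule.finrank_mono hcon
      have h2 := finrank_span_singleton_le_one (F := F) w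
      have h3 := hX.2
      have h4 := hQ.three_le
      omega
    have hwx := hX.1.polar_eq_zero hwX' hx
    obtain ⟨y, hy, hy0, hxy⟩ := hQ.exists_singular_dual hxw (hX.1 x hx)
      (mem_perp_span.2 (by rintro _ rfl; exact hwx))
    have hwy : polar Q w y = 0 := mem_perp_span.1 hy w rfl
    -- With x, y a hyperbolic pair in w^⊥, the two vectors of `T` have polar value B(w, t)², which
    -- must vanish.
    have h1 := hTs.polar_eq_zero (key x (hX.1 x hx) hwx t ht) (key y hy0 hwy t ht)
    simp only [polar_sub_left, polar_sub_right, polar_smul_left, polar_smul_right, hxy, hwy,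
      polar_comm Q x w, hwx, polar_self, hws, smul_zero, smul_eq_mul, mul_one,
      mul_zero, sub_zero, mul_eq_zero, or_self] at h1
    exact hne h1

end Action
end IbisOrth

namespace IbisOrth
section Intermediate

open QuadraticMap Module

variable {F V : Type*} [Field F] [AddCommGroup V] [Module F V] {Q : QuadraticForm F V} {m k : ℕ}

/-! ### Totally singular subspaces of intermediate dimension -/

/-- The subspace spanned by `W`, `a` and `b`. -/
def extendBy (W : Submodule F V) (a b : V) : Submodule F V :=
  W ⊔ Submodule.span F {a} ⊔ Submodule.span F {b}

theorem mem_extendBy {W : Submodule F V} {a b z : V} :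
    z ∈ extendBy W a b ↔ ∃ w ∈ W, ∃ x y : F, z = w + x • a + y • b := by
  constructor
  · intro hz
    obtain ⟨u, hu, v, hv, rfl⟩ := Submodule.mem_sup.1 hz
    obtain ⟨w, hw, w', hw', rfl⟩ := Submodule.mem_sup.1 hu
    obtain ⟨x, rfl⟩ := Submodule.mem_span_singleton.1 hw'
    obtain ⟨y, rfl⟩ := Submodule.mem_span_singleton.1 hv
    exact ⟨w, hw, x, y, rfl⟩
  · rintro ⟨w, hw, x, y, rfl⟩
    exact Submodule.add_mem_sup (Submodule.add_mem_sup hw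
      (Submodule.smul_mem _ _ (Submodule.mem_span_singleton_self a)))
      (Submodule.smul_mem _ _ (Submodule.mem_span_singleton_self b))

theorem le_extendBy {W : Submodule F V} {a b : V} : W ≤ extendBy W a b :=
  le_sup_left.trans le_sup_left

theorem left_mem_extendBy {W : Submodule F V} {a b : V} : a ∈ extendBy W a b :=
  mem_extendBy.2 ⟨0, W.zero_mem, 1, 0, by simp⟩

theorem right_mem_extendBy {W : Submodule F V} {a b : V} : b ∈ extendBy W a b :=
  mem_extendBy.2 ⟨0, W.zero_mem, 0, 1, by simp⟩

theorem extendBy_le {W U : Submodule F V} {a b : V} (hW : W ≤ U) (ha : a ∈ U) (hb : b ∈ U) :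
    extendBy W a b ≤ U :=
  sup_le (sup_le hW ((Submodule.span_singleton_le_iff_mem _ _).2 ha))
    ((Submodule.span_singleton_le_iff_mem _ _).2 hb)

theorem extendBy_comm (W : Submodule F V) (a b : V) : extendBy W a b = extendBy W b a := by
  rw [extendBy, sup_right_comm]; rfl

theorem isTotallySingular_extendBy {W : Submodule F V} (hW : IsTotallySingular Q W) {a b : V}
    (h : SingularPair Q a b) (ha : ∀ w ∈ W, polar Q a w = 0) (hb : ∀ w ∈ W, polar Q b w = 0) :
    IsTotallySingular Q (extendBy W a b) := by
  refine (hW.sup (isTotallySingular_span_singleton h.1) ?_).sup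
    (isTotallySingular_span_singleton h.2.1) ?_
  · rw [Submodule.span_singleton_le_iff_mem]
    exact fun w hw => (polar_comm Q w a).trans (ha w hw)
  · rw [Submodule.span_singleton_le_iff_mem, mem_perp]
    intro w hw
    obtain ⟨w', hw', c, hc, rfl⟩ := Submodule.mem_sup.1 hw
    obtain ⟨c, rfl⟩ := Submodule.mem_span_singleton.1 hc
    rw [polar_add_left, polar_comm Q w', hb w' hw', polar_smul_left, h.2.2]; simp

/-- The configuration of hyperbolic pairs orthogonal to a totally singular subspace `W` from which
a special pair of `k`-dimensional totally singular subspaces is made. -/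
structure SpecialConfig (Q : QuadraticForm F V) (k : ℕ) (W : Submodule F V) (e f : Fin 3 → V) :
    Prop where
  hyp : HypPairs Q e f
  ts : IsTotallySingular Q W
  we : ∀ i, ∀ w ∈ W, polar Q (e i) w = 0
  wf : ∀ i, ∀ w ∈ W, polar Q (f i) w = 0
  dim : finrank F W + 2 = k

namespace SpecialConfig

variable {W : Submodule F V} {e f : Fin 3 → V}

/-- A symmetry of the configuration that exchanges the two ends and keeps the midpoint, so that each
argument is needed for one end only. -/
theorem swap (h : SpecialConfig Q k W e f) :
    SpecialConfig Q k W ![f 0, e 2, e 1] ![e 0, f 2, f 1] where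
  hyp := by
    obtain ⟨h1, h2, h3, h4, h5⟩ := h.hyp
    have h6 := h.hyp.fe
    constructor
    · intro i; fin_cases i <;> simp [h1, h2]
    · intro i; fin_cases i <;> simp [h1, h2]
    · intro i j; fin_cases i <;> fin_cases j <;> simp [h3, h4, h5, h6, -polar_self]
    · intro i j; fin_cases i <;> fin_cases j <;> simp [h3, h4, h5, h6, -polar_self]
    · intro i j; fin_cases i <;> fin_cases j <;> simp [h3, h4, h5, h6, -polar_self]
  ts := h.ts
  we := by intro i w hw; fin_cases i <;> simp [h.we _ w hw, h.wf _ w hw]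
  wf := by intro i w hw; fin_cases i <;> simp [h.we _ w hw, h.wf _ w hw]
  dim := h.dim

theorem singularPair (h : SpecialConfig Q k W e f) (i j : Fin 3) : SingularPair Q (e i) (e j) :=
  ⟨h.hyp.qe i, h.hyp.qe j, h.hyp.ee i j⟩

theorem singularPair_ef (h : SpecialConfig Q k W e f) {i j : Fin 3} (hij : i ≠ j) :
    SingularPair Q (e i) (f j) :=
  ⟨h.hyp.qe i, h.hyp.qf j, by rw [h.hyp.ef, if_neg hij]⟩

theorem finrank_extendBy [FiniteDimensional F V] (h : SpecialConfig Q k W e f) {a b p q : V}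
    (hp : ∀ w ∈ W, polar Q p w = 0) (hpa : polar Q p a ≠ 0)
    (hq : ∀ w ∈ W, polar Q q w = 0) (hqa : polar Q q a = 0) (hqb : polar Q q b ≠ 0) :
    finrank F (extendBy W a b) = k := by
  rw [extendBy, finrank_sup_span_singleton, finrank_sup_span_singleton, ← h.dim]
  · exact fun ha => hpa (hp a ha)
  · intro hb
    obtain ⟨w, hw, c, hc, rfl⟩ := Submodule.mem_sup.1 hb
    obtain ⟨c, rfl⟩ := Submodule.mem_span_singleton.1 hc
    rw [polar_add_right, polar_smul_right, hq w hw, hqa] at hqb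
    simp at hqb

theorem left_mem [FiniteDimensional F V] (h : SpecialConfig Q k W e f) :
    extendBy W (e 0) (e 1) ∈ totallySingular Q k :=
  ⟨isTotallySingular_extendBy h.ts (h.singularPair 0 1) (h.we 0) (h.we 1),
    h.finrank_extendBy (p := f 0) (q := f 1) (h.wf 0) (by simp [h.hyp.fe]) (h.wf 1)
      (by simp [h.hyp.fe]) (by simp [h.hyp.fe])⟩

theorem middle_mem [FiniteDimensional F V] (h : SpecialConfig Q k W e f) :
    extendBy W (e 1) (e 2) ∈ totallySingular Q k :=
  ⟨isTotallySingular_extendBy h.ts (h.singularPair 1 2) (h.we 1) (h.we 2),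
    h.finrank_extendBy (p := f 1) (q := f 2) (h.wf 1) (by simp [h.hyp.fe]) (h.wf 2)
      (by simp [h.hyp.fe]) (by simp [h.hyp.fe])⟩

theorem right_mem [FiniteDimensional F V] (h : SpecialConfig Q k W e f) :
    extendBy W (f 0) (e 2) ∈ totallySingular Q k := h.swap.left_mem

/-- The values of a linear form on `extendBy W a b`. -/
theorem polar_extendBy {a b z : V} (hz : z ∈ extendBy W a b) {p : V}
    (hp : ∀ w ∈ W, polar Q p w = 0) :
    ∃ x y : F, polar Q p z = x * polar Q p a + y * polar Q p b := by
  obtain ⟨w, hw, x, y, rfl⟩ := mem_extendBy.1 hz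
  exact ⟨x, y, by
    rw [polar_add_right, polar_add_right, hp w hw, polar_smul_right, polar_smul_right]; simp⟩

theorem polar_extendBy_eq_zero {a b z : V} (hz : z ∈ extendBy W a b) {p : V}
    (hp : ∀ w ∈ W, polar Q p w = 0) (ha : polar Q p a = 0) (hb : polar Q p b = 0) :
    polar Q p z = 0 := by
  obtain ⟨x, y, h⟩ := polar_extendBy hz hp
  rw [h, ha, hb]; simp

/-- The vectors of the left end orthogonal to the right end form W + ⟨e 1⟩. -/
theorem map_mem_middle (h : SpecialConfig Q k W e f) {g : V ≃ₗ[F] V} (hg : g ∈ isometryGroup Q)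
    (hX : (extendBy W (e 0) (e 1)).map (g : V →ₗ[F] V) = extendBy W (e 0) (e 1))
    (hY : (extendBy W (f 0) (e 2)).map (g : V →ₗ[F] V) = extendBy W (f 0) (e 2)) :
    g (e 1) ∈ extendBy W (e 1) (e 2) := by
  have h1 : g (e 1) ∈ extendBy W (e 0) (e 1) := by
    rw [← hX]; exact ⟨e 1, right_mem_extendBy, rfl⟩
  have h2 : f 0 ∈ (extendBy W (f 0) (e 2)).map (g : V →ₗ[F] V) := hY.symm ▸ left_mem_extendBy
  obtain ⟨y, hy, hgy⟩ := h2
  have h3 : polar Q (f 0) (g (e 1)) = 0 := by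
    rw [← hgy]
    refine (polar_map_of_mem_isometryGroup hg y (e 1)).trans ?_
    rw [polar_comm]
    exact polar_extendBy_eq_zero hy (h.we 1) (by simp [h.hyp.ef]) (h.hyp.ee 1 2)
  obtain ⟨w, hw, x, z, hz⟩ := mem_extendBy.1 h1
  rw [hz, polar_add_right, polar_add_right, h.wf 0 w hw, polar_smul_right, polar_smul_right,
    h.hyp.fe, h.hyp.fe] at h3
  simp at h3
  rw [hz, h3]
  exact mem_extendBy.2 ⟨w, hw, z, 0, by module⟩

/-- The two ends intersect in W. -/
theorem map_mem_of_mem (h : SpecialConfig Q k W e f) {g : V ≃ₗ[F] V}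
    (hX : (extendBy W (e 0) (e 1)).map (g : V →ₗ[F] V) = extendBy W (e 0) (e 1))
    (hY : (extendBy W (f 0) (e 2)).map (g : V →ₗ[F] V) = extendBy W (f 0) (e 2)) {w : V}
    (hw : w ∈ W) : g w ∈ W := by
  have h1 : g w ∈ extendBy W (e 0) (e 1) := by
    rw [← hX]; exact ⟨w, le_extendBy hw, rfl⟩
  have h2 : g w ∈ extendBy W (f 0) (e 2) := by
    rw [← hY]; exact ⟨w, le_extendBy hw, rfl⟩
  have h3 := polar_extendBy_eq_zero h2 (h.wf 0) (h.hyp.ff 0 0) (by simp [h.hyp.fe])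
  have h4 := polar_extendBy_eq_zero h2 (h.wf 1) (h.hyp.ff 1 0) (by simp [h.hyp.fe])
  obtain ⟨w', hw', x, z, hz⟩ := mem_extendBy.1 h1
  rw [hz, polar_add_right, polar_add_right, h.wf _ w' hw', polar_smul_right, polar_smul_right,
    h.hyp.fe, h.hyp.fe] at h3 h4
  simp at h3 h4
  rw [hz, h3, h4]
  simpa using hw'

variable [FiniteDimensional F V]

/-- The two ends and the midpoint of a special pair. -/
def left (h : SpecialConfig Q k W e f) : totallySingular Q k := ⟨_, h.left_mem⟩

def right (h : SpecialConfig Q k W e f) : totallySingular Q k := ⟨_, h.right_mem⟩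

def middle (h : SpecialConfig Q k W e f) : totallySingular Q k := ⟨_, h.middle_mem⟩

theorem swap_left (h : SpecialConfig Q k W e f) : h.swap.left = h.right := rfl

theorem swap_right (h : SpecialConfig Q k W e f) : h.swap.right = h.left := rfl

theorem swap_middle (h : SpecialConfig Q k W e f) : h.swap.middle = h.middle :=
  Subtype.ext (extendBy_comm W (e 2) (e 1))

theorem root_sub_mem (h : SpecialConfig Q k W e f) (hQ : PlusSpace Q m)
    {T : totallySingular Q k}
    (hT : T ∈ omegaClosure Q (totallySingular Q k) {h.left, h.right}) {v : V} (hv : Q v = 0)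
    (hv1 : v ∈ perp Q (extendBy W (f 0) (e 2))) (hv2 : polar Q (e 1) v = 0) {t : V}
    (ht : t ∈ T.1) : polar Q (e 1) t • v - polar Q v t • e 1 ∈ T.1 := by
  refine (rootStable_totallySingular k).root_sub_mem hQ hT ⟨h.hyp.qe 1, hv, hv2⟩ ?_ ht
  rintro a (rfl | rfl) z hz
  · have h1 : polar Q (e 1) z = 0 :=
      polar_extendBy_eq_zero hz (h.we 1) (h.hyp.ee 1 0) (h.hyp.ee 1 1)
    rw [h1, zero_smul, zero_sub]
    exact Submodule.neg_mem _ (Submodule.smul_mem _ _ right_mem_extendBy)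
  · have h1 : polar Q (e 1) z = 0 :=
      polar_extendBy_eq_zero hz (h.we 1) (by simp [h.hyp.ef]) (h.hyp.ee 1 2)
    have h2 : polar Q v z = 0 := by rw [polar_comm]; exact hv1 z hz
    rw [h1, h2, zero_smul, zero_smul, sub_zero]
    exact Submodule.zero_mem _

theorem le_of_mem_closure (h : SpecialConfig Q k W e f) (hQ : PlusSpace Q m)
    {T : totallySingular Q k}
    (hT : T ∈ omegaClosure Q (totallySingular Q k) {h.left, h.right}) : W ≤ T.1 := by
  intro w hw
  refine (rootStable_totallySingular k).mem_of_mem_omegaClosure hQ hT T.2.1 ?_ ?_ ?_ (h.ts w hw)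
  · have h1 := T.2.2
    have h2 := h.dim
    omega
  · rintro a -
    exact a.2.1
  · rintro a (rfl | rfl) <;> exact le_extendBy hw

/-- Otherwise `T` would contain W, the displacements of t under the root elements of (e 1, e 2) and
(e 1, f 0), and t itself, which together span dimension k + 1. -/
theorem polar_eq_zero_of_mem_closure (h : SpecialConfig Q k W e f) (hQ : PlusSpace Q m)
    {T : totallySingular Q k}
    (hT : T ∈ omegaClosure Q (totallySingular Q k) {h.left, h.right}) {t : V} (ht : t ∈ T.1) :
    polar Q (e 1) t = 0 := by
  by_contra hne
  have h1 := h.root_sub_mem hQ hT (v := e 2) (h.hyp.qe 2)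
    (h.right_mem.1.le_perp right_mem_extendBy) (h.hyp.ee 1 2) ht
  have h2 := h.root_sub_mem hQ hT (v := f 0) (h.hyp.qf 0)
    (h.right_mem.1.le_perp left_mem_extendBy) (by simp [h.hyp.ef]) ht
  set a := polar Q (e 1) t • e 2 - polar Q (e 2) t • e 1
  set b := polar Q (e 1) t • f 0 - polar Q (f 0) t • e 1
  have h3 : extendBy W a b ⊔ Submodule.span F {t} ≤ T.1 :=
    sup_le (extendBy_le (h.le_of_mem_closure hQ hT) h1 h2)
      ((Submodule.span_singleton_le_iff_mem _ _).2 ht)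
  have h4 : finrank F (extendBy W a b) = k := by
    refine h.finrank_extendBy (p := f 2) (q := e 0) (h.wf 2) ?_ (h.we 0) ?_ ?_
    · simpa [a, polar_sub_right, h.hyp.fe] using hne
    · simp [a, polar_sub_right, h.hyp.ee]
    · simpa [b, polar_sub_right, h.hyp.ee, h.hyp.ef] using hne
  have h5 : t ∉ extendBy W a b := fun h6 => hne (polar_extendBy_eq_zero h6 (h.we 1)
    (by simp [a, polar_sub_right, h.hyp.ee]) (by simp [b, polar_sub_right, h.hyp.ee, h.hyp.ef]))
  have h6 := Submodule.finrank_mono h3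
  rw [finrank_sup_span_singleton h5, h4, T.2.2] at h6
  omega

/-- Let v be singular and orthogonal to W, e 1, e 2 and f 0. As t is orthogonal to e 1, the root
element of (e 1, v) displaces t by a multiple of e 1; since e 1 is not in `T`, that multiple is zero
and t is orthogonal to all these v. -/
theorem le_of_notMem (h : SpecialConfig Q k W e f) (hQ : PlusSpace Q m)
    {T : totallySingular Q k}
    (hT : T ∈ omegaClosure Q (totallySingular Q k) {h.left, h.right}) (he : e 1 ∉ T.1) :
    T.1 ≤ extendBy W (e 1) (e 2) ⊔ Submodule.span F {f 0} := by
  intro t ht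
  by_contra hcon
  have hts : IsTotallySingular Q (extendBy W (e 1) (e 2) ⊔ Submodule.span F {f 0}) := by
    refine h.middle_mem.1.sup (isTotallySingular_span_singleton (h.hyp.qf 0)) ?_
    rw [Submodule.span_singleton_le_iff_mem, mem_perp]
    intro w hw
    rw [polar_comm]
    exact polar_extendBy_eq_zero hw (h.wf 0) (by simp [h.hyp.fe]) (by simp [h.hyp.fe])
  obtain ⟨v, hv, hv0, hne⟩ := hQ.exists_singular_polar_ne_zero hts hcon
  have hv1 : polar Q (e 1) v = 0 := hv _ (Submodule.mem_sup_left left_mem_extendBy)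
  have h1 := h.root_sub_mem hQ hT hv0 (perp_anti (extendBy_le (le_extendBy.trans le_sup_left)
    (Submodule.mem_sup_right (Submodule.mem_span_singleton_self _))
    (Submodule.mem_sup_left right_mem_extendBy)) hv) hv1 ht
  rw [h.polar_eq_zero_of_mem_closure hQ hT ht, zero_smul, zero_sub, T.1.neg_mem_iff, polar_comm,
    T.1.smul_mem_iff hne] at h1
  exact he h1

theorem eq_middle_of_mem (h : SpecialConfig Q k W e f) {T : totallySingular Q k} (hW : W ≤ T.1)
    (h1 : e 1 ∈ T.1) (h2 : e 2 ∈ T.1) : T = h.middle :=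
  Subtype.ext (Submodule.eq_of_le_of_finrank_eq (extendBy_le hW h1 h2)
    (h.middle_mem.2.trans T.2.2.symm)).symm

/-- Here T = W + ⟨e 2, f 0 + c e 1⟩ is the image of the right end under a root element fixing the
left end. The closures of the two pairs are conjugate in N and nested, hence equal by finiteness. -/
theorem right_mem_closure (h : SpecialConfig Q k W e f) (hQ : PlusSpace Q m) [Finite F]
    {T : totallySingular Q k}
    (hT : T ∈ omegaClosure Q (totallySingular Q k) {h.left, h.right}) (he1 : e 1 ∉ T.1)
    (he2 : e 2 ∈ T.1) : h.right ∈ omegaClosure Q (totallySingular Q k) {h.left, T} := by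
  have : Finite V := Module.finite_of_finite F
  have hW := h.le_of_mem_closure hQ hT
  obtain ⟨t, ht, htn⟩ : ∃ t ∈ T.1, t ∉ W ⊔ Submodule.span F {e 2} := by
    by_contra! hcon
    have h1 : finrank F T.1 ≤ _ := Submodule.finrank_mono hcon
    have h2 := Submodule.finrank_add_le_finrank_add_finrank W (Submodule.span F {e 2})
    have h3 := finrank_span_singleton_le_one (F := F) (e 2)
    rw [T.2.2, ← h.dim] at h1
    omega
  obtain ⟨p, hp, c, hc, htp⟩ := Submodule.mem_sup.1 (h.le_of_notMem hQ hT he1 ht)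
  obtain ⟨z, rfl⟩ := Submodule.mem_span_singleton.1 hc
  obtain ⟨w, hw, x, y, rfl⟩ := mem_extendBy.1 hp
  have h1 : x • e 1 + z • f 0 ∈ T.1 := by
    have h2 := T.1.sub_mem (T.1.sub_mem ht (hW hw)) (T.1.smul_mem y he2)
    rw [← htp] at h2
    convert h2 using 1
    module
  have hz : z ≠ 0 := by
    rintro rfl
    by_cases hx : x = 0
    · apply htn
      rw [← htp, hx]
      refine Submodule.mem_sup.2 ⟨w, hw, y • e 2, Submodule.smul_mem _ _
        (Submodule.mem_span_singleton_self _), by module⟩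
    · rw [zero_smul, add_zero, T.1.smul_mem_iff hx] at h1
      exact he1 h1
  have h3 : f 0 + (z⁻¹ * x) • e 1 ∈ T.1 := by
    have := T.1.smul_mem z⁻¹ h1
    convert this using 1
    rw [smul_add, smul_smul, smul_smul, inv_mul_cancel₀ hz]
    module
  -- This root element adds (z⁻¹ x) e 1 to f 0 and fixes e 2 and every vector of the left end.
  have hpair : SingularPair Q (e 0) ((z⁻¹ * x) • e 1) := ((h.singularPair 1 0).smul_left _).symm
  obtain ⟨σ, hσ, hσg⟩ := (rootStable_totallySingular k).exists_perm hQ (root_mem_rootGroup hpair)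
  have hσl : σ h.left = h.left := by
    refine Subtype.ext ((hσg _).trans (map_eq_of_le fun a ha => ?_))
    have e1 : polar Q (e 0) a = 0 :=
      polar_extendBy_eq_zero ha (h.we 0) (h.hyp.ee 0 0) (h.hyp.ee 0 1)
    have e2 : polar Q (e 1) a = 0 :=
      polar_extendBy_eq_zero ha (h.we 1) (h.hyp.ee 1 0) (h.hyp.ee 1 1)
    rw [root_apply, polar_smul_left, e1, e2, zero_smul, smul_zero, zero_smul, sub_zero, add_zero]
    exact ha
  have hσr : σ h.right = T := by
    refine Subtype.ext ((hσg _).trans ?_)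
    refine Submodule.eq_of_le_of_finrank_eq ?_ ((LinearEquiv.finrank_map_eq _ _).trans
      (h.right_mem.2.trans T.2.2.symm))
    rintro _ ⟨a, ha, rfl⟩
    obtain ⟨w, hw, x', y', rfl⟩ := mem_extendBy.1 ha
    change root _ _ hpair _ ∈ T.1
    have e3 : root _ _ hpair (w + x' • f 0 + y' • e 2) =
        w + x' • (f 0 + (z⁻¹ * x) • e 1) + y' • e 2 := by
      simp only [root_apply, polar_add_right, polar_smul_right, polar_smul_left, h.we _ w hw,
        h.hyp.ee, h.hyp.ef, smul_eq_mul]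
      simp
      module
    rw [e3]
    exact T.1.add_mem (T.1.add_mem (hW hw) (T.1.smul_mem _ h3)) (T.1.smul_mem _ he2)
  have h4 := fixedClosure_image_eq (A := {h.left, h.right}) hσ
    (by
      rw [Set.image_pair, hσl, hσr]
      rintro a (rfl | rfl)
      · exact subset_fixedClosure _ _ (by simp)
      · exact hT)
  rw [Set.image_pair, hσl, hσr] at h4
  exact h4 (by simp)

/-- The cases are whether e 1 and e 2 belong to `T`. If neither does, `T` lies in both W + ⟨e 1, e
2, f 0⟩ and W + ⟨e 1, e 2, e 0⟩, which intersect in the midpoint. -/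
theorem trichotomy (h : SpecialConfig Q k W e f) (hQ : PlusSpace Q m) [Finite F]
    {T : totallySingular Q k}
    (hT : T ∈ omegaClosure Q (totallySingular Q k) {h.left, h.right}) :
    T = h.middle ∨ h.right ∈ omegaClosure Q (totallySingular Q k) {h.left, T} ∨
      h.left ∈ omegaClosure Q (totallySingular Q k) {h.right, T} := by
  have hW := h.le_of_mem_closure hQ hT
  have hT' : T ∈ omegaClosure Q (totallySingular Q k) {h.swap.left, h.swap.right} := by
    rw [h.swap_left, h.swap_right, Set.pair_comm]; exact hT
  by_cases h1 : e 1 ∈ T.1 <;> by_cases h2 : e 2 ∈ T.1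
  · exact Or.inl (h.eq_middle_of_mem hW h1 h2)
  · exact Or.inr (Or.inr (h.swap.right_mem_closure hQ hT' h2 h1))
  · exact Or.inr (Or.inl (h.right_mem_closure hQ hT h1 h2))
  · left
    refine Subtype.ext (Submodule.eq_of_le_of_finrank_eq (fun t ht => ?_)
      (T.2.2.trans h.middle_mem.2.symm))
    obtain ⟨p, hp, c, hc, htp⟩ := Submodule.mem_sup.1 (h.le_of_notMem hQ hT h1 ht)
    obtain ⟨z, rfl⟩ := Submodule.mem_span_singleton.1 hc
    obtain ⟨p', hp', c', hc', htp'⟩ := Submodule.mem_sup.1 (h.swap.le_of_notMem hQ hT' h2 ht)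
    obtain ⟨z', rfl⟩ := Submodule.mem_span_singleton.1 hc'
    have hp'' : p' ∈ extendBy W (e 2) (e 1) := hp'
    have e1 : polar Q (e 0) t = z := by
      rw [← htp, polar_add_right, polar_extendBy_eq_zero hp (h.we 0) (h.hyp.ee 0 1)
        (h.hyp.ee 0 2), polar_smul_right, h.hyp.ef]
      simp
    have e2 : polar Q (e 0) t = 0 := by
      rw [← htp', polar_add_right, polar_extendBy_eq_zero hp'' (h.we 0) (h.hyp.ee 0 2)
        (h.hyp.ee 0 1), polar_smul_right]
      have : polar Q (e 0) (e 0) = 0 := h.hyp.ee 0 0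
      simp [-polar_self, this]
    rw [← e1, e2, zero_smul, add_zero] at htp
    rw [← htp]
    exact hp

/-- The root element of (e 2, f 0) displaces e 0 by -e 2 and stabilizes the other two subspaces. -/
theorem left_notMem_closure (h : SpecialConfig Q k W e f) (hQ : PlusSpace Q m) :
    ∃ n ∈ inducedPerm (omegaGroup Q) (totallySingular Q k),
      (∀ a ∈ ({h.right, h.middle} : Set _), n a = a) ∧ n h.left ≠ h.left := by
  refine (rootStable_totallySingular k).exists_move_root hQ (h.singularPair_ef (i := 2) (j := 0)
    (by decide)) ?_ (x := h.left) (z := e 0) left_mem_extendBy ?_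
  · rintro a (rfl | rfl) z hz
    · rw [polar_extendBy_eq_zero hz (h.we 2) (by simp [h.hyp.ef]) (h.hyp.ee 2 2),
        polar_extendBy_eq_zero hz (h.wf 0) (h.hyp.ff 0 0) (by simp [h.hyp.fe])]
      simp
    · rw [polar_extendBy_eq_zero hz (h.we 2) (h.hyp.ee 2 1) (h.hyp.ee 2 2),
        polar_extendBy_eq_zero hz (h.wf 0) (by simp [h.hyp.fe]) (by simp [h.hyp.fe])]
      simp
  · intro hmem
    have h1 := polar_extendBy_eq_zero hmem (h.wf 2) (by simp [h.hyp.fe]) (by simp [h.hyp.fe])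
    simp [h.hyp.ee, h.hyp.fe] at h1

theorem right_notMem_closure (h : SpecialConfig Q k W e f) (hQ : PlusSpace Q m) :
    ∃ n ∈ inducedPerm (omegaGroup Q) (totallySingular Q k),
      (∀ a ∈ ({h.left, h.middle} : Set _), n a = a) ∧ n h.right ≠ h.right := by
  have := h.swap.left_notMem_closure hQ
  rwa [h.swap_left, h.swap_right, h.swap_middle] at this

theorem middle_mem_closure (h : SpecialConfig Q k W e f) :
    h.middle ∈ omegaClosure Q (totallySingular Q k) {h.left, h.right} := by
  refine mem_omegaClosure fun g hg hA => map_eq_of_le fun z hz => ?_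
  have hX : (extendBy W (e 0) (e 1)).map (g : V →ₗ[F] V) = _ := hA h.left (by simp)
  have hY : (extendBy W (f 0) (e 2)).map (g : V →ₗ[F] V) = _ := hA h.right (by simp)
  obtain ⟨w, hw, x, y, rfl⟩ := mem_extendBy.1 hz
  have h1 := h.map_mem_middle hg hX hY
  have h2 : g (e 2) ∈ extendBy W (e 2) (e 1) := h.swap.map_mem_middle hg hY hX
  rw [extendBy_comm] at h2
  rw [map_add, map_add, map_smul, map_smul]
  exact Submodule.add_mem _ (Submodule.add_mem _ (le_extendBy (h.map_mem_of_mem hX hY hw))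
    (Submodule.smul_mem _ _ h1)) (Submodule.smul_mem _ _ h2)

/-- The midpoint is the dependent entry. Its image under an element of G fixing both ends obeys the
trichotomy; the last two alternatives, pulled back to the midpoint itself, contradict
`right_notMem_closure` and `left_notMem_closure`. -/
theorem not_isIBIS (h : SpecialConfig Q k W e f) (hQ : PlusSpace Q m) [Finite F]
    {G : Subgroup (Equiv.Perm (totallySingular Q k))}
    (hNG : inducedPerm (omegaGroup Q) (totallySingular Q k) ≤ G)
    (hnorm : ∀ g ∈ G, ∀ n ∈ inducedPerm (omegaGroup Q) (totallySingular Q k),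
      g * n * g⁻¹ ∈ inducedPerm (omegaGroup Q) (totallySingular Q k)) : ¬ IsIBIS G := by
  have : Finite V := Module.finite_of_finite F
  have hirr : IrredundantList (inducedPerm (omegaGroup Q) (totallySingular Q k))
      ([h.right] ++ h.middle :: [h.left]) := by
    obtain ⟨n, hn, hfix, hmove⟩ := h.right_notMem_closure hQ
    obtain ⟨n', hn', -, hmove'⟩ := h.left_notMem_closure hQ
    refine ⟨⟨⟨trivial, n', hn', by simp, hmove'⟩, ?_⟩, n, hn, ?_, hmove⟩
    · have h1 := (rootStable_totallySingular k).exists_move_root hQ (h.singularPair_ef (i := 0)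
        (j := 2) (by decide)) (L := {h.left}) ?_ (x := h.middle) (z := e 2)
        right_mem_extendBy ?_
      · simpa using h1
      · rintro a rfl z hz
        rw [polar_extendBy_eq_zero hz (h.we 0) (h.hyp.ee 0 0) (h.hyp.ee 0 1),
          polar_extendBy_eq_zero hz (h.wf 2) (by simp [h.hyp.fe]) (by simp [h.hyp.fe])]
        simp
      · intro hmem
        have h1 := polar_extendBy_eq_zero hmem (h.wf 0) (by simp [h.hyp.fe]) (by simp [h.hyp.fe])
        simp [h.hyp.ee, h.hyp.fe] at h1
    · intro x hx
      exact hfix x (by simpa [or_comm] using hx)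
  refine not_isIBIS_of_dependent (hirr.mono hNG) fun g hg hfix => ?_
  have hr : g h.right = h.right := hfix _ (by simp)
  have hl : g h.left = h.left := hfix _ (by simp)
  have hmid := h.middle_mem_closure
  have himg : ∀ x y : totallySingular Q k, g '' {x, y} = {g x, g y} := fun x y =>
    Set.image_pair g x y
  have h1 : g h.middle ∈ omegaClosure Q (totallySingular Q k) {h.left, h.right} := by
    have := (apply_mem_fixedClosure_iff hnorm hg).2 hmid
    rwa [himg, hl, hr] at this
  rcases h.trichotomy hQ h1 with h2 | h2 | h2
  · exact h2
  · exfalso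
    have h3 := (apply_mem_fixedClosure_iff hnorm hg (A := {h.left, h.middle}) (t := h.right)).1
      (by rw [himg, hl, hr]; exact h2)
    obtain ⟨n, hn, hf, hm⟩ := h.right_notMem_closure hQ
    exact hm (h3 n hn hf)
  · exfalso
    have h3 := (apply_mem_fixedClosure_iff hnorm hg (A := {h.right, h.middle}) (t := h.left)).1
      (by rw [himg, hl, hr]; exact h2)
    obtain ⟨n, hn, hf, hm⟩ := h.left_notMem_closure hQ
    exact hm (h3 n hn hf)

end SpecialConfig

theorem exists_le_finrank_eq [FiniteDimensional F V] (U : Submodule F V) :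
    ∀ n ≤ finrank F U, ∃ W ≤ U, finrank F W = n
  | 0, _ => ⟨⊥, bot_le, finrank_bot F V⟩
  | n + 1, hn => by
    obtain ⟨W, hW, hWn⟩ := exists_le_finrank_eq U n (by omega)
    obtain ⟨x, hx, hxW⟩ : ∃ x ∈ U, x ∉ W := by
      by_contra! hcon
      have := Submodule.finrank_mono (show U ≤ W from hcon)
      omega
    exact ⟨W ⊔ Submodule.span F {x}, sup_le hW ((Submodule.span_singleton_le_iff_mem _ _).2 hx),
      by rw [finrank_sup_span_singleton hxW, hWn]⟩

/-- Three hyperbolic pairs leave a totally singular subspace of dimension m - 3 orthogonal to them;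
k < m is what lets W, of dimension k - 2, fit into it. -/
theorem PlusSpace.exists_specialConfig (hQ : PlusSpace Q m) (hk : 2 ≤ k) (hkm : k < m) :
    ∃ (W : Submodule F V) (e f : Fin 3 → V), SpecialConfig Q k W e f := by
  have := hQ.finite
  obtain ⟨X, hX, -⟩ := hQ.exists_isMaxTS (W := ⊥)
    (by intro u hu; rw [(Submodule.mem_bot F).1 hu]; exact QuadraticMap.map_zero Q)
  obtain ⟨e, f, h, he⟩ := hQ.exists_hypPairs hX 3 hQ.three_le
  have hU := h.finrank_inf_perp hQ hX he
  obtain ⟨W, hW, hWd⟩ := exists_le_finrank_eq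
    (X ⊓ perp Q (Submodule.span F (Set.range f))) (k - 2) (by omega)
  exact ⟨W, e, f, h, hX.1.mono (hW.trans inf_le_left),
    fun i w hw => hX.1.polar_eq_zero (he i) (hW hw).1,
    fun i w hw => mem_perp_span.1 (hW hw).2 _ ⟨i, rfl⟩, by omega⟩

theorem not_isIBIS_of_two_le_of_lt (hQ : PlusSpace Q m) [Finite F] (hk : 2 ≤ k) (hkm : k < m)
    {G : Subgroup (Equiv.Perm (totallySingular Q k))}
    (hNG : inducedPerm (omegaGroup Q) (totallySingular Q k) ≤ G)
    (hnorm : ∀ g ∈ G, ∀ n ∈ inducedPerm (omegaGroup Q) (totallySingular Q k),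
      g * n * g⁻¹ ∈ inducedPerm (omegaGroup Q) (totallySingular Q k)) : ¬ IsIBIS G := by
  have := hQ.finite
  obtain ⟨W, e, f, h⟩ := hQ.exists_specialConfig hk hkm
  exact h.not_isIBIS hQ hNG hnorm

end Intermediate
end IbisOrth

namespace IbisOrth
section Points

open QuadraticMap Module

variable {F V : Type*} [Field F] [AddCommGroup V] [Module F V] {Q : QuadraticForm F V} {m : ℕ}

/-! ### Torus elements -/

/-- Diagonal elements in the group generated by the root elements. -/
theorem HypPairs.exists_torus {r : ℕ} {e f : Fin r → V} (h : HypPairs Q e f) {i j : Fin r}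
    (hij : i ≠ j) {t : F} (ht : t ≠ 0) : ∃ g ∈ rootGroup Q, ∀ z, g z = z +
      ((t - 1) * polar Q (f i) z) • e i + ((t⁻¹ - 1) * polar Q (e i) z) • f i +
      ((t⁻¹ - 1) * polar Q (f j) z) • e j + ((t - 1) * polar Q (e j) z) • f j := by
  have hp : SingularPair Q (e i) (f j) := ⟨h.qe i, h.qf j, by rw [h.ef, if_neg hij]⟩
  have hp' : SingularPair Q (e j) (f i) := ⟨h.qe j, h.qf i, by rw [h.ef, if_neg hij.symm]⟩
  -- On ⟨e i, e j⟩ the two kinds of root elements act as opposite transvections of SL₂; this is the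
  -- factorization of diag(t, t⁻¹) into four of them.
  refine ⟨root _ _ (hp.smul_left t) * (root _ _ (hp'.smul_left ((t - 1) / t)) *
    (root _ _ (hp.smul_left (-1)) * root _ _ (hp'.smul_left (1 - t)))),
    mul_mem (root_mem_rootGroup _) (mul_mem (root_mem_rootGroup _)
      (mul_mem (root_mem_rootGroup _) (root_mem_rootGroup _))), fun z => ?_⟩
  have h1 := h.fe
  simp only [LinearEquiv.mul_apply, root_apply, polar_add_right, polar_sub_right,
    polar_smul_right, polar_smul_left, h.ee, h.ff, h.ef, h1, if_neg hij, if_neg hij.symm, if_true,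
    smul_eq_mul, mul_zero, mul_one, sub_zero, zero_sub, add_zero]
  match_scalars <;> field_simp <;> ring

/-! ### Singular points -/

/-- The point spanned by a singular vector. -/
def singularPoint (u : V) (hu : u ≠ 0) (hs : Q u = 0) : totallySingular Q 1 :=
  ⟨Submodule.span F {u}, isTotallySingular_span_singleton hs, finrank_span_singleton hu⟩

theorem exists_singularPoint (T : totallySingular Q 1) :
    ∃ (t : V) (ht : t ≠ 0) (hs : Q t = 0), T = singularPoint t ht hs := by
  have h1 : finrank F T.1 = 1 := T.2.2
  obtain ⟨⟨t, htT⟩, ht, h2⟩ := finrank_eq_one_iff'.1 h1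
  refine ⟨t, fun h => ht (Subtype.ext h), T.2.1 t htT, Subtype.ext (le_antisymm ?_ ?_)⟩
  · intro x hx
    obtain ⟨c, hc⟩ := h2 ⟨x, hx⟩
    exact Submodule.mem_span_singleton.2 ⟨c, congrArg Subtype.val hc⟩
  · exact (Submodule.span_singleton_le_iff_mem _ _).2 htT

theorem singularPoint_eq {u v : V} {hu : u ≠ 0} {hs : Q u = 0} {hv : v ≠ 0} {hs' : Q v = 0}
    (h : u ∈ Submodule.span F {v}) : singularPoint u hu hs = singularPoint v hv hs' := by
  obtain ⟨c, hc⟩ := Submodule.mem_span_singleton.1 h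
  have hc0 : c ≠ 0 := by rintro rfl; exact hu (by simpa using hc.symm)
  refine Subtype.ext ?_
  change Submodule.span F {u} = Submodule.span F {v}
  rw [← hc, Submodule.span_singleton_smul_eq (IsUnit.mk0 c hc0)]

theorem map_span_singleton_eq_iff [FiniteDimensional F V] {g : V ≃ₗ[F] V} {u : V} :
    (Submodule.span F {u}).map (g : V →ₗ[F] V) = Submodule.span F {u} ↔ ∃ c : F, g u = c • u := by
  constructor
  · intro h
    have h1 : g u ∈ (Submodule.span F {u}).map (g : V →ₗ[F] V) :=
      ⟨u, Submodule.mem_span_singleton_self u, rfl⟩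
    rw [h] at h1
    obtain ⟨c, hc⟩ := Submodule.mem_span_singleton.1 h1
    exact ⟨c, hc.symm⟩
  · rintro ⟨c, hc⟩
    refine map_eq_of_le fun x hx => ?_
    obtain ⟨a, rfl⟩ := Submodule.mem_span_singleton.1 hx
    rw [map_smul, hc, smul_smul]
    exact Submodule.smul_mem _ _ (Submodule.mem_span_singleton_self u)

namespace HypPairs

variable {e f : Fin 3 → V}

theorem e_ne_zero {r : ℕ} {e f : Fin r → V} (h : HypPairs Q e f) (i : Fin r) : e i ≠ 0 :=
  fun h0 => by
    have := h.ef i i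
    rw [h0, polar_zero_left] at this
    simp at this

theorem add_ne_zero (h : HypPairs Q e f) : e 0 + e 1 ≠ 0 := fun h0 => by
  have : polar Q (f 0) (e 0 + e 1) = 1 := by simp [polar_add_right, h.fe]
  rw [h0, polar_zero_right] at this
  exact zero_ne_one this

theorem apply_add (h : HypPairs Q e f) : Q (e 0 + e 1) = 0 := by
  rw [QuadraticMap.map_add (f := Q), h.qe, h.qe, h.ee]; simp

/-- The vectors fixed up to scalars by the stabilizer of `e 0`, `e 0 + e 1` and `f 0`. -/
theorem mem_span_of_mem_closure (h : HypPairs Q e f) (hQ : PlusSpace Q m) {X : Submodule F V}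
    (hX : IsMaxTS Q m X) (he : ∀ i, e i ∈ X) {T : totallySingular Q 1}
    (hT : T ∈ omegaClosure Q (totallySingular Q 1) {singularPoint (e 0) (h.e_ne_zero 0) (h.qe 0),
      singularPoint (e 0 + e 1) h.add_ne_zero h.apply_add,
      singularPoint (f 0) (h.symm.e_ne_zero 0) (h.qf 0)}) {t : V} (ht : t ∈ T.1) :
    t ∈ Submodule.span F {e 0, f 0, e 1} := by
  have := hQ.finite
  have key : ∀ v, Q v = 0 → polar Q (e 0) v = 0 → polar Q (f 0) v = 0 → polar Q (e 1) v = 0 →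
      polar Q (e 1) t • v - polar Q v t • e 1 ∈ T.1 := by
    intro v hv h0 hf h1
    refine (rootStable_totallySingular 1).root_sub_mem hQ hT ⟨h.qe 1, hv, h1⟩ ?_ ht
    have aux : ∀ u z : V, z ∈ Submodule.span F {u} → polar Q (e 1) u = 0 → polar Q v u = 0 →
        polar Q (e 1) z • v - polar Q v z • e 1 ∈ Submodule.span F {u} := by
      intro u z hz h2 h3
      obtain ⟨c, rfl⟩ := Submodule.mem_span_singleton.1 hz
      rw [polar_smul_right, polar_smul_right, h2, h3]
      simp
    rw [polar_comm] at h0 hf h1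
    rintro a (rfl | rfl | rfl) z hz
    · exact aux _ z hz (h.ee 1 0) h0
    · exact aux _ z hz (by rw [polar_add_right, h.ee, h.ee, add_zero])
        (by rw [polar_add_right, h0, h1, add_zero])
    · exact aux _ z hz (by simp [h.ef]) hf
  -- The root elements of (e 1, e 2) and (e 1, f 2) give two vectors of `T` with polar value B(e 1,
  -- t)².
  have h1 : polar Q (e 1) t = 0 := by
    have k1 := key (e 2) (h.qe 2) (h.ee 0 2) (by simp [h.fe]) (h.ee 1 2)
    have k2 := key (f 2) (h.qf 2) (by simp [h.ef]) (h.ff 0 2) (by simp [h.ef])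
    have k3 := T.2.1.polar_eq_zero k1 k2
    simp only [polar_sub_left, polar_sub_right, polar_smul_left, polar_smul_right, h.ee, h.ef] at k3
    simpa using k3
  by_contra hcon
  have h2 : ∀ v, Q v = 0 → polar Q (e 0) v = 0 → polar Q (f 0) v = 0 → polar Q (e 1) v = 0 →
      polar Q v t = 0 := by
    intro v hv h0 hf h3
    by_contra hne
    have h4 := key v hv h0 hf h3
    rw [h1, zero_smul, zero_sub, T.1.neg_mem_iff, T.1.smul_mem_iff hne] at h4
    have h5 : singularPoint (e 1) (h.e_ne_zero 1) (h.qe 1) = T :=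
      Subtype.ext (Submodule.eq_of_le_of_finrank_eq
        ((Submodule.span_singleton_le_iff_mem _ _).2 h4)
        ((finrank_span_singleton (h.e_ne_zero 1)).trans T.2.2.symm))
    rw [← h5] at ht
    exact hcon (Submodule.span_mono (by simp) ht)
  -- The component of t orthogonal to e 0 and f 0 turns out to lie in X. Outside ⟨e 0, f 0, e 1⟩ it
  -- would have a singular dual orthogonal to these three vectors, contrary to `h2`.
  set t' := t - polar Q (f 0) t • e 0 - polar Q (e 0) t • f 0 with ht'
  have e0 : polar Q (e 0) t' = 0 := by
    simp only [ht', polar_sub_right, polar_smul_right, h.ee, h.ef]; simp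
  have f0 : polar Q (f 0) t' = 0 := by
    simp only [ht', polar_sub_right, polar_smul_right, h.ff, h.fe]; simp
  have e1 : polar Q (e 1) t' = 0 := by
    simp only [ht', polar_sub_right, polar_smul_right, h.ee, h.ef, h1]; simp
  have htX : t' ∈ X := by
    refine hQ.mem_of_perp hX fun s hs => ?_
    have h3 := h2 (s - polar Q (f 0) s • e 0) (hX.1 _ (X.sub_mem hs (X.smul_mem _ (he 0))))
      (hX.1.polar_eq_zero (he 0) (X.sub_mem hs (X.smul_mem _ (he 0))))
      (by simp only [polar_sub_right, polar_smul_right, h.fe]; simp)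
      (hX.1.polar_eq_zero (he 1) (X.sub_mem hs (X.smul_mem _ (he 0))))
    rw [polar_sub_left, polar_smul_left] at h3
    rw [ht', polar_sub_right, polar_sub_right, polar_smul_right, polar_smul_right,
      polar_comm Q s (f 0), hX.1.polar_eq_zero hs (he 0)]
    linear_combination (exp := 1) h3
  have hin : t' ∉ Submodule.span F {e 0, f 0, e 1} := fun h3 => hcon <| by
    have h4 : t = t' + polar Q (f 0) t • e 0 + polar Q (e 0) t • f 0 := by rw [ht']; abel
    rw [h4]
    exact Submodule.add_mem _ (Submodule.add_mem _ h3
      (Submodule.smul_mem _ _ (Submodule.subset_span (by simp))))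
      (Submodule.smul_mem _ _ (Submodule.subset_span (by simp)))
  obtain ⟨v, hv, hv0, h3⟩ := hQ.exists_singular_dual hin (hX.1 t' htX)
    (mem_perp_span.2 (by rintro _ (rfl | rfl | rfl); exacts [e0, f0, e1]))
  have v0 : polar Q (e 0) v = 0 := mem_perp_span.1 hv _ (by simp)
  have v1 : polar Q (f 0) v = 0 := mem_perp_span.1 hv _ (by simp)
  have v2 : polar Q (e 1) v = 0 := mem_perp_span.1 hv _ (by simp)
  have h4 := h2 v hv0 v0 v1 v2
  rw [ht', polar_sub_left, polar_sub_left, polar_smul_left, polar_smul_left, v0, v1,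
    polar_comm, h4] at h3
  simp at h3

/-- An isometry fixing three points of a line together with a hyperbolic partner is a scalar on
the line. -/
theorem apply_eq_smul (h : HypPairs Q e f) {g : V ≃ₗ[F] V} (hg : g ∈ isometryGroup Q)
    {a b c l : F} (h0 : g (e 0) = a • e 0) (h1 : g (f 0) = b • f 0) (hl : l ≠ 0)
    (h2 : g (e 1 + l • e 0) = c • (e 1 + l • e 0)) : g (e 1) = a • e 1 := by
  have h3 : g (e 1) = c • e 1 + ((c - a) * l) • e 0 := by
    rw [map_add, map_smul, h0] at h2
    rw [eq_sub_of_add_eq h2]; module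
  have h4 := polar_map_of_mem_isometryGroup hg (e 1) (f 0)
  have h5 := polar_map_of_mem_isometryGroup hg (e 0) (f 0)
  rw [h0, h1] at h5
  rw [h1, h3] at h4
  simp only [polar_add_left, polar_smul_left, polar_smul_right, h.ef] at h4 h5
  simp at h4 h5
  rw [mul_comm] at h5
  have hb : b ≠ 0 := right_ne_zero_of_mul_eq_one h5
  have hca : c = a := by
    by_contra hne
    simp [sub_eq_zero, hne, hl, hb] at h4
  rw [h3, hca]; simp

/-- The analogue for a point on the line through `e 1` and `f 0`. -/
theorem apply_eq_smul' (h : HypPairs Q e f) {g : V ≃ₗ[F] V} (hg : g ∈ isometryGroup Q)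
    {a b c l : F} (h0 : g (e 0) = a • e 0) (h1 : g (f 0) = b • f 0) (hl : l ≠ 0)
    (h2 : g (e 1 + l • f 0) = c • (e 1 + l • f 0)) : g (e 1) = b • e 1 ∧ a * b = 1 := by
  have h3 : g (e 1) = c • e 1 + ((c - b) * l) • f 0 := by
    rw [map_add, map_smul, h1] at h2
    rw [eq_sub_of_add_eq h2]; module
  have h4 := polar_map_of_mem_isometryGroup hg (e 1) (e 0)
  have h5 := polar_map_of_mem_isometryGroup hg (e 0) (f 0)
  rw [h0, h1] at h5
  rw [h0, h3] at h4
  simp only [polar_add_left, polar_smul_left, polar_smul_right, h.ef, h.fe, h.ee] at h4 h5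
  simp at h4 h5
  rw [mul_comm] at h5
  have ha : a ≠ 0 := left_ne_zero_of_mul_eq_one h5
  have hca : c = b := by
    by_contra hne
    simp [sub_eq_zero, hne, hl, ha] at h4
  rw [h3, hca]; exact ⟨by simp, h5⟩

end HypPairs

theorem exists_ne_zero_ne_one [Finite F] (hq : 2 < Nat.card F) : ∃ s : F, s ≠ 0 ∧ s ≠ 1 := by
  classical
  by_contra! hcon
  cases nonempty_fintype F
  have h1 : (Finset.univ : Finset F) ⊆ {0, 1} := fun s _ => by
    by_cases hs : s = 0
    · simp [hs]
    · simp [hcon s hs]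
  have h2 := (Finset.card_le_card h1).trans Finset.card_le_two
  rw [Finset.card_univ, ← Nat.card_eq_fintype_card] at h2
  omega

/-- The dependent point ⟨e 1⟩ is the point of the line through ⟨e 0⟩ and ⟨e 0 + e 1⟩ that is
orthogonal to ⟨f 0⟩. An image of it under an element of G fixing the other three points is spanned
by e 1 + l e 0 or e 1 + l f 0; as ⟨e 0 + e 1⟩ is not in the closure of ⟨e 0⟩, ⟨e 1⟩, ⟨f 0⟩, it is
not in the closure of the transported triple either, which forces l = 0. -/
theorem not_isIBIS_points (hQ : PlusSpace Q m) [Finite F] (hq : 2 < Nat.card F)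
    {G : Subgroup (Equiv.Perm (totallySingular Q 1))}
    (hNG : inducedPerm (omegaGroup Q) (totallySingular Q 1) ≤ G)
    (hnorm : ∀ g ∈ G, ∀ n ∈ inducedPerm (omegaGroup Q) (totallySingular Q 1),
      g * n * g⁻¹ ∈ inducedPerm (omegaGroup Q) (totallySingular Q 1)) : ¬ IsIBIS G := by
  have := hQ.finite
  have : Finite V := Module.finite_of_finite F
  obtain ⟨X, hX, -⟩ := hQ.exists_isMaxTS (W := ⊥)
    (by intro u hu; rw [(Submodule.mem_bot F).1 hu]; exact QuadraticMap.map_zero Q)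
  obtain ⟨e, f, h, he⟩ := hQ.exists_hypPairs hX 3 hQ.three_le
  obtain ⟨s, hs0, hs1⟩ := exists_ne_zero_ne_one hq
  have hst := rootStable_totallySingular (Q := Q) 1
  set p0 := singularPoint (e 0) (h.e_ne_zero 0) (h.qe 0) with hp0
  set p1 := singularPoint (e 1) (h.e_ne_zero 1) (h.qe 1) with hp1
  set px := singularPoint (e 0 + e 1) h.add_ne_zero h.apply_add with hpx
  set pf := singularPoint (f 0) (h.symm.e_ne_zero 0) (h.qf 0) with hpf
  have self : ∀ u : V, u ∈ Submodule.span F {u} := Submodule.mem_span_singleton_self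
  have notin : ∀ p u v : V, polar Q p u = 0 → polar Q p v ≠ 0 → v ∉ Submodule.span F {u} := by
    rintro p u v hu hv hmem
    obtain ⟨c, rfl⟩ := Submodule.mem_span_singleton.1 hmem
    rw [polar_smul_right, hu, smul_zero] at hv
    exact hv rfl
  -- A torus element scaling e 0 by s ≠ 1 and fixing e 1; this needs a third field element.
  have hmove : ∃ σ ∈ inducedPerm (omegaGroup Q) (totallySingular Q 1),
      (∀ a ∈ ({p0, p1, pf} : Set _), σ a = a) ∧ σ px ≠ px := by
    obtain ⟨g, hg, hgz⟩ := h.exists_torus (i := 0) (j := 2) (by decide) hs0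
    have g0 : g (e 0) = s • e 0 := by
      rw [hgz]; simp only [h.ee, h.fe]; simp; module
    have g1 : g (e 1) = e 1 := by rw [hgz]; simp only [h.ee, h.fe]; simp
    have gf : g (f 0) = s⁻¹ • f 0 := by
      rw [hgz]; simp only [h.ff, h.ef]; simp; module
    refine hst.exists_move hQ hg ?_ (x := px) (z := e 0 + e 1) (self _) ?_
    · rintro a (rfl | rfl | rfl) z hz <;> obtain ⟨c, rfl⟩ := Submodule.mem_span_singleton.1 hz <;>
        rw [map_smul]
      · rw [g0]; exact Submodule.smul_mem _ _ (Submodule.smul_mem _ _ (self _))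
      · rw [g1]; exact Submodule.smul_mem _ _ (self _)
      · rw [gf]; exact Submodule.smul_mem _ _ (Submodule.smul_mem _ _ (self _))
    · rw [map_add, g0, g1]
      refine notin (f 0 - f 1) _ _ ?_ ?_
      · simp [polar_sub_left, polar_add_right, h.fe]
      · have : polar Q (f 0 - f 1) (s • e 0 + e 1) = s - 1 := by
          simp [polar_sub_left, polar_add_right, h.fe]; ring
        rw [this]; exact sub_ne_zero.2 hs1
  have hirr : IrredundantList (inducedPerm (omegaGroup Q) (totallySingular Q 1))
      ([pf, px] ++ p1 :: [p0]) := by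
    refine ⟨⟨⟨⟨trivial, ?_⟩, ?_⟩, ?_⟩, ?_⟩
    · have h1 := hst.exists_move_root hQ (u := e 1) (v := f 0)
        ⟨h.qe 1, h.qf 0, by simp [h.ef]⟩ (L := ∅) (by simp) (x := p0) (self (e 0))
        (notin (f 1) _ _ (by simp [h.fe]) (by simp [h.fe, h.ee]))
      simpa using h1
    · have h1 := hst.exists_move_root hQ (u := e 0) (v := f 1)
        ⟨h.qe 0, h.qf 1, by simp [h.ef]⟩ (L := {p0}) ?_ (x := p1) (self (e 1))
        (notin (f 0) _ _ (by simp [h.fe]) (by simp [h.fe, h.ee]))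
      · simpa using h1
      · rintro a rfl z hz
        obtain ⟨c, rfl⟩ := Submodule.mem_span_singleton.1 hz
        simp only [polar_smul_right, h.ee, h.fe]; simp
    · obtain ⟨σ, hσ, hfix, hm⟩ := hmove
      exact ⟨σ, hσ, fun x hx => hfix x (by
        have hx' : x ∈ [p1, p0] := hx
        simp only [List.mem_cons, List.not_mem_nil, or_false] at hx'
        rcases hx' with rfl | rfl <;> simp), hm⟩
    · have h1 := hst.exists_move_root hQ (u := e 0) (v := e 2)
        ⟨h.qe 0, h.qe 2, h.ee 0 2⟩ (L := {px, p1, p0}) ?_ (x := pf) (self (f 0))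
        (notin (f 2) _ _ (h.ff 2 0) (by simp [h.fe, h.ef]))
      · simpa using h1
      · rintro a (rfl | rfl | rfl) z hz <;>
          obtain ⟨c, rfl⟩ := Submodule.mem_span_singleton.1 hz <;>
          simp only [polar_smul_right, polar_add_right, h.ee] <;> simp
  refine not_isIBIS_of_dependent (hirr.mono hNG) fun g hg hfix => ?_
  have g0 : g p0 = p0 := hfix _ (by simp)
  have gx : g px = px := hfix _ (by simp)
  have gf : g pf = pf := hfix _ (by simp)
  have fixedAll : ∀ {A : Set (totallySingular Q 1)} {t : V} {ht : t ≠ 0} {hs : Q t = 0},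
      (∀ g ∈ isometryGroup Q, (∀ a ∈ A, (a : Submodule F V).map (g : V →ₗ[F] V) = a) →
        ∃ c : F, g t = c • t) → singularPoint t ht hs ∈ omegaClosure Q (totallySingular Q 1) A :=
    fun hA => mem_omegaClosure fun g hg hgA => map_span_singleton_eq_iff.2 (hA g hg hgA)
  have himg : ∀ x y z : totallySingular Q 1, g '' {x, y, z} = {g x, g y, g z} := fun x y z => by
    rw [Set.image_insert_eq, Set.image_pair]
  have hp1mem : p1 ∈ omegaClosure Q (totallySingular Q 1) {p0, px, pf} := by
    refine fixedAll fun g hg hA => ?_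
    obtain ⟨a, ha⟩ := map_span_singleton_eq_iff.1 (hA p0 (by simp))
    obtain ⟨b, hb⟩ := map_span_singleton_eq_iff.1 (hA px (by simp))
    obtain ⟨c, hc⟩ := map_span_singleton_eq_iff.1 (hA pf (by simp))
    exact ⟨a, h.apply_eq_smul hg ha hc one_ne_zero (c := b) (by
      rw [one_smul, add_comm]; exact hb)⟩
  have hT : g p1 ∈ omegaClosure Q (totallySingular Q 1) {p0, px, pf} := by
    have := (apply_mem_fixedClosure_iff hnorm hg).2 hp1mem
    rwa [himg, g0, gx, gf] at this
  have hTx : px ∉ omegaClosure Q (totallySingular Q 1) {p0, g p1, pf} := by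
    intro hmem
    have h1 := (apply_mem_fixedClosure_iff hnorm hg (A := {p0, p1, pf}) (t := px)).1
      (by rw [himg, g0, gx, gf]; exact hmem)
    obtain ⟨σ, hσ, hf, hm⟩ := hmove
    exact hm (h1 σ hσ hf)
  have hT0 : g p1 ≠ p0 := fun h1 => by
    have h2 : p1 = p0 := g.injective (h1.trans g0.symm)
    have h3 : e 1 ∈ p0.1 := h2 ▸ self (e 1)
    exact notin (f 1) (e 0) (e 1) (by simp [h.fe]) (by simp [h.fe]) h3
  have hTf : g p1 ≠ pf := fun h1 => by
    have h2 : p1 = pf := g.injective (h1.trans gf.symm)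
    have h3 : e 1 ∈ pf.1 := h2 ▸ self (e 1)
    exact notin (f 1) (f 0) (e 1) (h.ff 1 0) (by simp [h.fe]) h3
  obtain ⟨t, ht, hst', hTt⟩ := exists_singularPoint (g p1)
  rw [hTt] at hT hTx hT0 hTf ⊢
  obtain ⟨α, β, γ, rfl⟩ := Submodule.mem_span_triple.1
    (h.mem_span_of_mem_closure hQ hX he hT (self t))
  have hαβ : α * β = 0 := by
    rw [QuadraticMap.map_add (f := Q), QuadraticMap.map_add (f := Q)] at hst'
    simp only [QuadraticMap.map_smul, h.qe, h.qf, polar_add_left, polar_smul_left,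
      polar_smul_right, h.ef, h.fe, h.ee] at hst'
    simpa [or_comm] using hst'
  have hγ : γ ≠ 0 := by
    rintro rfl
    rcases mul_eq_zero.1 hαβ with rfl | rfl
    · exact hTf (singularPoint_eq (Submodule.mem_span_singleton.2 ⟨β, by simp⟩))
    · exact hT0 (singularPoint_eq (Submodule.mem_span_singleton.2 ⟨α, by simp⟩))
  rcases mul_eq_zero.1 hαβ with rfl | rfl
  · by_cases hβ : β = 0
    · subst hβ
      exact singularPoint_eq (Submodule.mem_span_singleton.2 ⟨γ, by simp⟩)
    exfalso
    -- The torus element acting as a on e 0 and e 1 and as a⁻¹ on f 0 fixes the three given points,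
    -- hence also ⟨β f 0 + γ e 1⟩, so a = a⁻¹. This can happen only for three field elements.
    have hsq : ∀ a : F, a ≠ 0 → a * a = 1 := by
      intro a ha
      obtain ⟨g1, hg1, hz1⟩ := h.exists_torus (i := 0) (j := 2) (by decide) ha
      obtain ⟨g2, hg2, hz2⟩ := h.exists_torus (i := 1) (j := 2) (by decide) ha
      have k0 : (g1 * g2) (e 0) = a • e 0 := by
        rw [LinearEquiv.mul_apply, hz2]; simp only [h.ee, h.fe]; simp
        rw [hz1]; simp only [h.ee, h.fe]; simp; module
      have k1 : (g1 * g2) (e 1) = a • e 1 := by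
        rw [LinearEquiv.mul_apply, hz2]; simp only [h.ee, h.fe]; simp
        rw [show g1 (e 1) = e 1 by rw [hz1]; simp only [h.ee, h.fe]; simp]; module
      have kf : (g1 * g2) (f 0) = a⁻¹ • f 0 := by
        rw [LinearEquiv.mul_apply, hz2]; simp only [h.ff, h.ef]; simp
        rw [hz1]; simp only [h.ff, h.ef]; simp; module
      have h1 := hst.map_eq_of_mem_omegaClosure hQ hT (mul_mem hg1 hg2) (by
        rintro b (rfl | rfl | rfl)
        · exact map_span_singleton_eq_iff.2 ⟨_, k0⟩
        · exact map_span_singleton_eq_iff.2 ⟨a, by rw [map_add, k0, k1]; module⟩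
        · exact map_span_singleton_eq_iff.2 ⟨_, kf⟩)
      obtain ⟨c, hc⟩ := map_span_singleton_eq_iff.1 h1
      rw [map_add, map_add, map_smul, map_smul, map_smul, k0, k1, kf] at hc
      have h2 := congrArg (polar Q (e 0)) hc
      have h3 := congrArg (polar Q (f 1)) hc
      simp only [polar_add_right, polar_smul_right, h.ee, h.ef, h.fe, h.ff] at h2 h3
      simp at h2 h3
      have h4 : a⁻¹ = c := mul_left_cancel₀ hβ (by rw [h2]; ring)
      have h5 : a = c := mul_left_cancel₀ hγ (by rw [h3]; ring)
      conv_lhs => rw [h5, ← h4]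
      rw [← h5] at h4
      rw [h4]
      nth_rewrite 1 [← h4]
      exact inv_mul_cancel₀ ha
    -- An isometry fixing the three points scales e 0 by a and e 1 by a⁻¹ = a, so it fixes ⟨e 0 + e
    -- 1⟩.
    apply hTx
    refine fixedAll fun g hg hA => ?_
    obtain ⟨a, ha⟩ := map_span_singleton_eq_iff.1 (hA p0 (by simp))
    obtain ⟨c, hc⟩ := map_span_singleton_eq_iff.1 (hA (singularPoint _ ht hst') (by simp))
    obtain ⟨b, hb⟩ := map_span_singleton_eq_iff.1 (hA pf (by simp))
    have hc' : g (e 1 + (γ⁻¹ * β) • f 0) = c • (e 1 + (γ⁻¹ * β) • f 0) := by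
      have : e 1 + (γ⁻¹ * β) • f 0 = γ⁻¹ • ((0 : F) • e 0 + β • f 0 + γ • e 1) := by
        rw [smul_add, smul_add, smul_smul, smul_smul, smul_smul, inv_mul_cancel₀ hγ]; module
      rw [this, map_smul, hc, smul_comm]
    obtain ⟨k1, k2⟩ := h.apply_eq_smul' hg ha hb (mul_ne_zero (inv_ne_zero hγ) hβ) hc'
    have hab : a = b := by
      have h1 := hsq a (left_ne_zero_of_mul_eq_one k2)
      exact mul_left_cancel₀ (left_ne_zero_of_mul_eq_one k2) (h1.trans k2.symm)
    exact ⟨a, by rw [map_add, ha, k1, hab]; module⟩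
  · by_cases hα : α = 0
    · subst hα
      exact singularPoint_eq (Submodule.mem_span_singleton.2 ⟨γ, by simp⟩)
    exfalso
    apply hTx
    refine fixedAll fun g hg hA => ?_
    obtain ⟨a, ha⟩ := map_span_singleton_eq_iff.1 (hA p0 (by simp))
    obtain ⟨c, hc⟩ := map_span_singleton_eq_iff.1 (hA (singularPoint _ ht hst') (by simp))
    obtain ⟨b, hb⟩ := map_span_singleton_eq_iff.1 (hA pf (by simp))
    have hc' : g (e 1 + (γ⁻¹ * α) • e 0) = c • (e 1 + (γ⁻¹ * α) • e 0) := by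
      have : e 1 + (γ⁻¹ * α) • e 0 = γ⁻¹ • (α • e 0 + (0 : F) • f 0 + γ • e 1) := by
        rw [smul_add, smul_add, smul_smul, smul_smul, smul_smul, inv_mul_cancel₀ hγ]; module
      rw [this, map_smul, hc, smul_comm]
    have k1 := h.apply_eq_smul hg ha hb (mul_ne_zero (inv_ne_zero hγ) hα) hc'
    exact ⟨a, by rw [map_add, ha, k1]; module⟩

end Points
end IbisOrth

namespace IbisOrth
section BinaryPoints

open QuadraticMap Module

variable {F V : Type*} [Field F] [AddCommGroup V] [Module F V] {Q : QuadraticForm F V} {m : ℕ}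

/-! ### Singular points over the field with two elements -/

theorem eq_zero_or_eq_one (hq : Nat.card F = 2) (a : F) : a = 0 ∨ a = 1 := by
  obtain ⟨y, -, hy⟩ := (Nat.card_eq_two_iff' (0 : F)).1 hq
  by_cases ha : a = 0
  · exact Or.inl ha
  · exact Or.inr ((hy a ha).trans (hy 1 one_ne_zero).symm)

theorem one_add_one_eq_zero (hq : Nat.card F = 2) : (1 : F) + 1 = 0 := by
  rcases eq_zero_or_eq_one hq ((1 : F) + 1) with h | h
  · exact h
  · exact absurd (add_eq_left.1 h) one_ne_zero

theorem eq_of_eq_zero_iff (hq : Nat.card F = 2) {a b : F} (h : a = 0 ↔ b = 0) : a = b := by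
  rcases eq_zero_or_eq_one hq a with rfl | rfl <;> rcases eq_zero_or_eq_one hq b with rfl | rfl <;>
    simp_all

theorem PlusSpace.exists_ne_mem {U : Submodule F V} [FiniteDimensional F V]
    (hU : 2 ≤ finrank F U) (a : V) : ∃ x ∈ U, x ∉ Submodule.span F {a} := by
  by_contra! hcon
  have h1 := Submodule.finrank_mono (show U ≤ _ from hcon)
  have h2 := finrank_span_singleton_le_one (F := F) a
  omega

/-- The stabilizer of a hyperbolic pair of points fixes no other point. -/
theorem eq_or_eq_of_mem_closure (hQ : PlusSpace Q m) {a b : V} {ha0 : a ≠ 0} {ha : Q a = 0}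
    {hb0 : b ≠ 0} {hb : Q b = 0} (hab : polar Q a b ≠ 0) {T : totallySingular Q 1}
    (hT : T ∈ omegaClosure Q (totallySingular Q 1)
      {singularPoint a ha0 ha, singularPoint b hb0 hb}) :
    T = singularPoint a ha0 ha ∨ T = singularPoint b hb0 hb := by
  have := hQ.finite
  obtain ⟨t, ht0, ht, rfl⟩ := exists_singularPoint T
  have self : ∀ u : V, u ∈ Submodule.span F {u} := Submodule.mem_span_singleton_self
  have hba : polar Q b a ≠ 0 := by rwa [polar_comm]
  have key : ∀ u v, SingularPair Q u v → polar Q a u = 0 → polar Q b u = 0 → polar Q a v = 0 →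
      polar Q b v = 0 → polar Q u t • v - polar Q v t • u ∈ Submodule.span F {t} := by
    intro u v huv h1 h2 h3 h4
    rw [polar_comm] at h1 h2 h3 h4
    refine (rootStable_totallySingular 1).root_sub_mem hQ hT huv ?_ (self t)
    rintro c (rfl | rfl) z hz <;> obtain ⟨x, rfl⟩ := Submodule.mem_span_singleton.1 hz
    · rw [polar_smul_right, polar_smul_right, h1, h3]; simp
    · rw [polar_smul_right, polar_smul_right, h2, h4]; simp
  have polar_span : ∀ {p u v : V}, v ∈ Submodule.span F {u} → polar Q p u = 0 →
      polar Q p v = 0 := by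
    intro p u v hv hp
    obtain ⟨c, rfl⟩ := Submodule.mem_span_singleton.1 hv
    rw [polar_smul_right, hp, smul_zero]
  set α := polar Q b t / polar Q b a with hα
  set β := polar Q a t / polar Q a b with hβ
  -- The component of t orthogonal to a and b: root elements of pairs in ⟨a, b⟩^⊥ fix both points,
  -- and their displacement of t depends only on r.
  set r := t - α • a - β • b with hr
  have har : polar Q a r = 0 := by
    rw [hr, polar_sub_right, polar_sub_right, polar_smul_right, polar_smul_right, polar_self, ha,
      hβ]
    simp [hab]
  have hbr : polar Q b r = 0 := by
    rw [hr, polar_sub_right, polar_sub_right, polar_smul_right, polar_smul_right, polar_self, hb,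
      hα]
    simp [hba]
  have htr : t = r + α • a + β • b := by rw [hr]; abel
  have hur : ∀ u, polar Q a u = 0 → polar Q b u = 0 → polar Q u t = polar Q u r := by
    intro u h1 h2
    rw [htr, polar_add_right, polar_add_right, polar_smul_right, polar_smul_right,
      polar_comm Q u a, polar_comm Q u b, h1, h2]
    simp
  -- The only singular points of the hyperbolic plane ⟨a, b⟩ are ⟨a⟩ and ⟨b⟩.
  by_cases hr0 : r = 0
  · rw [hr0, zero_add] at htr
    have h1 : α * β = 0 := by
      have h2 := ht
      rw [htr, QuadraticMap.map_add (f := Q), QuadraticMap.map_smul, QuadraticMap.map_smul, ha, hb,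
        polar_smul_left, polar_smul_right] at h2
      simpa [hab] using h2
    rcases mul_eq_zero.1 h1 with h2 | h2
    · exact Or.inr (singularPoint_eq (Submodule.mem_span_singleton.2 ⟨β, by rw [htr, h2]; simp⟩))
    · exact Or.inl (singularPoint_eq (Submodule.mem_span_singleton.2 ⟨α, by rw [htr, h2]; simp⟩))
  exfalso
  obtain ⟨X, hX, haX'⟩ := hQ.exists_isMaxTS (isTotallySingular_span_singleton ha)
  have haX : a ∈ X := haX' (self a)
  set U := X ⊓ perp Q (Submodule.span F {b}) with hU
  have hUd : 2 ≤ finrank F U := by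
    have h1 := hQ.finrank_inf_perp hX (Submodule.span F {b})
    rw [← hU] at h1
    have h2 := finrank_span_singleton_le_one (F := F) b
    have h3 := hQ.three_le
    omega
  have hUb : ∀ u ∈ U, polar Q b u = 0 := fun u hu => mem_perp_span.1 hu.2 b rfl
  have hUa : ∀ u ∈ U, polar Q a u = 0 := fun u hu => hX.1.polar_eq_zero haX hu.1
  have hUs : IsTotallySingular Q U := hX.1.mono inf_le_left
  by_cases hrU : ∀ u ∈ U, polar Q u r = 0
  · have hrX : r ∈ U := by
      refine ⟨hQ.mem_of_perp hX fun s hs => ?_, mem_perp_span.2 (by rintro _ rfl; exact hbr)⟩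
      have h1 : s - (polar Q b s / polar Q b a) • a ∈ U :=
        ⟨X.sub_mem hs (X.smul_mem _ haX), mem_perp_span.2 (by
          rintro _ rfl
          rw [polar_sub_right, polar_smul_right]
          simp [hba])⟩
      have h2 := hrU _ h1
      rwa [polar_sub_left, polar_smul_left, har, smul_zero, sub_zero] at h2
    have hrn : r ∉ Submodule.span F {a, b} := fun hmem => by
      obtain ⟨x, y, hxy⟩ := Submodule.mem_span_pair.1 hmem
      have h1 := har
      have h2 := hbr
      rw [← hxy, polar_add_right, polar_smul_right, polar_smul_right, polar_self] at h1 h2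
      rw [ha] at h1
      rw [hb] at h2
      simp [hab, hba] at h1 h2
      rw [h1, h2] at hxy
      exact hr0 (by simpa using hxy.symm)
    -- Here r lies in U. A dual u of r and a vector of U orthogonal to u and outside ⟨r⟩ give a
    -- displacement equal to that vector. It must be a multiple of t, so t lies in U, t = r, and the
    -- vector lies in ⟨r⟩ after all.
    obtain ⟨u, hu, hu0, hru⟩ := hQ.exists_singular_dual hrn (hUs r hrX)
      (mem_perp_span.2 (by rintro _ (rfl | rfl); exacts [har, hbr]))
    have hau : polar Q a u = 0 := mem_perp_span.1 hu a (by simp)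
    have hbu : polar Q b u = 0 := mem_perp_span.1 hu b (by simp)
    obtain ⟨x, hx, hxr⟩ := PlusSpace.exists_ne_mem hUd r
    have hv : x - polar Q u x • r ∈ U := U.sub_mem hx (U.smul_mem _ hrX)
    have huv : polar Q u (x - polar Q u x • r) = 0 := by
      rw [polar_sub_right, polar_smul_right, polar_comm Q u r, hru]; simp
    have h1 := key u _ ⟨hu0, hUs _ hv, huv⟩ hau hbu (hUa _ hv) (hUb _ hv)
    rw [hur u hau hbu, hur _ (hUa _ hv) (hUb _ hv), hUs.polar_eq_zero hv hrX, polar_comm Q u r,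
      hru, one_smul, zero_smul, sub_zero] at h1
    obtain ⟨c, hc⟩ := Submodule.mem_span_singleton.1 h1
    have hc0 : c ≠ 0 := by
      rintro rfl
      rw [zero_smul] at hc
      exact hxr (Submodule.mem_span_singleton.2 ⟨polar Q u x, (sub_eq_zero.1 hc.symm).symm⟩)
    have htU : t ∈ U := by
      rw [← hc] at hv
      exact (U.smul_mem_iff hc0).1 hv
    have htr' : t = r := by
      rw [hr, hα, hβ, hUa t htU, hUb t htU]; simp
    apply hxr
    refine Submodule.mem_span_singleton.2 ⟨c + polar Q u x, ?_⟩
    rw [add_smul, ← htr', hc, ← htr']; abel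
  · push Not at hrU
    obtain ⟨u, hu, hne⟩ := hrU
    -- The displacement of t is a nonzero vector of U and a multiple of t, so t lies in U and is
    -- orthogonal to u.
    obtain ⟨v, hv, hvu⟩ := PlusSpace.exists_ne_mem hUd u
    have h1 := key u v (hUs.singularPair hu hv) (hUa u hu) (hUb u hu) (hUa v hv) (hUb v hv)
    obtain ⟨c, hc⟩ := Submodule.mem_span_singleton.1 h1
    have hut := hur u (hUa u hu) (hUb u hu)
    have hc0 : c ≠ 0 := by
      rintro rfl
      rw [zero_smul, hut] at hc
      refine hvu (Submodule.mem_span_singleton.2 ⟨(polar Q u r)⁻¹ * polar Q v t, ?_⟩)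
      rw [mul_smul, ← sub_eq_zero.1 hc.symm, smul_smul, inv_mul_cancel₀ hne, one_smul]
    have htU : t ∈ U := by
      rw [← U.smul_mem_iff hc0, hc]
      exact U.sub_mem (U.smul_mem _ hv) (U.smul_mem _ hu)
    exact hne (hut ▸ hUs.polar_eq_zero hu htU)

/-- Over the field with two elements, orthogonality of distinct singular points is visible from the
action. -/
theorem polar_eq_zero_iff_exists_mem_closure (hQ : PlusSpace Q m) (hq : Nat.card F = 2)
    {a b : V} {ha0 : a ≠ 0} {ha : Q a = 0} {hb0 : b ≠ 0} {hb : Q b = 0}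
    (hab : singularPoint a ha0 ha ≠ singularPoint b hb0 hb) :
    polar Q a b = 0 ↔ ∃ C ∈ omegaClosure Q (totallySingular Q 1)
      {singularPoint a ha0 ha, singularPoint b hb0 hb},
      C ≠ singularPoint a ha0 ha ∧ C ≠ singularPoint b hb0 hb := by
  have := hQ.finite
  constructor
  · intro h
    have hs : Q (a + b) = 0 := by rw [QuadraticMap.map_add (f := Q), ha, hb, h]; simp
    have self : ∀ u : V, u ∈ Submodule.span F {u} := Submodule.mem_span_singleton_self
    have h0 : a + b ≠ 0 := fun h0 => hab (singularPoint_eq (by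
      rw [eq_neg_of_add_eq_zero_left h0]; exact Submodule.neg_mem _ (self b)))
    refine ⟨singularPoint (a + b) h0 hs, mem_omegaClosure fun g _ hA => ?_, fun h1 => ?_,
      fun h1 => ?_⟩
    · have fix : ∀ u : V, u ≠ 0 → (Submodule.span F {u}).map (g : V →ₗ[F] V) =
          Submodule.span F {u} → g u = u := by
        intro u hu hmap
        obtain ⟨c, hc⟩ := map_span_singleton_eq_iff.1 hmap
        rcases eq_zero_or_eq_one hq c with rfl | rfl
        · rw [zero_smul] at hc
          exact absurd (g.map_eq_zero_iff.1 hc) hu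
        · rwa [one_smul] at hc
      refine map_span_singleton_eq_iff.2 ⟨1, ?_⟩
      rw [one_smul, map_add, fix a ha0 (hA (singularPoint a ha0 ha) (by simp)),
        fix b hb0 (hA (singularPoint b hb0 hb) (by simp))]
    · have h2 : a + b ∈ (singularPoint a ha0 ha).1 := h1 ▸ self _
      exact hab (singularPoint_eq ((Submodule.add_mem_iff_right _ (self a)).1 h2)).symm
    · have h2 : a + b ∈ (singularPoint b hb0 hb).1 := h1 ▸ self _
      exact hab (singularPoint_eq ((Submodule.add_mem_iff_left _ (self b)).1 h2))
  · rintro ⟨C, hC, h1, h2⟩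
    by_contra h
    rcases eq_or_eq_of_mem_closure hQ h hC with h3 | h3
    · exact h1 h3
    · exact h2 h3

namespace HypPairs

/-- The vectors of a hyperbolic basis, indexed by sign and position. -/
def vec {W : Type*} {r : ℕ} (e f : Fin r → W) : Fin r × Bool → W
  | (i, true) => e i
  | (i, false) => f i

variable {r : ℕ} {e f : Fin r → V}

theorem vec_ne_zero (h : HypPairs Q e f) : ∀ p, vec e f p ≠ 0
  | (i, true) => h.e_ne_zero i
  | (i, false) => h.symm.e_ne_zero i

theorem apply_vec (h : HypPairs Q e f) : ∀ p, Q (vec e f p) = 0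
  | (i, true) => h.qe i
  | (i, false) => h.qf i

theorem vec_swap {W : Type*} {r : ℕ} {e f : Fin r → W} :
    ∀ p : Fin r × Bool, vec f e (p.1, !p.2) = vec e f p
  | (_, true) => rfl
  | (_, false) => rfl

/-- The vector whose class is determined by its orthogonality relations to basis vectors. -/
def quadVec (e f : Fin r → V) (i j : Fin r) : V := e i + f i + e j + f j

theorem quadVec_swap (i j : Fin r) : quadVec e f i j = quadVec f e i j := by
  rw [quadVec, quadVec]; abel

theorem apply_quadVec (h : HypPairs Q e f) (hq : Nat.card F = 2) {i j : Fin r} (hij : i ≠ j) :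
    Q (quadVec e f i j) = 0 := by
  have := one_add_one_eq_zero hq
  simp only [quadVec, QuadraticMap.map_add (f := Q), h.qe, h.qf, polar_add_left, h.ef, h.ee, h.fe,
    h.ff, if_neg hij, if_true]
  simpa using this

theorem quadVec_ne_zero (h : HypPairs Q e f) {i j : Fin r} (hij : i ≠ j) :
    quadVec e f i j ≠ 0 := fun h0 => by
  have h1 : polar Q (e i) (quadVec e f i j) = 1 := by
    simp only [quadVec, polar_add_right, h.ee, h.ef, if_neg hij, if_true]; simp
  rw [h0, polar_zero_right] at h1
  exact zero_ne_one h1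

/-- The two factors subtract multiples of f l given by the pairings with e i and with f i. Both
pairings of `quadVec` equal 1, so the two contributions cancel in characteristic two, while e l
gains e i and f i. -/
theorem exists_move_vec (h : HypPairs Q e f) (hq : Nat.card F = 2)
    {i j l : Fin r} (hij : i ≠ j) (hil : i ≠ l) (hjl : j ≠ l) :
    ∃ g ∈ rootGroup Q, (∀ p : Fin r × Bool, p.1 ≠ i → p ≠ (l, true) → g (vec e f p) = vec e f p) ∧
      g (quadVec e f i j) = quadVec e f i j ∧ g (e l) ∉ Submodule.span F {e l} := by
  have h2 := one_add_one_eq_zero hq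
  have p1 : SingularPair Q (f l) (e i) := ⟨h.qf l, h.qe i, by rw [h.fe, if_neg hil.symm]⟩
  have p2 : SingularPair Q (f l) (f i) := ⟨h.qf l, h.qf i, h.ff l i⟩
  refine ⟨root _ _ p1 * root _ _ p2, mul_mem (root_mem_rootGroup _) (root_mem_rootGroup _), ?_,
    ?_, ?_⟩
  · rintro ⟨a, _ | _⟩ h3 h4
    · have h3' : i ≠ a := fun h => h3 h.symm
      simp only [vec, LinearEquiv.mul_apply, root_apply, h.ff, h.ef, if_neg h3', zero_smul,
        sub_zero, add_zero]
    · have h3' : i ≠ a := fun h => h3 h.symm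
      have h4' : l ≠ a := fun h => h4 (by rw [h])
      simp only [vec, LinearEquiv.mul_apply, root_apply, h.ee, h.fe, if_neg h3', if_neg h4',
        zero_smul, sub_zero, add_zero]
  · simp only [quadVec, LinearEquiv.mul_apply, root_apply, polar_add_right, polar_sub_right,
      polar_smul_right, h.ee, h.ff, h.ef, h.fe, if_neg hij, if_neg hil.symm, if_neg hjl.symm,
      if_neg hil, if_true]
    have h3 : f l + f l = 0 := by rw [← two_smul F, ← one_add_one_eq_two, h2, zero_smul]
    simp
    rw [← sub_eq_zero, ← neg_eq_zero, ← h3]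
    abel
  · intro hmem
    obtain ⟨c, hc⟩ := Submodule.mem_span_singleton.1 hmem
    have h3 := congrArg (polar Q (f i)) hc
    simp only [LinearEquiv.mul_apply, root_apply, polar_add_right, polar_sub_right,
      polar_smul_right, h.ee, h.ff, h.ef, h.fe, if_neg hil, if_true] at h3
    simp at h3

end HypPairs

/-- The dependent point is ⟨e₀ + f₀ + e₁ + f₁⟩. Elements of G preserve orthogonality of points, so
fixing all basis points other than ⟨e₀⟩ and ⟨f₀⟩ leaves only two coordinates of its image free, and
singularity determines these. -/
theorem not_isIBIS_points_of_card_eq_two (hQ : PlusSpace Q m) [Finite F] (hq : Nat.card F = 2)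
    {G : Subgroup (Equiv.Perm (totallySingular Q 1))}
    (hNG : inducedPerm (omegaGroup Q) (totallySingular Q 1) ≤ G)
    (hnorm : ∀ g ∈ G, ∀ n ∈ inducedPerm (omegaGroup Q) (totallySingular Q 1),
      g * n * g⁻¹ ∈ inducedPerm (omegaGroup Q) (totallySingular Q 1)) : ¬ IsIBIS G := by
  have := hQ.finite
  have : Finite V := Module.finite_of_finite F
  obtain ⟨X, hX, -⟩ := hQ.exists_isMaxTS (W := ⊥)
    (by intro u hu; rw [(Submodule.mem_bot F).1 hu]; exact QuadraticMap.map_zero Q)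
  obtain ⟨e, f, h, he⟩ := hQ.exists_hypPairs hX m le_rfl
  have hm := hQ.three_le
  have hst := rootStable_totallySingular (Q := Q) 1
  have self : ∀ u : V, u ∈ Submodule.span F {u} := Submodule.mem_span_singleton_self
  have hzero : ∀ z : V, (∀ i, polar Q (e i) z = 0) → (∀ i, polar Q (f i) z = 0) → z = 0 := by
    intro z hze hzf
    have hd : finrank F (Submodule.span F (Set.range e)) = m := h.symm.finrank_span_right
    have hXe : Submodule.span F (Set.range e) = X :=
      Submodule.eq_of_le_of_finrank_eq (Submodule.span_le.2 (by rintro _ ⟨i, rfl⟩; exact he i))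
        (hd.trans hX.2.symm)
    have hzX : z ∈ X := hQ.mem_of_perp hX (by
      rw [← hXe]; exact mem_perp_span.2 (by rintro _ ⟨i, rfl⟩; exact hze i))
    have h1 := h.eq_sum (Submodule.span_mono Set.subset_union_left (hXe.symm ▸ hzX))
    simpa [hze, hzf] using h1
  let i0 : Fin m := ⟨0, by omega⟩
  let i1 : Fin m := ⟨1, by omega⟩
  let i2 : Fin m := ⟨2, by omega⟩
  have h01 : i0 ≠ i1 := by simp [i0, i1]
  have h02 : i0 ≠ i2 := by simp [i0, i2]
  have h12 : i1 ≠ i2 := by simp [i1, i2]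
  set y : Fin m × Bool → totallySingular Q 1 := fun p =>
    singularPoint (HypPairs.vec e f p) (h.vec_ne_zero p) (h.apply_vec p) with hy
  set x : totallySingular Q 1 := singularPoint (HypPairs.quadVec e f i0 i1)
    (h.quadVec_ne_zero h01) (h.apply_quadVec hq h01) with hx
  have notin : ∀ p u v : V, polar Q p u = 0 → polar Q p v ≠ 0 → v ∉ Submodule.span F {u} := by
    rintro p u v hu hv hmem
    obtain ⟨c, rfl⟩ := Submodule.mem_span_singleton.1 hmem
    rw [polar_smul_right, hu, smul_zero] at hv
    exact hv rfl
  have hbase : IrredundantList (inducedPerm (omegaGroup Q) (totallySingular Q 1))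
      [x, y (i1, false), y (i1, true)] := by
    refine ⟨⟨⟨trivial, ?_⟩, ?_⟩, ?_⟩
    · have h1 := hst.exists_move_root hQ (u := e i0) (v := f i1)
        ⟨h.qe _, h.qf _, by rw [h.ef, if_neg h01]⟩ (L := ∅) (by simp) (x := y (i1, true))
        (self (e i1)) (notin (f i0) (e i1) _ (by rw [h.fe, if_neg h01])
          (by simp only [polar_sub_right, polar_smul_right, h.ff, h.fe, h.ee, if_true]; simp))
      simpa using h1
    · have h1 := hst.exists_move_root hQ (u := e i1) (v := e i0)
        ⟨h.qe _, h.qe _, h.ee _ _⟩ (L := {y (i1, true)}) ?_ (x := y (i1, false))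
        (self (f i1)) (notin (f i0) (f i1) _ (h.ff _ _)
          (by simp only [polar_sub_right, polar_smul_right, h.ef, h.fe, if_true, if_neg h01]; simp))
      · simpa using h1
      · rintro a rfl z hz
        obtain ⟨c, rfl⟩ := Submodule.mem_span_singleton.1 hz
        rw [polar_smul_right, polar_smul_right]
        simp [HypPairs.vec, h.ee]
    · have h1 := hst.exists_move_root hQ (u := e i0) (v := e i2)
        ⟨h.qe _, h.qe _, h.ee _ _⟩ (L := {y (i1, false), y (i1, true)}) ?_ (x := x)
        (self _) (notin (f i2) _ _
          (by simp only [HypPairs.quadVec, polar_add_right, h.ff, h.fe, if_neg h02.symm,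
                if_neg h12.symm, add_zero])
          (by simp only [HypPairs.quadVec, polar_add_right, polar_sub_right, polar_smul_right,
                h.ee, h.ef, h.fe, if_true, if_neg h01, if_neg h02.symm, if_neg h12.symm]; simp))
      · simpa using h1
      · rintro a (rfl | rfl) z hz <;> obtain ⟨c, rfl⟩ := Submodule.mem_span_singleton.1 hz <;>
          rw [polar_smul_right, polar_smul_right] <;>
          simp [HypPairs.vec, h.ee, h.ef, h01, h12.symm]
  -- Each of these basis points is moved by an element fixing all the other points of the sequence,
  -- so their order is irrelevant.
  set J := (Finset.univ.filter fun p : Fin m × Bool => p.1 ≠ i0 ∧ p.1 ≠ i1).toList with hJ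
  have hmemJ : ∀ p, p ∈ J ↔ p.1 ≠ i0 ∧ p.1 ≠ i1 := fun p => by simp [hJ]
  have hmoves : ∀ p ∈ J, ∃ n ∈ inducedPerm (omegaGroup Q) (totallySingular Q 1),
      (∀ a ∈ [x, y (i1, false), y (i1, true)], n a = a) ∧
        (∀ j ∈ J, j ≠ p → n (y j) = y j) ∧ n (y p) ≠ y p := by
    intro p hp
    obtain ⟨g, hg, hg1, hg2, hg3⟩ : ∃ g ∈ rootGroup Q,
        (∀ p' : Fin m × Bool, p'.1 ≠ i0 → p' ≠ p →
          g (HypPairs.vec e f p') = HypPairs.vec e f p') ∧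
        g (HypPairs.quadVec e f i0 i1) = HypPairs.quadVec e f i0 i1 ∧
        g (HypPairs.vec e f p) ∉ Submodule.span F {HypPairs.vec e f p} := by
      obtain ⟨hp0, hp1⟩ := (hmemJ p).1 hp
      obtain ⟨l, _ | _⟩ := p
      · obtain ⟨g, hg, hg1, hg2, hg3⟩ := h.symm.exists_move_vec hq h01 (Ne.symm hp0)
          (Ne.symm hp1)
        refine ⟨g, hg, fun p' h1 h2 => ?_, by rw [HypPairs.quadVec_swap]; exact hg2, hg3⟩
        rw [← HypPairs.vec_swap]
        refine hg1 (p'.1, !p'.2) h1 fun h3 => h2 ?_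
        obtain ⟨a, b⟩ := p'
        simpa using h3
      · exact h.exists_move_vec hq h01 (Ne.symm hp0) (Ne.symm hp1)
    obtain ⟨σ, hσ, hfix, hmove⟩ := hst.exists_move hQ hg
      (L := {a | a = x ∨ ∃ p', p'.1 ≠ i0 ∧ p' ≠ p ∧ a = y p'}) (by
        rintro a (rfl | ⟨p', h1, h2, rfl⟩) z hz <;>
          obtain ⟨c, rfl⟩ := Submodule.mem_span_singleton.1 hz <;> rw [map_smul]
        · rw [hg2]; exact Submodule.smul_mem _ _ (self _)
        · rw [hg1 p' h1 h2]; exact Submodule.smul_mem _ _ (self _))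
      (x := y p) (self _) hg3
    have hp1 := ((hmemJ p).1 hp).2
    refine ⟨σ, hσ, fun a ha => hfix a ?_, fun j hj hjp =>
      hfix _ (Or.inr ⟨j, ((hmemJ j).1 hj).1, hjp, rfl⟩), hmove⟩
    simp only [List.mem_cons, List.not_mem_nil, or_false] at ha
    rcases ha with rfl | rfl | rfl
    · exact Or.inl rfl
    · exact Or.inr ⟨(i1, false), h01.symm, fun h1 => hp1 (by rw [← h1]), rfl⟩
    · exact Or.inr ⟨(i1, true), h01.symm, fun h1 => hp1 (by rw [← h1]), rfl⟩
  have hirr := hbase.append_map (Finset.nodup_toList _) hmoves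
  refine not_isIBIS_of_dependent (hirr.mono hNG) fun g hg hfix => ?_
  have hfix' : ∀ p : Fin m × Bool, p.1 ≠ i0 → g (y p) = y p := by
    intro p hp
    refine hfix _ ?_
    simp only [List.mem_append, List.mem_map, List.mem_cons, List.not_mem_nil, or_false]
    by_cases hp1 : p.1 = i1
    · right
      obtain ⟨l, _ | _⟩ := p
      · exact Or.inl (by rw [← hp1])
      · exact Or.inr (by rw [← hp1])
    · exact Or.inl ⟨p, (hmemJ p).2 ⟨hp, hp1⟩, rfl⟩
  -- The existence of a third point in the closure of a pair, and with it orthogonality, is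
  -- invariant under G.
  have hinv : ∀ a b : totallySingular Q 1, (∃ C ∈ omegaClosure Q (totallySingular Q 1)
      {g a, g b}, C ≠ g a ∧ C ≠ g b) ↔ ∃ C ∈ omegaClosure Q (totallySingular Q 1) {a, b},
      C ≠ a ∧ C ≠ b := by
    intro a b
    constructor
    · rintro ⟨C, hC, h1, h2⟩
      refine ⟨g⁻¹ C, (apply_mem_fixedClosure_iff hnorm hg).1 ?_, fun h3 => h1 ?_, fun h3 => h2 ?_⟩
      · rw [Set.image_pair, ← Equiv.Perm.mul_apply, mul_inv_cancel]; exact hC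
      · rw [← h3, ← Equiv.Perm.mul_apply, mul_inv_cancel]; rfl
      · rw [← h3, ← Equiv.Perm.mul_apply, mul_inv_cancel]; rfl
    · rintro ⟨C, hC, h1, h2⟩
      refine ⟨g C, ?_, fun h3 => h1 (g.injective h3), fun h3 => h2 (g.injective h3)⟩
      have := (apply_mem_fixedClosure_iff hnorm hg).2 hC
      rwa [Set.image_pair] at this
  obtain ⟨t, ht0, ht, hTt⟩ := exists_singularPoint (g x)
  have hpol : ∀ p : Fin m × Bool, p.1 ≠ i0 →
      polar Q (HypPairs.vec e f p) t = polar Q (HypPairs.vec e f p) (HypPairs.quadVec e f i0 i1) := by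
    intro p hp
    have hxy : y p ≠ x := by
      intro h1
      have h2 : HypPairs.quadVec e f i0 i1 ∈ (y p).1 := h1 ▸ self _
      refine notin (e i0) (HypPairs.vec e f p) _ ?_ ?_ h2
      · obtain ⟨l, _ | _⟩ := p
        · have hl : i0 ≠ l := fun h3 => hp h3.symm
          simp only [HypPairs.vec, h.ef, if_neg hl]
        · exact h.ee _ _
      · simp only [HypPairs.quadVec, polar_add_right, h.ee, h.ef, if_neg h01, if_true]; simp
    have hgxy : y p ≠ g x := fun h1 => hxy (g.injective ((hfix' p hp).trans h1))
    refine eq_of_eq_zero_iff hq ?_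
    rw [polar_eq_zero_iff_exists_mem_closure hQ hq (ha0 := h.vec_ne_zero p) (ha := h.apply_vec p)
      (hb0 := ht0) (hb := ht) (by rw [hTt] at hgxy; exact hgxy),
      polar_eq_zero_iff_exists_mem_closure hQ hq (ha0 := h.vec_ne_zero p) (ha := h.apply_vec p)
      (hb0 := h.quadVec_ne_zero h01) (hb := h.apply_quadVec hq h01) hxy]
    rw [← hTt]
    have := hinv (y p) x
    rw [hfix' p hp] at this
    exact this
  have hpe : ∀ i, i ≠ i0 → polar Q (e i) t = polar Q (e i) (HypPairs.quadVec e f i0 i1) :=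
    fun i hi => hpol (i, true) hi
  have hpf : ∀ i, i ≠ i0 → polar Q (f i) t = polar Q (f i) (HypPairs.quadVec e f i0 i1) :=
    fun i hi => hpol (i, false) hi
  have htq : t = polar Q (f i0) t • e i0 + polar Q (e i0) t • f i0 + e i1 + f i1 := by
    rw [← sub_eq_zero]
    refine hzero _ (fun i => ?_) fun i => ?_
    · by_cases hi : i = i0
      · subst hi
        simp only [polar_sub_right, polar_add_right, polar_smul_right, h.ee, h.ef, if_true,
          if_neg h01]; simp
      · rw [polar_sub_right, hpe i hi]
        simp only [HypPairs.quadVec, polar_add_right, polar_smul_right, h.ee, h.ef, if_neg hi]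
        simp
    · by_cases hi : i = i0
      · subst hi
        simp only [polar_sub_right, polar_add_right, polar_smul_right, h.ff, h.fe, if_true,
          if_neg h01]; simp
      · rw [polar_sub_right, hpf i hi]
        simp only [HypPairs.quadVec, polar_add_right, polar_smul_right, h.ff, h.fe, if_neg hi]
        simp
  -- If α and β are the coordinates of t at e₀ and f₀, then Q(t) = αβ + 1, so α = β = 1.
  have hQt := ht
  rw [htq] at hQt
  simp only [QuadraticMap.map_add (f := Q), QuadraticMap.map_smul, h.qe, h.qf, polar_add_left,
    polar_smul_left, polar_smul_right, h.ef, h.ee, h.fe, h.ff, if_neg h01, if_true] at hQt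
  rw [hTt]
  refine singularPoint_eq ?_
  rw [htq]
  rcases eq_zero_or_eq_one hq (polar Q (f i0) t) with h1 | h1 <;>
    rcases eq_zero_or_eq_one hq (polar Q (e i0) t) with h2 | h2
  · simp [h1, h2] at hQt
  · simp [h1, h2] at hQt
  · simp [h1, h2] at hQt
  · rw [h1, h2, one_smul, one_smul]; exact self _

end BinaryPoints
end IbisOrth

namespace IbisOrth
section HalfSpin

open QuadraticMap Module

variable {F V : Type*} [Field F] [AddCommGroup V] [Module F V] {Q : QuadraticForm F V} {m : ℕ}
  {𝒮 : Set (Submodule F V)} {Z : Submodule F V}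

/-! ### A family of maximal totally singular subspaces, at least three elements in the field -/

/-- The maximal totally singular subspace through `w` that meets `Z` in the hyperplane `Z ⊓ w^⊥`. -/
def pivot (Q : QuadraticForm F V) (Z : Submodule F V) (w : V) : Submodule F V :=
  Submodule.span F {w} ⊔ (Z ⊓ perp Q (Submodule.span F {w}))

theorem mem_pivot {w s : V} :
    s ∈ pivot Q Z w ↔ ∃ c : F, ∃ y ∈ Z, polar Q w y = 0 ∧ s = c • w + y := by
  constructor
  · intro hs
    obtain ⟨u, hu, y, hy, rfl⟩ := Submodule.mem_sup.1 hs
    obtain ⟨c, rfl⟩ := Submodule.mem_span_singleton.1 hu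
    exact ⟨c, y, hy.1, mem_perp_span.1 hy.2 w rfl, rfl⟩
  · rintro ⟨c, y, hy, hwy, rfl⟩
    exact Submodule.add_mem_sup (Submodule.smul_mem _ _ (Submodule.mem_span_singleton_self w))
      ⟨hy, mem_perp_span.2 (by rintro _ rfl; exact hwy)⟩

theorem self_mem_pivot {w : V} : w ∈ pivot Q Z w :=
  mem_pivot.2 ⟨1, 0, Z.zero_mem, polar_zero_right _ _, by simp⟩

theorem mem_pivot_of_mem {w y : V} (hy : y ∈ Z) (hwy : polar Q w y = 0) : y ∈ pivot Q Z w :=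
  mem_pivot.2 ⟨0, y, hy, hwy, by simp⟩

theorem polar_eq_zero_of_mem_pivot (hZ : IsTotallySingular Q Z) {w p s : V} (hp : p ∈ Z)
    (hpw : polar Q p w = 0) (hs : s ∈ pivot Q Z w) : polar Q p s = 0 := by
  obtain ⟨c, y, hy, -, rfl⟩ := mem_pivot.1 hs
  rw [polar_add_right, polar_smul_right, hpw, hZ.polar_eq_zero hp hy]; simp

theorem inf_span_singleton_eq_bot {w : V} (hw : w ∉ Z) : Z ⊓ Submodule.span F {w} = ⊥ := by
  rw [eq_bot_iff]
  rintro x ⟨hx1, hx2⟩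
  obtain ⟨c, rfl⟩ := Submodule.mem_span_singleton.1 hx2
  by_cases hc : c = 0
  · simp [hc]
  · exact absurd ((Z.smul_mem_iff hc).1 hx1) hw

/-- The data of a family and a maximal totally singular subspace outside it. -/
structure OppositeFamily (Q : QuadraticForm F V) (m : ℕ) (𝒮 : Set (Submodule F V))
    (Z : Submodule F V) : Prop where
  fam : IsFamily Q m 𝒮
  max : IsMaxTS Q m Z
  notMem : Z ∉ 𝒮
  mem : ∀ w, Q w = 0 → w ∉ Z → pivot Q Z w ∈ 𝒮

theorem PlusSpace.finrank_inf_pivot (hQ : PlusSpace Q m) (hZ : IsMaxTS Q m Z) {w : V}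
    (hwZ : w ∉ Z) : finrank F (Z ⊓ pivot Q Z w : Submodule F V) + 1 = m := by
  have h0 : w ≠ 0 := fun h => hwZ (h ▸ Z.zero_mem)
  have h1 := finrank_inf_sup_inf_perp hQ hZ (inf_span_singleton_eq_bot hwZ)
  rwa [finrank_span_singleton h0] at h1

theorem PlusSpace.isMaxTS_pivot (hQ : PlusSpace Q m) (hZ : IsMaxTS Q m Z) {w : V} (hw : Q w = 0) :
    IsMaxTS Q m (pivot Q Z w) := hQ.isMaxTS_sup_inf hZ (isTotallySingular_span_singleton hw)

/-- One step through a hyperplane leads from a member of the family to the opposite family, and one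
more step leads back. -/
theorem exists_oppositeFamily (hQ : PlusSpace Q m) (h𝒮 : IsFamily Q m 𝒮) :
    ∃ Z, OppositeFamily Q m 𝒮 Z := by
  obtain ⟨A, hA⟩ := exists_mem_of_isFamily h𝒮
  have hAm := isMaxTS_of_isFamily h𝒮 hA
  obtain ⟨e, f, h, he⟩ := hQ.exists_hypPairs hAm 1 (by have := hQ.three_le; omega)
  have hfA : f 0 ∉ A := fun hf => by
    have := hAm.1.polar_eq_zero (he 0) hf
    rw [h.ef] at this
    simp at this
  have hZ := hQ.isMaxTS_pivot hAm (h.qf 0)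
  have h1 := hQ.finrank_inf_pivot hAm hfA
  refine ⟨pivot Q A (f 0), h𝒮, hZ, fun hmem => ?_, fun w hw hwZ => ?_⟩
  · have h2 := even_of_isFamily hQ h𝒮 hA hmem
    rw [Nat.even_iff] at h2
    omega
  · have h2 := hQ.finrank_inf_pivot hZ hwZ
    refine (mem_of_isFamily hQ h𝒮 hA _).2 ⟨hQ.isMaxTS_pivot hZ hw, ?_⟩
    have h3 := hQ.even_finrank hAm hZ (hQ.isMaxTS_pivot hZ hw)
    rw [Nat.even_iff] at h3 ⊢
    omega

namespace OppositeFamily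

/-- The member of the family through a singular vector outside `Z`. -/
def point (h : OppositeFamily Q m 𝒮 Z) (w : V) (hw : Q w = 0) (hwZ : w ∉ Z) : 𝒮 :=
  ⟨pivot Q Z w, h.mem w hw hwZ⟩

variable {e f : Fin 3 → V}

theorem notMem_of_polar (h : OppositeFamily Q m 𝒮 Z) {p w : V} (hp : p ∈ Z)
    (hpw : polar Q p w ≠ 0) : w ∉ Z := fun hw => hpw (h.max.1.polar_eq_zero hp hw)

theorem f_notMem (h : OppositeFamily Q m 𝒮 Z) (hyp : HypPairs Q e f) (he : ∀ i, e i ∈ Z)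
    (i : Fin 3) : f i ∉ Z := h.notMem_of_polar (he i) (by simp [hyp.ef])

/-- The members `pivot Q Z w` with w in ⟨f 0, f 1, f 2⟩ form a projective plane, which contains the
closure of each of its subsets. For t in T outside Z, root elements of pairs in Z show that T
contains Z ∩ t^⊥. Root elements of pairs (u, f j), with u in U = Z ∩ ⟨f⟩^⊥, put U into T, so that t
may be replaced by a vector of ⟨f⟩. -/
theorem exists_eq_point (h : OppositeFamily Q m 𝒮 Z) (hQ : PlusSpace Q m) (hyp : HypPairs Q e f)
    (he : ∀ i, e i ∈ Z) {A : Set 𝒮}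
    (hA : ∀ a ∈ A, ∃ w ∈ Submodule.span F (Set.range f), a.1 = pivot Q Z w) {T : 𝒮}
    (hT : T ∈ omegaClosure Q 𝒮 A) :
    ∃ w, ∃ hw : Q w = 0, ∃ hwZ : w ∉ Z, w ∈ Submodule.span F (Set.range f) ∧
      T = h.point w hw hwZ := by
  have := hQ.finite
  have hst := rootStable_of_isFamily hQ h.fam
  have hTm := isMaxTS_of_isFamily h.fam T.2
  have hZs := h.max.1
  obtain ⟨t, ht, htZ⟩ : ∃ t ∈ T.1, t ∉ Z := by
    by_contra! hcon
    exact h.notMem (hQ.eq_of_le hTm h.max hcon ▸ T.2)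
  obtain ⟨z', hz', hne⟩ : ∃ z' ∈ Z, polar Q z' t ≠ 0 := by
    by_contra! hcon
    exact htZ (hQ.mem_of_perp h.max hcon)
  have h1 : ∀ z ∈ Z, polar Q z t = 0 → z ∈ T.1 := by
    intro z hz hzt
    have h2 := hst.root_sub_mem hQ hT (hZs.singularPair hz hz') (fun a ha s hs => ?_) ht
    · rwa [hzt, zero_smul, zero_sub, T.1.neg_mem_iff, T.1.smul_mem_iff hne] at h2
    · obtain ⟨w, -, hw⟩ := hA a ha
      rw [hw] at hs ⊢
      obtain ⟨c, y, hy, hwy, rfl⟩ := mem_pivot.1 hs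
      refine mem_pivot_of_mem (Z.sub_mem (Z.smul_mem _ hz') (Z.smul_mem _ hz)) ?_
      simp only [polar_sub_left, polar_add_right, polar_smul_right, polar_smul_left,
        hZs.polar_eq_zero hz hy, hZs.polar_eq_zero hz' hy, polar_comm Q w, smul_eq_mul]
      ring
  set U := Z ⊓ perp Q (Submodule.span F (Set.range f)) with hU
  have hUd : finrank F U + 3 = m := hyp.finrank_inf_perp hQ h.max he
  have hfU : ∀ u ∈ U, ∀ i, polar Q (f i) u = 0 := fun u hu i => mem_perp_span.1 hu.2 _ ⟨i, rfl⟩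
  have hUT : ∀ u ∈ U, u ∈ T.1 := by
    obtain ⟨y, hy, hyU⟩ : ∃ y ∈ Z ⊓ perp Q (Submodule.span F {t}), y ∉ U := by
      by_contra! hcon
      have d1 := Submodule.finrank_mono (show _ ≤ U from hcon)
      have d2 := hQ.finrank_inf_perp h.max (Submodule.span F {t})
      have d3 := finrank_span_singleton_le_one (F := F) t
      omega
    have hyt : polar Q y t = 0 := by rw [polar_comm]; exact mem_perp_span.1 hy.2 t rfl
    obtain ⟨j, hj⟩ : ∃ j, polar Q (f j) y ≠ 0 := by
      by_contra! hcon
      exact hyU ⟨hy.1, mem_perp_span.2 (by rintro _ ⟨j, rfl⟩; exact hcon j)⟩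
    intro u hu
    have h2 := hst.root_sub_mem hQ hT (u := u) (v := f j)
      ⟨hZs u hu.1, hyp.qf j, by rw [polar_comm]; exact hfU u hu j⟩ (fun a ha s hs => ?_)
      (h1 y hy.1 hyt)
    · rwa [hZs.polar_eq_zero hu.1 hy.1, zero_smul, zero_sub, T.1.neg_mem_iff,
        T.1.smul_mem_iff hj] at h2
    · obtain ⟨w, hwf, hw⟩ := hA a ha
      rw [hw] at hs ⊢
      have huw : polar Q w u = 0 := hu.2 w hwf
      rw [polar_eq_zero_of_mem_pivot hZs hu.1 (by rw [polar_comm]; exact huw) hs, zero_smul,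
        zero_sub]
      exact Submodule.neg_mem _ (Submodule.smul_mem _ _ (mem_pivot_of_mem hu.1 huw))
  -- The vector of ⟨f⟩ with the same polar values on Z as t; thus t - w lies in Z^⊥ = Z.
  set w := ∑ i, polar Q (e i) t • f i with hw
  have hwf : w ∈ Submodule.span F (Set.range f) :=
    Submodule.sum_mem _ fun i _ => Submodule.smul_mem _ _ (Submodule.subset_span ⟨i, rfl⟩)
  have hfs : IsTotallySingular Q (Submodule.span F (Set.range f)) :=
    isTotallySingular_span (by rintro _ ⟨i, rfl⟩; exact hyp.qf i)
      (by rintro _ ⟨i, rfl⟩ _ ⟨j, rfl⟩; exact hyp.ff i j)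
  have hsw : ∀ s ∈ Z, polar Q s w = polar Q s t := by
    intro s hs
    have hu : s - ∑ i, polar Q (f i) s • e i ∈ U := by
      refine ⟨Z.sub_mem hs (Submodule.sum_mem _ fun i _ => Z.smul_mem _ (he i)),
        mem_perp_span.2 ?_⟩
      rintro _ ⟨j, rfl⟩
      rw [Fin.sum_univ_three]
      simp only [polar_sub_right, polar_add_right, polar_smul_right, hyp.fe]
      fin_cases j <;> simp
    have k1 : polar Q (s - ∑ i, polar Q (f i) s • e i) t = 0 :=
      hTm.1.polar_eq_zero (hUT _ hu) ht
    have k2 : polar Q (s - ∑ i, polar Q (f i) s • e i) w = 0 := by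
      rw [polar_comm]; exact hu.2 w hwf
    rw [polar_sub_left, sub_eq_zero] at k1 k2
    rw [k1, k2, hw, Fin.sum_univ_three, Fin.sum_univ_three]
    simp only [polar_add_left, polar_add_right, polar_smul_left, polar_smul_right, hyp.ef]
    simp
    ring
  have htw : t - w ∈ Z := hQ.mem_of_perp h.max fun s hs => by
    rw [polar_sub_right, hsw s hs, sub_self]
  have hwZ : w ∉ Z := fun hwZ => htZ (by simpa using Z.add_mem htw hwZ)
  have hwp : polar Q w (t - w) = 0 := by
    have k1 := hTm.1 t ht
    rw [show t = w + (t - w) by abel, QuadraticMap.map_add (f := Q), hfs w hwf, hZs _ htw] at k1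
    simpa using k1
  refine ⟨w, hfs w hwf, hwZ, hwf, Subtype.ext
    (hQ.eq_of_le (hQ.isMaxTS_pivot h.max (hfs w hwf)) hTm ?_).symm⟩
  have hwT : w ∈ T.1 := by
    have k1 : t - w ∈ T.1 := h1 _ htw (by
      rw [← hsw _ htw, polar_comm]; exact hwp)
    simpa using T.1.sub_mem ht k1
  intro s hs
  obtain ⟨c, y, hy, hwy, rfl⟩ := mem_pivot.1 hs
  exact T.1.add_mem (T.1.smul_mem _ hwT) (h1 y hy (by rw [← hsw y hy, polar_comm]; exact hwy))

/-- Isometries stabilizing `Z` act on the points through their action on hyperplanes of `Z`. -/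
theorem map_pivot_of_smul (h : OppositeFamily Q m 𝒮 Z) (hQ : PlusSpace Q m) {g : V ≃ₗ[F] V}
    (hg : g ∈ isometryGroup Q) (hgZ : ∀ z ∈ Z, g z ∈ Z) {w : V} (hw : Q w = 0) (hwZ : w ∉ Z)
    (hgw : ∀ z ∈ Z, polar Q w z = 0 → polar Q w (g z) = 0) :
    (pivot Q Z w).map (g : V →ₗ[F] V) = pivot Q Z w := by
  have := hQ.finite
  have hmax := hQ.isMaxTS_pivot h.max hw
  have hmax' : IsMaxTS Q m ((pivot Q Z w).map (g : V →ₗ[F] V)) :=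
    ⟨isTotallySingular_map hg hmax.1, (LinearEquiv.finrank_map_eq g _).trans hmax.2⟩
  have hZmap := map_eq_of_le hgZ
  have h1 : ∀ z ∈ Z, polar Q w z = 0 → z ∈ (pivot Q Z w).map (g : V →ₗ[F] V) := by
    have h2 : (Z ⊓ perp Q (Submodule.span F {w})).map (g : V →ₗ[F] V) =
        Z ⊓ perp Q (Submodule.span F {w}) := map_eq_of_le fun z hz =>
      ⟨hgZ z hz.1, mem_perp_span.2 (by
        rintro _ rfl; exact hgw z hz.1 (mem_perp_span.1 hz.2 _ rfl))⟩
    intro z hz hwz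
    have h3 : z ∈ (Z ⊓ perp Q (Submodule.span F {w})).map (g : V →ₗ[F] V) := by
      rw [h2]; exact ⟨hz, mem_perp_span.2 (by rintro _ rfl; exact hwz)⟩
    exact Submodule.map_mono le_sup_right h3
  -- The image contains the hyperplane Z ∩ w^⊥, so it is Z or the pivot; it is not Z, because g
  -- stabilizes Z.
  rcases hQ.eq_or_eq_of_hyperplane hmax' h.max hmax (hQ.finrank_inf_pivot h.max hwZ) (by
    rintro z ⟨hz, hz'⟩
    obtain ⟨c, y, hy, hwy, rfl⟩ := mem_pivot.1 hz'
    refine h1 _ hz ?_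
    rw [polar_add_right, polar_smul_right, polar_self, hw, hwy]; simp) with h2 | h2
  · exfalso
    rw [← hZmap] at h2
    have h3 := Submodule.map_injective_of_injective (f := (g : V →ₗ[F] V)) g.injective h2
    exact hwZ (h3 ▸ self_mem_pivot)
  · exact h2

theorem point_eq_point (h : OppositeFamily Q m 𝒮 Z) {w w' : V} {hw : Q w = 0}
    {hwZ : w ∉ Z} {hw' : Q w' = 0} {hwZ' : w' ∉ Z} {c : F} (hc : w' = c • w) :
    h.point w hw hwZ = h.point w' hw' hwZ' := by
  have hc0 : c ≠ 0 := by
    rintro rfl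
    rw [zero_smul] at hc
    exact hwZ' (hc ▸ Z.zero_mem)
  refine Subtype.ext ?_
  change pivot Q Z w = pivot Q Z w'
  rw [pivot, pivot, hc, Submodule.span_singleton_smul_eq (IsUnit.mk0 c hc0)]

theorem exists_smul_of_point_eq (h : OppositeFamily Q m 𝒮 Z) (hyp : HypPairs Q e f)
    (he : ∀ i, e i ∈ Z) {w w' : V} (hwf : w ∈ Submodule.span F (Set.range f))
    (hwf' : w' ∈ Submodule.span F (Set.range f)) (heq : w' ∈ pivot Q Z w) :
    ∃ c : F, w' = c • w := by
  obtain ⟨c, y, hy, -, hc⟩ := mem_pivot.1 heq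
  refine ⟨c, ?_⟩
  have h1 : y ∈ Z ⊓ Submodule.span F (Set.range f) :=
    ⟨hy, by rw [← sub_eq_of_eq_add' hc]; exact Submodule.sub_mem _ hwf' (Submodule.smul_mem _ _ hwf)⟩
  rw [hyp.inf_span_right h.max.1 he, Submodule.mem_bot] at h1
  rw [hc, h1, add_zero]

/-- A torus element scaling f i and f k by s⁻¹ and s and fixing f j fixes the three vertices, but no
point with nonzero coordinates at both i and j. -/
theorem closure_triangle (h : OppositeFamily Q m 𝒮 Z) (hQ : PlusSpace Q m) (hyp : HypPairs Q e f)
    (he : ∀ i, e i ∈ Z) {s : F} (hs0 : s ≠ 0) (hs1 : s ≠ 1) {T : 𝒮}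
    (hT : T ∈ omegaClosure Q 𝒮 (Set.range fun i => h.point (f i) (hyp.qf i) (h.f_notMem hyp he i))) :
    ∃ i, T = h.point (f i) (hyp.qf i) (h.f_notMem hyp he i) := by
  have := hQ.finite
  have hst := rootStable_of_isFamily hQ h.fam
  have hZs := h.max.1
  obtain ⟨w, hw, hwZ, hwf, rfl⟩ := h.exists_eq_point hQ hyp he (by
    rintro _ ⟨i, rfl⟩
    exact ⟨f i, Submodule.subset_span ⟨i, rfl⟩, rfl⟩) hT
  have hsum := hyp.eq_sum (Submodule.span_mono Set.subset_union_right hwf)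
  have hfw : ∀ i, polar Q (f i) w = 0 := fun i => by
    have h1 : f i ∈ perp Q (Submodule.span F (Set.range f)) :=
      mem_perp_span.2 (by rintro _ ⟨j, rfl⟩; exact hyp.ff j i)
    rw [polar_comm]; exact h1 w hwf
  simp only [hfw, zero_smul, Finset.sum_const_zero, zero_add] at hsum
  have key : ∀ i j k : Fin 3, i ≠ j → i ≠ k → j ≠ k → polar Q (e i) w = 0 ∨ polar Q (e j) w = 0 := by
    intro i j k hij hik hjk
    obtain ⟨g, hg, hgz⟩ := hyp.exists_torus hik hs0
    have h1 := hst.map_eq_of_mem_omegaClosure hQ hT hg (by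
      rintro _ ⟨l, rfl⟩
      refine h.map_pivot_of_smul hQ (omegaGroup_le_isometryGroup Q (rootGroup_le_omegaGroup hQ hg))
        (fun z hz => ?_) (hyp.qf l) (h.f_notMem hyp he l) (fun z hz hlz => ?_)
      · rw [hgz, hZs.polar_eq_zero (he i) hz, hZs.polar_eq_zero (he k) hz]
        simp only [mul_zero, zero_smul, add_zero]
        exact Z.add_mem (Z.add_mem hz (Z.smul_mem _ (he i))) (Z.smul_mem _ (he k))
      · rw [hgz, hZs.polar_eq_zero (he i) hz, hZs.polar_eq_zero (he k) hz]
        simp only [mul_zero, zero_smul, add_zero, polar_add_right, polar_smul_right, hlz, hyp.fe,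
          zero_add]
        by_cases h1 : l = i
        · subst h1; simp [hlz, hik]
        · by_cases h2 : l = k
          · subst h2; simp [hlz, h1]
          · simp [h1, h2])
    have h2 : g w ∈ pivot Q Z w := by
      have h3 : g w ∈ (pivot Q Z w).map (g : V →ₗ[F] V) := ⟨w, self_mem_pivot, rfl⟩
      rwa [show (pivot Q Z w).map (g : V →ₗ[F] V) = pivot Q Z w from h1] at h3
    have h4 : g w = w + ((s⁻¹ - 1) * polar Q (e i) w) • f i + ((s - 1) * polar Q (e k) w) • f k := by
      rw [hgz, hfw, hfw]; simp
    have h5 : g w ∈ Submodule.span F (Set.range f) := by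
      rw [h4]
      exact Submodule.add_mem _ (Submodule.add_mem _ hwf
        (Submodule.smul_mem _ _ (Submodule.subset_span ⟨i, rfl⟩)))
        (Submodule.smul_mem _ _ (Submodule.subset_span ⟨k, rfl⟩))
    obtain ⟨c, hc⟩ := h.exists_smul_of_point_eq hyp he hwf h5 h2
    rw [h4] at hc
    have h6 := congrArg (polar Q (e i)) hc
    have h7 := congrArg (polar Q (e j)) hc
    simp only [polar_add_right, polar_smul_right, hyp.ef, if_neg hik, if_neg hij.symm, if_neg hjk,
      if_true] at h6 h7
    simp at h6 h7
    by_contra! hcon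
    have hc1 : c = 1 := (mul_right_cancel₀ hcon.2 (by rw [one_mul]; exact h7)).symm
    rw [hc1] at h6
    have : (s⁻¹ - 1) * polar Q (e i) w = 0 := by linear_combination h6
    rcases mul_eq_zero.1 this with h8 | h8
    · exact hs1 (inv_eq_one.1 (sub_eq_zero.1 h8))
    · exact hcon.1 h8
  have k01 := key 0 1 2 (by decide) (by decide) (by decide)
  have k02 := key 0 2 1 (by decide) (by decide) (by decide)
  have k12 := key 1 2 0 (by decide) (by decide) (by decide)
  rw [Fin.sum_univ_three] at hsum
  have fin : ∀ i, w = polar Q (e i) w • f i →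
      ∃ i, h.point w hw hwZ = h.point (f i) (hyp.qf i) (h.f_notMem hyp he i) :=
    fun i hi => ⟨i, (h.point_eq_point hi).symm⟩
  by_cases h0 : polar Q (e 0) w = 0
  · by_cases h1 : polar Q (e 1) w = 0
    · exact fin 2 (by simpa [h0, h1] using hsum)
    · have h2 := k12.resolve_left h1
      exact fin 1 (by simpa [h0, h2] using hsum)
  · have h1 := k01.resolve_left h0
    have h2 := k02.resolve_left h0
    exact fin 0 (by simpa [h1, h2] using hsum)

theorem add_notMem (h : OppositeFamily Q m 𝒮 Z) (hyp : HypPairs Q e f) (he : ∀ i, e i ∈ Z)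
    (c : F) : f 0 + c • f 1 ∉ Z := h.notMem_of_polar (he 0) (by
  rw [polar_add_right, polar_smul_right, hyp.ef, hyp.ef]; simp)

theorem apply_add (hyp : HypPairs Q e f) (c : F) : Q (f 0 + c • f 1) = 0 := by
  rw [QuadraticMap.map_add (f := Q), QuadraticMap.map_smul, hyp.qf, hyp.qf, polar_smul_right,
    hyp.ff]; simp

/-- The member with parameter c on a line is expressed linearly through those with parameters 0, ∞
and 1, so a linear map stabilizing these three stabilizes every member of the line. -/
theorem mem_pivot_add_iff (h : OppositeFamily Q m 𝒮 Z) (hyp : HypPairs Q e f) (he : ∀ i, e i ∈ Z)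
    (c : F) (v : V) : v ∈ pivot Q Z (f 0 + c • f 1) ↔ ∃ p ∈ pivot Q Z (f 0), ∃ q ∈ pivot Q Z (f 1),
      p + q ∈ pivot Q Z (f 0 + (1 : F) • f 1) ∧ v = p + c • q := by
  constructor
  · intro hv
    obtain ⟨a, y, hy, hwy, rfl⟩ := mem_pivot.1 hv
    rw [polar_add_left, polar_smul_left] at hwy
    -- The multiples of e 0 make the Z-part of p orthogonal to f 0 and that of p + q orthogonal to f
    -- 0 + f 1. They cancel in p + c q because y is orthogonal to f 0 + c f 1.
    refine ⟨a • f 0 + (y - polar Q (f 0) y • e 0), mem_pivot.2 ⟨a, _,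
      Z.sub_mem hy (Z.smul_mem _ (he 0)), ?_, rfl⟩, a • f 1 - polar Q (f 1) y • e 0,
      mem_pivot.2 ⟨a, -(polar Q (f 1) y • e 0), Z.neg_mem (Z.smul_mem _ (he 0)), ?_, by abel⟩,
      mem_pivot.2 ⟨a, y - polar Q (f 0) y • e 0 - polar Q (f 1) y • e 0,
        Z.sub_mem (Z.sub_mem hy (Z.smul_mem _ (he 0))) (Z.smul_mem _ (he 0)), ?_, by module⟩, ?_⟩
    · rw [polar_sub_right, polar_smul_right, hyp.fe]; simp
    · rw [polar_neg_right, polar_smul_right, hyp.fe]; simp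
    · simp only [polar_add_left, polar_sub_right, polar_smul_right, polar_smul_left, hyp.fe]
      simp
    · have : polar Q (f 0) y = -(c * polar Q (f 1) y) := by
        rw [smul_eq_mul] at hwy; linear_combination hwy
      rw [this]; module
  · rintro ⟨p, hp, q, hq, hpq, rfl⟩
    obtain ⟨a, y, hy, hwy, rfl⟩ := mem_pivot.1 hp
    obtain ⟨b, z, hz, hwz, rfl⟩ := mem_pivot.1 hq
    obtain ⟨d, x, hx, hwx, hd⟩ := mem_pivot.1 hpq
    have hZs := h.max.1
    have h0 := congrArg (polar Q (e 0)) hd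
    have h1 := congrArg (polar Q (e 1)) hd
    simp only [polar_add_right, polar_smul_right, hyp.ef, hZs.polar_eq_zero (he _) hy,
      hZs.polar_eq_zero (he _) hz, hZs.polar_eq_zero (he _) hx] at h0 h1
    simp at h0 h1
    subst h0 h1
    have hxyz : x = y + z := by
      have := sub_eq_zero.2 hd
      rw [← sub_eq_zero, ← neg_eq_zero, ← this]; module
    rw [hxyz, polar_add_left, polar_add_right, polar_add_right, polar_smul_left, polar_smul_left,
      hwy, hwz] at hwx
    refine mem_pivot.2 ⟨b, y + c • z, Z.add_mem hy (Z.smul_mem _ hz), ?_, by module⟩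
    rw [polar_add_left, polar_add_right, polar_add_right, polar_smul_left, polar_smul_left,
      polar_smul_right, polar_smul_right, hwy, hwz]
    simp at hwx ⊢
    linear_combination c * hwx

/-- The points of a line are fixed by the stabilizer of three of them. -/
theorem line_mem_closure (h : OppositeFamily Q m 𝒮 Z) (hQ : PlusSpace Q m) (hyp : HypPairs Q e f)
    (he : ∀ i, e i ∈ Z) (c : F) :
    h.point (f 0 + c • f 1) (apply_add hyp c) (h.add_notMem hyp he c) ∈ omegaClosure Q 𝒮
      {h.point (f 0) (hyp.qf 0) (h.f_notMem hyp he 0),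
        h.point (f 1) (hyp.qf 1) (h.f_notMem hyp he 1),
        h.point (f 0 + (1 : F) • f 1) (apply_add hyp 1) (h.add_notMem hyp he 1)} := by
  have := hQ.finite
  refine mem_omegaClosure fun g _ hA => map_eq_of_le fun v hv => ?_
  have stab : ∀ a : 𝒮, a.1.map (g : V →ₗ[F] V) = a.1 → ∀ v ∈ a.1, g v ∈ a.1 := by
    intro a ha v hv
    have : g v ∈ a.1.map (g : V →ₗ[F] V) := ⟨v, hv, rfl⟩
    rwa [ha] at this
  obtain ⟨p, hp, q, hq, hpq, rfl⟩ := (h.mem_pivot_add_iff hyp he c v).1 hv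
  refine (h.mem_pivot_add_iff hyp he c _).2 ⟨g p, stab _ (hA _ (Or.inl rfl)) p hp, g q,
    stab _ (hA _ (Or.inr (Or.inl rfl))) q hq, ?_, by rw [map_add, map_smul]⟩
  rw [← map_add]
  exact stab _ (hA _ (Or.inr (Or.inr rfl))) _ hpq

end OppositeFamily
end HalfSpin
end IbisOrth

namespace IbisOrth
-- Lines and frames in the projective plane of members adjacent to Z
section HalfSpinLarge

open QuadraticMap Module

variable {F V : Type*} [Field F] [AddCommGroup V] [Module F V] {Q : QuadraticForm F V} {m : ℕ}
  {𝒮 : Set (Submodule F V)} {Z : Submodule F V}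

namespace OppositeFamily

variable {e f : Fin 3 → V}

theorem add_add_notMem (h : OppositeFamily Q m 𝒮 Z) (hyp : HypPairs Q e f) (he : ∀ i, e i ∈ Z) :
    f 0 + f 1 + f 2 ∉ Z := h.notMem_of_polar (he 0) (by
  rw [polar_add_right, polar_add_right, hyp.ef, hyp.ef, hyp.ef]; simp)

theorem apply_add_add (hyp : HypPairs Q e f) : Q (f 0 + f 1 + f 2) = 0 := by
  rw [QuadraticMap.map_add (f := Q), QuadraticMap.map_add (f := Q), polar_add_left]
  simp [hyp.qf, hyp.ff]

theorem eq_sum_right (hyp : HypPairs Q e f) {w : V} (hw : w ∈ Submodule.span F (Set.range f)) :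
    w = polar Q (e 0) w • f 0 + polar Q (e 1) w • f 1 + polar Q (e 2) w • f 2 := by
  have hsum := hyp.eq_sum (Submodule.span_mono Set.subset_union_right hw)
  have hfw : ∀ i, polar Q (f i) w = 0 := fun i => by
    have h1 : f i ∈ perp Q (Submodule.span F (Set.range f)) :=
      mem_perp_span.2 (by rintro _ ⟨j, rfl⟩; exact hyp.ff j i)
    rw [polar_comm]; exact h1 w hw
  simp only [hfw, zero_smul, Finset.sum_const_zero, zero_add] at hsum
  rwa [Fin.sum_univ_three] at hsum

/-- A line of points is mapped into the span of the images of two of its points. -/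
theorem polar_eq_zero_of_apply_line [Finite F] (h : OppositeFamily Q m 𝒮 Z) (hQ : PlusSpace Q m)
    (hyp : HypPairs Q e f) (he : ∀ i, e i ∈ Z) {s : F} (hs0 : s ≠ 0) (hs1 : s ≠ 1)
    {G : Subgroup (Equiv.Perm 𝒮)}
    (hnorm : ∀ g ∈ G, ∀ n ∈ inducedPerm (omegaGroup Q) 𝒮, g * n * g⁻¹ ∈
      inducedPerm (omegaGroup Q) 𝒮) {g : Equiv.Perm 𝒮} (hg : g ∈ G)
    (h0 : g (h.point (f 0) (hyp.qf 0) (h.f_notMem hyp he 0)) =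
      h.point (f 0) (hyp.qf 0) (h.f_notMem hyp he 0))
    (h1 : g (h.point (f 1) (hyp.qf 1) (h.f_notMem hyp he 1)) =
      h.point (f 1) (hyp.qf 1) (h.f_notMem hyp he 1)) {φ : V} {hφ : Q φ = 0} {hφZ : φ ∉ Z}
    (hφf : φ ∈ Submodule.span F (Set.range f))
    (hx : g (h.point (f 0 + (1 : F) • f 1) (apply_add hyp 1) (h.add_notMem hyp he 1)) =
      h.point φ hφ hφZ) : polar Q (e 2) φ = 0 := by
  by_contra hne
  have hfφ : ∀ i, polar Q (f i) φ = 0 := fun i => by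
    have h1 : f i ∈ perp Q (Submodule.span F (Set.range f)) :=
      mem_perp_span.2 (by rintro _ ⟨j, rfl⟩; exact hyp.ff j i)
    rw [polar_comm]; exact h1 φ hφf
  have hφf' : ∀ i, polar Q φ (f i) = 0 := fun i => by rw [polar_comm]; exact hfφ i
  set p0 := polar Q (e 0) φ with hp0
  set p1 := polar Q (e 1) φ with hp1
  set p2 := polar Q (e 2) φ with hp2
  -- If φ were off the line, f 0, f 1, φ would span a triangle; this is the dual system in Z.
  set e' : Fin 3 → V := ![e 0 - (p0 / p2) • e 2, e 1 - (p1 / p2) • e 2, p2⁻¹ • e 2] with he'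
  set f' : Fin 3 → V := ![f 0, f 1, φ] with hf'
  have heZ : ∀ i, e' i ∈ Z := by
    intro i
    fin_cases i
    · exact Z.sub_mem (he 0) (Z.smul_mem _ (he 2))
    · exact Z.sub_mem (he 1) (Z.smul_mem _ (he 2))
    · exact Z.smul_mem _ (he 2)
  have hyp' : HypPairs Q e' f' := by
    refine ⟨fun i => h.max.1 _ (heZ i), fun i => ?_,
      fun i j => h.max.1.polar_eq_zero (heZ i) (heZ j), fun i j => ?_, fun i j => ?_⟩
    · fin_cases i
      exacts [hyp.qf 0, hyp.qf 1, hφ]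
    · fin_cases i <;> fin_cases j
      exacts [hyp.ff 0 0, hyp.ff 0 1, hfφ 0, hyp.ff 1 0, hyp.ff 1 1, hfφ 1, hφf' 0, hφf' 1,
        by simp [f', polar_self, hφ]]
    · fin_cases i <;> fin_cases j <;>
        simp [e', f', polar_sub_left, polar_smul_left, hyp.ef, ← hp0, ← hp1, ← hp2, hne]
  set y := h.point (f 0 + s • f 1) (apply_add hyp s) (h.add_notMem hyp he s)
  -- A fourth point y of the line lies in the closure of three of its points, so g y lies in the
  -- closure of the triangle and is a vertex. Then y is one of the original three points, contrary
  -- to s ≠ 0, 1.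
  have hy := (apply_mem_fixedClosure_iff hnorm hg).2 (h.line_mem_closure hQ hyp he s)
  rw [Set.image_insert_eq, Set.image_pair, h0, h1, hx] at hy
  obtain ⟨i, hi⟩ := h.closure_triangle hQ hyp' heZ hs0 hs1 (T := g y)
    (fixedClosure_subset (by
      rintro _ (rfl | rfl | rfl)
      exacts [subset_fixedClosure _ _ ⟨0, rfl⟩, subset_fixedClosure _ _ ⟨1, rfl⟩,
        subset_fixedClosure _ _ ⟨2, rfl⟩]) hy)
  have hmemf : ∀ i, f i ∈ Submodule.span F (Set.range f) := fun i => Submodule.subset_span ⟨i, rfl⟩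
  have key : ∀ {w : V} {hw : Q w = 0} {hwZ : w ∉ Z}, w ∈ Submodule.span F (Set.range f) →
      g y = g (h.point w hw hwZ) → ∃ c : F, f 0 + s • f 1 = c • w := by
    intro w hw hwZ hwf hgy
    refine h.exists_smul_of_point_eq hyp he hwf
      (Submodule.add_mem _ (hmemf 0) (Submodule.smul_mem _ _ (hmemf 1))) ?_
    rw [← show y.1 = pivot Q Z w from congrArg Subtype.val (g.injective hgy)]
    exact self_mem_pivot
  have coords : ∀ {c a b : F}, f 0 + s • f 1 = c • (a • f 0 + b • f 1) → 1 = c * a ∧ s = c * b := by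
    intro c a b hc
    have k0 := congrArg (polar Q (e 0)) hc
    have k1 := congrArg (polar Q (e 1)) hc
    simp only [polar_add_right, polar_smul_right, hyp.ef] at k0 k1
    simpa using And.intro k0 k1
  fin_cases i
  · obtain ⟨c, hc⟩ := key (hmemf 0) (hi.trans h0.symm)
    have := (coords (c := c) (a := 1) (b := 0) (by rw [hc]; module)).2
    exact hs0 (by simpa using this)
  · obtain ⟨c, hc⟩ := key (hmemf 1) (hi.trans h1.symm)
    have := (coords (c := c) (a := 0) (b := 1) (by rw [hc]; module)).1
    simp at this
  · obtain ⟨c, hc⟩ := key (Submodule.add_mem _ (hmemf 0) (Submodule.smul_mem _ _ (hmemf 1)))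
      (hi.trans hx.symm)
    have := coords (c := c) (a := 1) (b := 1) (by rw [hc]; module)
    exact hs1 (by rw [this.2, ← this.1])

/-- The stabilizer of the vertices and of the unit point of a frame fixes a point of a side. -/
theorem frame_mem_closure (h : OppositeFamily Q m 𝒮 Z) (hQ : PlusSpace Q m) (hyp : HypPairs Q e f)
    (he : ∀ i, e i ∈ Z) :
    h.point (f 0 + (1 : F) • f 1) (apply_add hyp 1) (h.add_notMem hyp he 1) ∈ omegaClosure Q 𝒮
      {h.point (f 0) (hyp.qf 0) (h.f_notMem hyp he 0),
        h.point (f 1) (hyp.qf 1) (h.f_notMem hyp he 1),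
        h.point (f 2) (hyp.qf 2) (h.f_notMem hyp he 2),
        h.point (f 0 + f 1 + f 2) (apply_add_add hyp) (h.add_add_notMem hyp he)} := by
  have := hQ.finite
  refine mem_omegaClosure fun g hg hA => ?_
  have stab : ∀ a : 𝒮, a.1.map (g : V →ₗ[F] V) = a.1 → ∀ v ∈ a.1, g v ∈ a.1 := by
    intro a ha v hv
    have : g v ∈ a.1.map (g : V →ₗ[F] V) := ⟨v, hv, rfl⟩
    rwa [ha] at this
  have hstab : ∀ i, ∀ v ∈ pivot Q Z (f i), g v ∈ pivot Q Z (f i) := by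
    intro i
    fin_cases i
    exacts [stab _ (hA _ (Or.inl rfl)), stab _ (hA _ (Or.inr (Or.inl rfl))),
      stab _ (hA _ (Or.inr (Or.inr (Or.inl rfl))))]
  have hstab' := stab _ (hA _ (Or.inr (Or.inr (Or.inr rfl))))
  have hperp : ∀ {w : V}, Q w = 0 → ∀ {s}, s ∈ pivot Q Z w → polar Q w s = 0 := fun hw _ hs =>
    (hQ.isMaxTS_pivot h.max hw).1.polar_eq_zero self_mem_pivot hs
  -- Distinct vertices intersect inside Z, so g stabilizes enough of Z to stabilize all of it.
  have hZ : ∀ {i j : Fin 3} {s : V}, i ≠ j → s ∈ pivot Q Z (f i) → s ∈ pivot Q Z (f j) → s ∈ Z := by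
    intro i j s hij hi hj
    obtain ⟨c, y, hy, -, rfl⟩ := mem_pivot.1 hi
    have h1 := polar_eq_zero_of_mem_pivot h.max.1 (he i) (by rw [hyp.ef, if_neg hij]) hj
    rw [polar_add_right, polar_smul_right, hyp.ef, h.max.1.polar_eq_zero (he i) hy] at h1
    simp at h1
    simpa [h1] using hy
  have hepiv : ∀ {i j : Fin 3}, i ≠ j → e j ∈ pivot Q Z (f i) := fun {i j} hij =>
    mem_pivot_of_mem (he j) (by rw [hyp.fe, if_neg hij])
  have hgeZ : ∀ i, g (e i) ∈ Z := by
    intro i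
    obtain ⟨j, k, hj, hk, hjk⟩ : ∃ j k : Fin 3, j ≠ i ∧ k ≠ i ∧ j ≠ k := by
      fin_cases i <;> decide
    exact hZ hjk (hstab _ _ (hepiv hj)) (hstab _ _ (hepiv hk))
  have hge : ∀ {i j : Fin 3}, i ≠ j → polar Q (f i) (g (e j)) = 0 := fun hij =>
    hperp (hyp.qf _) (hstab _ _ (hepiv hij))
  have hdecomp : ∀ z ∈ Z, ∃ u ∈ Z, (∀ i, polar Q (f i) u = 0) ∧ z = polar Q (f 0) z • e 0 +
      polar Q (f 1) z • e 1 + polar Q (f 2) z • e 2 + u := by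
    intro z hz
    refine ⟨z - (polar Q (f 0) z • e 0 + polar Q (f 1) z • e 1 + polar Q (f 2) z • e 2),
      Z.sub_mem hz (Z.add_mem (Z.add_mem (Z.smul_mem _ (he 0)) (Z.smul_mem _ (he 1)))
        (Z.smul_mem _ (he 2))), fun i => ?_, by abel⟩
    simp only [polar_sub_right, polar_add_right, polar_smul_right, hyp.fe]
    fin_cases i <;> simp
  have hgu : ∀ u ∈ Z, (∀ i, polar Q (f i) u = 0) → g u ∈ Z ∧ ∀ i, polar Q (f i) (g u) = 0 := by
    intro u hu hfu
    have h1 : ∀ i, g u ∈ pivot Q Z (f i) := fun i => hstab i _ (mem_pivot_of_mem hu (hfu i))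
    exact ⟨hZ (i := 0) (j := 1) (by decide) (h1 0) (h1 1), fun i => hperp (hyp.qf i) (h1 i)⟩
  have hgZ : ∀ z ∈ Z, g z ∈ Z := by
    intro z hz
    obtain ⟨u, hu, hfu, hz'⟩ := hdecomp z hz
    rw [hz']
    simp only [map_add, map_smul]
    exact Z.add_mem (Z.add_mem (Z.add_mem (Z.smul_mem _ (hgeZ 0)) (Z.smul_mem _ (hgeZ 1)))
      (Z.smul_mem _ (hgeZ 2))) (hgu u hu hfu).1
  -- The vertices make the action on Z modulo U diagonal; the unit point makes these two diagonal
  -- entries equal.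
  have hdiag : polar Q (f 0) (g (e 0)) = polar Q (f 1) (g (e 1)) := by
    have h1 : e 0 - e 1 ∈ pivot Q Z (f 0 + f 1 + f 2) := mem_pivot_of_mem (Z.sub_mem (he 0) (he 1))
      (by simp [polar_add_left, polar_sub_right, hyp.fe])
    have h2 := hperp (apply_add_add hyp) (hstab' _ h1)
    rw [map_sub] at h2
    simp only [polar_add_left, polar_sub_right] at h2
    rw [hge (i := 0) (j := 1) (by decide), hge (i := 1) (j := 0) (by decide),
      hge (i := 2) (j := 0) (by decide), hge (i := 2) (j := 1) (by decide)] at h2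
    linear_combination h2
  refine h.map_pivot_of_smul hQ hg hgZ (apply_add hyp 1) (h.add_notMem hyp he 1) fun z hz hwz => ?_
  obtain ⟨u, hu, hfu, hz'⟩ := hdecomp z hz
  have hgz := congrArg g hz'
  simp only [map_add, map_smul] at hgz
  rw [hgz]
  simp only [polar_add_left, polar_smul_left, polar_add_right, polar_smul_right] at hwz ⊢
  rw [(hgu u hu hfu).2 0, (hgu u hu hfu).2 1, hge (i := 0) (j := 1) (by decide),
    hge (i := 1) (j := 0) (by decide), hge (i := 0) (j := 2) (by decide),
    hge (i := 1) (j := 2) (by decide), hdiag]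
  simp only [smul_eq_mul] at hwz ⊢
  linear_combination polar Q (f 1) (g (e 1)) * hwz

theorem exists_move_point (h : OppositeFamily Q m 𝒮 Z) (hQ : PlusSpace Q m) {g : V ≃ₗ[F] V}
    (hg : g ∈ rootGroup Q) (hgZ : ∀ z ∈ Z, g z ∈ Z) {L : Set 𝒮}
    (hL : ∀ a ∈ L, ∃ w, Q w = 0 ∧ w ∉ Z ∧ a.1 = pivot Q Z w ∧
      ∀ z ∈ Z, polar Q w z = 0 → polar Q w (g z) = 0)
    {w : V} {hw : Q w = 0} {hwZ : w ∉ Z} {z : V} (hz : z ∈ Z) (hwz : polar Q w z = 0)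
    (hne : polar Q w (g z) ≠ 0) :
    ∃ σ ∈ inducedPerm (omegaGroup Q) 𝒮, (∀ a ∈ L, σ a = a) ∧
      σ (h.point w hw hwZ) ≠ h.point w hw hwZ := by
  obtain ⟨σ, hσ, hσg⟩ := (rootStable_of_isFamily hQ h.fam).exists_perm hQ hg
  have hgO := omegaGroup_le_isometryGroup Q (rootGroup_le_omegaGroup hQ hg)
  refine ⟨σ, hσ, fun a ha => Subtype.ext ?_, fun hx => hne ?_⟩
  · obtain ⟨w', hw', hwZ', haw, hgw⟩ := hL a ha
    rw [hσg, haw]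
    exact h.map_pivot_of_smul hQ hgO hgZ hw' hwZ' hgw
  · have h1 := hσg (h.point w hw hwZ)
    rw [hx] at h1
    have h2 : g z ∈ pivot Q Z w := by
      rw [show pivot Q Z w = (pivot Q Z w).map (g : V →ₗ[F] V) from h1]
      exact ⟨z, mem_pivot_of_mem hz hwz, rfl⟩
    exact (hQ.isMaxTS_pivot h.max hw).1.polar_eq_zero self_mem_pivot h2

end OppositeFamily

open OppositeFamily in
-- In the frame a, b, c, d the dependent point x is the intersection of the lines ab and cd. With
-- more than two field elements these lines are visible in closures, so g x lies on both.
theorem not_isIBIS_family_of_two_lt_card [Finite F] (hQ : PlusSpace Q m) (hq : 2 < Nat.card F)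
    (h𝒮 : IsFamily Q m 𝒮) {G : Subgroup (Equiv.Perm 𝒮)}
    (hNG : inducedPerm (omegaGroup Q) 𝒮 ≤ G)
    (hnorm : ∀ g ∈ G, ∀ n ∈ inducedPerm (omegaGroup Q) 𝒮, g * n * g⁻¹ ∈
      inducedPerm (omegaGroup Q) 𝒮) : ¬ IsIBIS G := by
  have := hQ.finite
  have : Finite V := Module.finite_of_finite F
  obtain ⟨s, hs0, hs1⟩ := exists_ne_zero_ne_one hq
  obtain ⟨Z, h⟩ := exists_oppositeFamily hQ h𝒮
  obtain ⟨e, f, hyp, he⟩ := hQ.exists_hypPairs h.max 3 hQ.three_le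
  have hZs := h.max.1
  have hez : ∀ {z}, z ∈ Z → ∀ i, polar Q (e i) z = 0 := fun hz i => hZs.polar_eq_zero (he i) hz
  set a := h.point (f 0) (hyp.qf 0) (h.f_notMem hyp he 0) with ha
  set b := h.point (f 1) (hyp.qf 1) (h.f_notMem hyp he 1) with hb
  set c := h.point (f 2) (hyp.qf 2) (h.f_notMem hyp he 2) with hc
  set x := h.point (f 0 + (1 : F) • f 1) (apply_add hyp 1) (h.add_notMem hyp he 1) with hx
  set d := h.point (f 0 + f 1 + f 2) (apply_add_add hyp) (h.add_add_notMem hyp he) with hd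
  have hroot : ∀ {i j}, i ≠ j → ∃ g ∈ rootGroup Q, ∀ z ∈ Z, g z = z - polar Q (f j) z • e i := by
    intro i j hij
    have hs : SingularPair Q (e i) (f j) := ⟨hyp.qe i, hyp.qf j, by rw [hyp.ef, if_neg hij]⟩
    refine ⟨root _ _ hs, root_mem_rootGroup hs, fun z hz => ?_⟩
    rw [root_apply, hez hz, zero_smul, zero_sub, sub_eq_add_neg]
  have hrootZ : ∀ {g : V ≃ₗ[F] V} {i j}, (∀ z ∈ Z, g z = z - polar Q (f j) z • e i) →
      ∀ z ∈ Z, g z ∈ Z := fun hg z hz => by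
    rw [hg z hz]; exact Z.sub_mem hz (Z.smul_mem _ (he _))
  have hirr : IrredundantList (inducedPerm (omegaGroup Q) 𝒮) ([d, c] ++ x :: [b, a]) := by
    refine ⟨⟨⟨⟨⟨trivial, ?_⟩, ?_⟩, ?_⟩, ?_⟩, ?_⟩
    · obtain ⟨g, hg, hgz⟩ := hroot (i := 0) (j := 1) (by decide)
      have := h.exists_move_point hQ hg (hrootZ hgz) (L := ∅) (by simp) (w := f 0)
        (hw := hyp.qf 0) (hwZ := h.f_notMem hyp he 0) (he 1) (by simp [hyp.fe])
        (by rw [hgz _ (he 1)]; simp [polar_sub_right, hyp.fe])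
      simpa using this
    · obtain ⟨g, hg, hgz⟩ := hroot (i := 1) (j := 0) (by decide)
      have := h.exists_move_point hQ hg (hrootZ hgz) (L := {a}) (by
          rintro _ rfl
          refine ⟨f 0, hyp.qf 0, h.f_notMem hyp he 0, rfl, fun z hz hwz => ?_⟩
          rw [hgz z hz]; simp [hwz]) (w := f 1)
        (hw := hyp.qf 1) (hwZ := h.f_notMem hyp he 1) (he 0) (by simp [hyp.fe])
        (by rw [hgz _ (he 0)]; simp [polar_sub_right, hyp.fe])
      simpa using this
    · obtain ⟨g, hg, hgz'⟩ := hyp.exists_torus (i := 0) (j := 2) (by decide) hs0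
      have hgz : ∀ z ∈ Z, g z = z + ((s - 1) * polar Q (f 0) z) • e 0 +
          ((s⁻¹ - 1) * polar Q (f 2) z) • e 2 := fun z hz => by
        rw [hgz', hez hz, hez hz]; simp
      have := h.exists_move_point hQ hg (fun z hz => by
          rw [hgz z hz]
          exact Z.add_mem (Z.add_mem hz (Z.smul_mem _ (he 0))) (Z.smul_mem _ (he 2)))
        (L := {b, a}) (by
          rintro _ (rfl | rfl)
          · refine ⟨f 1, hyp.qf 1, h.f_notMem hyp he 1, rfl, fun z hz hwz => ?_⟩
            rw [hgz z hz]; simp [polar_add_right, hyp.fe, hwz]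
          · refine ⟨f 0, hyp.qf 0, h.f_notMem hyp he 0, rfl, fun z hz hwz => ?_⟩
            rw [hgz z hz]; simp [polar_add_right, hyp.fe, hwz]) (w := f 0 + (1 : F) • f 1)
        (hw := apply_add hyp 1) (hwZ := h.add_notMem hyp he 1) (z := e 0 - e 1)
        (Z.sub_mem (he 0) (he 1)) (by simp [polar_add_left, polar_sub_right, hyp.fe])
        (by
          rw [hgz _ (Z.sub_mem (he 0) (he 1))]
          simp [polar_add_left, polar_add_right, polar_sub_right, hyp.fe]
          exact sub_ne_zero.2 hs1)
      obtain ⟨σ, hσ, hf, hm⟩ := this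
      exact ⟨σ, hσ, fun y hy => hf y (by have hy' : y ∈ [b, a] := hy; simpa using hy'), hm⟩
    · obtain ⟨g, hg, hgz⟩ := hroot (i := 2) (j := 0) (by decide)
      have := h.exists_move_point hQ hg (hrootZ hgz) (L := {x, b, a}) (by
          rintro _ (rfl | rfl | rfl)
          · refine ⟨_, apply_add hyp 1, h.add_notMem hyp he 1, rfl, fun z hz hwz => ?_⟩
            rw [hgz z hz, polar_sub_right, hwz, polar_smul_right]; simp [polar_add_left, hyp.fe]
          · refine ⟨f 1, hyp.qf 1, h.f_notMem hyp he 1, rfl, fun z hz hwz => ?_⟩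
            rw [hgz z hz]; simp [polar_sub_right, hyp.fe, hwz]
          · refine ⟨f 0, hyp.qf 0, h.f_notMem hyp he 0, rfl, fun z hz hwz => ?_⟩
            rw [hgz z hz]; simp [hwz]) (w := f 2)
        (hw := hyp.qf 2) (hwZ := h.f_notMem hyp he 2) (he 0) (by simp [hyp.fe])
        (by rw [hgz _ (he 0)]; simp [polar_sub_right, hyp.fe])
      simpa using this
    -- With e 1 and f 1 exchanged, the torus element scales both e 0 and e 1 by s: it fixes a, b, c
    -- and x but moves d.
    · have hyp2 : HypPairs Q ![e 0, f 1, e 2] ![f 0, e 1, f 2] := by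
        refine ⟨fun i => ?_, fun i => ?_, fun i j => ?_, fun i j => ?_, fun i j => ?_⟩
        · fin_cases i <;> simp [hyp.qe, hyp.qf]
        · fin_cases i <;> simp [hyp.qe, hyp.qf]
        · fin_cases i <;> fin_cases j <;> simp [-polar_self, hyp.ee, hyp.ff, hyp.ef, hyp.fe]
        · fin_cases i <;> fin_cases j <;> simp [-polar_self, hyp.ee, hyp.ff, hyp.ef, hyp.fe]
        · fin_cases i <;> fin_cases j <;> simp [-polar_self, hyp.ee, hyp.ff, hyp.ef, hyp.fe]
      obtain ⟨g, hg, hgz'⟩ := hyp2.exists_torus (i := 0) (j := 1) (by decide) hs0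
      have hgz : ∀ z ∈ Z, g z = z + ((s - 1) * polar Q (f 0) z) • e 0 +
          ((s - 1) * polar Q (f 1) z) • e 1 := fun z hz => by
        have k0 := hez hz 0
        have k1 := hez hz 1
        rw [hgz']; simp [k0, k1]
      have := h.exists_move_point hQ hg (fun z hz => by
          rw [hgz z hz]
          exact Z.add_mem (Z.add_mem hz (Z.smul_mem _ (he 0))) (Z.smul_mem _ (he 1)))
        (L := {c, x, b, a}) (by
          rintro _ (rfl | rfl | rfl | rfl)
          · refine ⟨f 2, hyp.qf 2, h.f_notMem hyp he 2, rfl, fun z hz hwz => ?_⟩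
            rw [hgz z hz]; simp [polar_add_right, hyp.fe, hwz]
          · refine ⟨_, apply_add hyp 1, h.add_notMem hyp he 1, rfl, fun z hz hwz => ?_⟩
            rw [hgz z hz, polar_add_right, polar_add_right, hwz]
            simp only [polar_add_left, polar_smul_left, polar_smul_right, hyp.fe] at hwz ⊢
            simp at hwz ⊢
            linear_combination (s - 1) * hwz
          · refine ⟨f 1, hyp.qf 1, h.f_notMem hyp he 1, rfl, fun z hz hwz => ?_⟩
            rw [hgz z hz]; simp [polar_add_right, hyp.fe, hwz]
          · refine ⟨f 0, hyp.qf 0, h.f_notMem hyp he 0, rfl, fun z hz hwz => ?_⟩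
            rw [hgz z hz]; simp [polar_add_right, hyp.fe, hwz]) (w := f 0 + f 1 + f 2)
        (hw := apply_add_add hyp) (hwZ := h.add_add_notMem hyp he) (z := e 0 - e 2)
        (Z.sub_mem (he 0) (he 2)) (by simp [polar_add_left, polar_sub_right, hyp.fe])
        (by
          rw [hgz _ (Z.sub_mem (he 0) (he 2))]
          simp [polar_add_left, polar_add_right, polar_sub_right, hyp.fe]
          exact sub_ne_zero.2 hs1)
      simpa using this
  refine not_isIBIS_of_dependent (hirr.mono hNG) fun g hg hfix => ?_
  have ga : g a = a := hfix _ (by simp)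
  have gb : g b = b := hfix _ (by simp)
  have gc : g c = c := hfix _ (by simp)
  have gd : g d = d := hfix _ (by simp)
  have hmemf : ∀ i, f i ∈ Submodule.span F (Set.range f) := fun i => Submodule.subset_span ⟨i, rfl⟩
  have hgx := (apply_mem_fixedClosure_iff hnorm hg).2 (h.frame_mem_closure hQ hyp he)
  rw [Set.image_insert_eq, Set.image_insert_eq, Set.image_pair, ← ha, ← hb, ← hc, ← hd, ga, gb, gc,
    gd] at hgx
  obtain ⟨φ, hφ, hφZ, hφf, hgφ⟩ := h.exists_eq_point hQ hyp he (by
    rintro _ (rfl | rfl | rfl | rfl)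
    exacts [⟨_, hmemf 0, rfl⟩, ⟨_, hmemf 1, rfl⟩, ⟨_, hmemf 2, rfl⟩,
      ⟨_, Submodule.add_mem _ (Submodule.add_mem _ (hmemf 0) (hmemf 1)) (hmemf 2), rfl⟩]) hgx
  have hsum := eq_sum_right hyp hφf
  have h2 := h.polar_eq_zero_of_apply_line hQ hyp he hs0 hs1 hnorm hg ga gb hφf hgφ
  -- The same argument for the line cd; the sign of f 2 makes the sum of the first two vectors equal
  -- to f 0 + f 1, which represents x.
  set e' : Fin 3 → V := ![e 1 - e 2, e 1, e 0 - e 1] with he'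
  set f' : Fin 3 → V := ![(-1 : F) • f 2, f 0 + f 1 + f 2, f 0] with hf'
  have heZ : ∀ i, e' i ∈ Z := by
    intro i
    fin_cases i
    exacts [Z.sub_mem (he 1) (he 2), he 1, Z.sub_mem (he 0) (he 1)]
  have hyp' : HypPairs Q e' f' := by
    refine ⟨fun i => hZs _ (heZ i), fun i => ?_,
      fun i j => hZs.polar_eq_zero (heZ i) (heZ j), fun i j => ?_, fun i j => ?_⟩
    · fin_cases i
      · change Q ((-1 : F) • f 2) = 0
        rw [QuadraticMap.map_smul, hyp.qf, smul_zero]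
      · exact apply_add_add hyp
      · exact hyp.qf 0
    · fin_cases i <;> fin_cases j <;>
        simp [-polar_self, f', polar_add_left, polar_add_right, hyp.ff]
    · fin_cases i <;> fin_cases j <;>
        simp [e', f', polar_sub_left, polar_add_right, hyp.ef]
  have hnf2 : h.point (f' 0) (hyp'.qf 0) (h.f_notMem hyp' heZ 0) = c :=
    (h.point_eq_point (c := (-1 : F)) rfl).symm
  have hx' : h.point (f' 0 + (1 : F) • f' 1) (apply_add hyp' 1) (h.add_notMem hyp' heZ 1) = x := by
    refine h.point_eq_point (c := (1 : F)) ?_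
    change f 0 + (1 : F) • f 1 = (1 : F) • ((-1 : F) • f 2 + (1 : F) • (f 0 + f 1 + f 2))
    module
  have hφf' : φ ∈ Submodule.span F (Set.range f') := by
    have k : ∀ i, f' i ∈ Submodule.span F (Set.range f') := fun i => Submodule.subset_span ⟨i, rfl⟩
    have k1 : f 1 = f' 0 + f' 1 - f' 2 := by
      change f 1 = (-1 : F) • f 2 + (f 0 + f 1 + f 2) - f 0
      module
    rw [hsum, h2, zero_smul, add_zero]
    refine Submodule.add_mem _ (Submodule.smul_mem _ _ (k 2)) (Submodule.smul_mem _ _ ?_)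
    rw [k1]
    exact Submodule.sub_mem _ (Submodule.add_mem _ (k 0) (k 1)) (k 2)
  have h3 := h.polar_eq_zero_of_apply_line hQ hyp' heZ hs0 hs1 hnorm hg (by rw [hnf2, gc]) gd
    hφf' (by rw [hx']; exact hgφ)
  replace h3 : polar Q (e 0 - e 1) φ = 0 := h3
  rw [polar_sub_left, sub_eq_zero] at h3
  rw [h2, h3, zero_smul, add_zero] at hsum
  rw [hgφ]
  exact (h.point_eq_point (c := polar Q (e 1) φ) (by rw [hsum]; simp [polar_add_right, polar_smul_right, hyp.ef])).symm

end HalfSpinLarge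
end IbisOrth

namespace IbisOrth
section Collinear

open QuadraticMap Module

variable {F V : Type*} [Field F] [AddCommGroup V] [Module F V] {Q : QuadraticForm F V} {m : ℕ}
  {𝒮 : Set (Submodule F V)}

/-! ### Members of a family that meet in codimension two -/

theorem PlusSpace.perp_inf_eq_sup (hQ : PlusSpace Q m) {A B : Submodule F V} (hA : IsMaxTS Q m A)
    (hB : IsMaxTS Q m B) : perp Q (A ⊓ B) = A ⊔ B := by
  rw [← hQ.perp_perp (A ⊔ B), ← hQ.perp_inf, hQ.perp_eq hA, hQ.perp_eq hB]

theorem finrank_inf_lt (hQ : PlusSpace Q m) (h𝒮 : IsFamily Q m 𝒮) {A B : Submodule F V}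
    (hA : A ∈ 𝒮) (hB : B ∈ 𝒮) (hne : A ≠ B) : finrank F (A ⊓ B : Submodule F V) + 2 ≤ m := by
  have := hQ.finite
  have hAm := isMaxTS_of_isFamily h𝒮 hA
  have h1 := Submodule.finrank_mono (inf_le_left : A ⊓ B ≤ A)
  have h2 := hAm.2
  have h3 : finrank F (A ⊓ B : Submodule F V) ≠ m := fun h => hne
    (hQ.eq_of_le hAm (isMaxTS_of_isFamily h𝒮 hB)
      (inf_eq_left.1 (Submodule.eq_of_le_of_finrank_eq inf_le_left (h.trans h2.symm))))
  have h4 := even_of_isFamily hQ h𝒮 hA hB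
  rw [Nat.even_iff] at h4
  omega

theorem sub_mem_of_notMem [FiniteDimensional F V] (hq : Nat.card F = 2) {H K : Submodule F V}
    (hHK : H ≤ K) (hK : finrank F K = finrank F H + 1) {x y : V} (hx : x ∈ K) (hxH : x ∉ H)
    (hy : y ∈ K) (hyH : y ∉ H) : x - y ∈ H := by
  have h1 : H ⊔ Submodule.span F {x} = K := by
    refine Submodule.eq_of_le_of_finrank_eq
      (sup_le hHK ((Submodule.span_singleton_le_iff_mem _ _).2 hx)) ?_
    rw [finrank_sup_span_singleton hxH, hK]
  rw [← h1] at hy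
  obtain ⟨a, ha, b, hb, rfl⟩ := Submodule.mem_sup.1 hy
  obtain ⟨c, rfl⟩ := Submodule.mem_span_singleton.1 hb
  rcases eq_zero_or_eq_one hq c with rfl | rfl
  · exact absurd (by simpa using ha) hyH
  · rw [one_smul, sub_add_cancel_right]
    exact H.neg_mem ha

/-- Over the field with two elements, there is at most one third member through the intersection
of two members that meet in codimension two. -/
theorem le_of_inf_le (hQ : PlusSpace Q m) (hq : Nat.card F = 2) (h𝒮 : IsFamily Q m 𝒮)
    {A B C C' : Submodule F V} (hA : A ∈ 𝒮) (hB : B ∈ 𝒮)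
    (hAB : finrank F (A ⊓ B : Submodule F V) + 2 = m) (hC : C ∈ 𝒮) (hC' : C' ∈ 𝒮)
    (hCA : C ≠ A) (hCB : C ≠ B) (hCA' : C' ≠ A) (hCB' : C' ≠ B) (hD : A ⊓ B ≤ C)
    (hD' : A ⊓ B ≤ C') : C ≤ C' := by
  have := hQ.finite
  have hAm := isMaxTS_of_isFamily h𝒮 hA
  have hBm := isMaxTS_of_isFamily h𝒮 hB
  have hCm := isMaxTS_of_isFamily h𝒮 hC
  have hCm' := isMaxTS_of_isFamily h𝒮 hC'
  have inter : ∀ {E G : Submodule F V}, E ∈ 𝒮 → G ∈ 𝒮 → E ≠ G → A ⊓ B ≤ E ⊓ G →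
      E ⊓ G = A ⊓ B := fun hE hG hne hle => by
    have h1 := finrank_inf_lt hQ h𝒮 hE hG hne
    exact (Submodule.eq_of_le_of_finrank_le hle (by omega)).symm
  have hCBi := inter hC hB hCB (le_inf hD inf_le_right)
  have hCAi' := inter hC' hA hCA' (le_inf hD' inf_le_left)
  have hCBi' := inter hC' hB hCB' (le_inf hD' inf_le_right)
  intro c hc
  have hcs : c ∈ A ⊔ B := by
    rw [← hQ.perp_inf_eq_sup hAm hBm]
    exact perp_anti hD (hCm.1.le_perp hc)
  obtain ⟨α, hα, β, hβ, rfl⟩ := Submodule.mem_sup.1 hcs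
  by_cases hαD : α ∈ A ⊓ B
  · have h1 : β ∈ A ⊓ B := by
      rw [← hCBi]
      exact ⟨(C.add_mem_iff_right (hD hαD)).1 hc, hβ⟩
    exact hD' ((A ⊓ B).add_mem hαD h1)
  · have hαB : α ∉ B := fun h => hαD ⟨hα, h⟩
    have hα0 : α ≠ 0 := fun h => hαB (h ▸ B.zero_mem)
    obtain ⟨c', hc', β', hβ', hα'⟩ : ∃ c' ∈ C', ∃ β' ∈ B, α = c' + β' := by
      have h1 : α ∈ C' ⊔ B := by
        rw [← hQ.perp_inf_eq_sup hCm' hBm, hCBi', hQ.perp_inf_eq_sup hAm hBm]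
        exact Submodule.mem_sup_left hα
      obtain ⟨c', hc', β', hβ', h2⟩ := Submodule.mem_sup.1 h1
      exact ⟨c', hc', β', hβ', h2.symm⟩
    -- D = A ∩ B is a hyperplane of K. Both β and -β' lie in K outside D, so they agree modulo D
    -- over two elements, and α + β differs from c' by a vector of D.
    set K := B ⊓ perp Q (Submodule.span F {α}) with hK
    have hmemK : ∀ {b}, b ∈ B → polar Q α b = 0 → b ∈ K := fun hb h =>
      ⟨hb, mem_perp_span.2 (by rintro _ rfl; exact h)⟩
    have hKd : finrank F K = finrank F (A ⊓ B : Submodule F V) + 1 := by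
      have h1 := hQ.finrank_inf_perp hBm (Submodule.span F {α})
      rw [inf_span_singleton_eq_bot hαB, finrank_bot,
        finrank_span_singleton hα0, ← hK] at h1
      omega
    have hβK : β ∈ K := hmemK hβ (by
      have h1 := hCm.1 _ hc
      rw [QuadraticMap.map_add (f := Q), hAm.1 α hα, hBm.1 β hβ] at h1
      simpa using h1)
    have hβK' : β' ∈ K := hmemK hβ' (by
      have h1 := hCm'.1 _ hc'
      rw [eq_sub_of_add_eq hα'.symm, sub_eq_add_neg, QuadraticMap.map_add (f := Q), hAm.1 α hα,
        QuadraticMap.map_neg, hBm.1 β' hβ', polar_neg_right] at h1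
      simpa using h1)
    have hCAi := inter hC hA hCA (le_inf hD inf_le_left)
    have hβD : β ∉ A ⊓ B := fun h => hαD (by
      rw [← hCAi]
      exact ⟨(C.add_mem_iff_left (hD h)).1 hc, hα⟩)
    have hβD' : -β' ∉ A ⊓ B := fun h => hαD (by
      rw [← hCAi']
      refine ⟨?_, hα⟩
      rw [hα']
      exact C'.add_mem hc' (C'.neg_mem_iff.1 (hD' h)))
    have h1 := sub_mem_of_notMem hq (le_inf inf_le_right fun d hd => mem_perp_span.2 (by
      rintro _ rfl; exact hAm.1.polar_eq_zero hα hd.1)) hKd hβK hβD (K.neg_mem hβK') hβD'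
    have h2 : α + β = c' + (β - -β') := by rw [hα']; abel
    rw [h2]
    exact C'.add_mem hc' (hD' h1)

theorem eq_of_inf_le (hQ : PlusSpace Q m) (hq : Nat.card F = 2) (h𝒮 : IsFamily Q m 𝒮)
    {A B C C' : Submodule F V} (hA : A ∈ 𝒮) (hB : B ∈ 𝒮)
    (hAB : finrank F (A ⊓ B : Submodule F V) + 2 = m) (hC : C ∈ 𝒮) (hC' : C' ∈ 𝒮)
    (hCA : C ≠ A) (hCB : C ≠ B) (hCA' : C' ≠ A) (hCB' : C' ≠ B) (hD : A ⊓ B ≤ C)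
    (hD' : A ⊓ B ≤ C') : C = C' :=
  le_antisymm (le_of_inf_le hQ hq h𝒮 hA hB hAB hC hC' hCA hCB hCA' hCB' hD hD')
    (le_of_inf_le hQ hq h𝒮 hA hB hAB hC' hC hCA' hCB' hCA hCB hD' hD)

/-- For orthogonal a in A and b in B, both outside A ∩ B, the vector a + b is singular and in
neither of A, B. Two hyperplane steps from A, both keeping (A ∩ B) + ⟨a + b⟩, lead back to the
family of A. -/
theorem exists_third (hQ : PlusSpace Q m) (h𝒮 : IsFamily Q m 𝒮) {A B : Submodule F V}
    (hA : A ∈ 𝒮) (hB : B ∈ 𝒮) (hAB : finrank F (A ⊓ B : Submodule F V) + 2 = m) :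
    ∃ C ∈ 𝒮, C ≠ A ∧ C ≠ B ∧ A ⊓ B ≤ C := by
  have := hQ.finite
  have hAm := isMaxTS_of_isFamily h𝒮 hA
  have hBm := isMaxTS_of_isFamily h𝒮 hB
  obtain ⟨a, ha, haD⟩ : ∃ a ∈ A, a ∉ A ⊓ B := by
    by_contra! hcon
    have h1 := Submodule.finrank_mono (show A ≤ A ⊓ B from hcon)
    have h2 := hAm.2
    omega
  have haB : a ∉ B := fun h => haD ⟨ha, h⟩
  have ha0 : a ≠ 0 := fun h => haB (h ▸ B.zero_mem)
  obtain ⟨b, hb, hbD⟩ : ∃ b ∈ B ⊓ perp Q (Submodule.span F {a}), b ∉ A ⊓ B := by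
    by_contra! hcon
    have h0 := Submodule.finrank_mono (show _ ≤ A ⊓ B from hcon)
    have h1 := hQ.finrank_inf_perp hBm (Submodule.span F {a})
    rw [inf_span_singleton_eq_bot haB, finrank_bot, finrank_span_singleton ha0] at h1
    omega
  have hab : polar Q a b = 0 := mem_perp_span.1 hb.2 a rfl
  have hbA : b ∉ A := fun h => hbD ⟨h, hb.1⟩
  have hs : Q (a + b) = 0 := by
    rw [QuadraticMap.map_add (f := Q), hAm.1 a ha, hBm.1 b hb.1, hab]; simp
  have habA : a + b ∉ A := fun h => hbA ((A.add_mem_iff_right ha).1 h)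
  have habB : a + b ∉ B := fun h => haB ((B.add_mem_iff_left hb.1).1 h)
  set P := pivot Q A (a + b) with hP
  have hPm := hQ.isMaxTS_pivot hAm hs
  have hDp : ∀ d ∈ A ⊓ B, polar Q (a + b) d = 0 := fun d hd => by
    rw [polar_add_left, hAm.1.polar_eq_zero ha hd.1, hBm.1.polar_eq_zero hb.1 hd.2, add_zero]
  set W := A ⊓ B ⊔ Submodule.span F {a + b} with hW
  have hWP : W ≤ P := sup_le (fun d hd => mem_pivot_of_mem hd.1 (hDp d hd))
    ((Submodule.span_singleton_le_iff_mem _ _).2 self_mem_pivot)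
  have haP : a ∈ P := mem_pivot_of_mem ha (by
    rw [polar_add_left, polar_self, hAm.1 a ha, polar_comm Q b a, hab]; simp)
  have haW : a ∉ W := by
    intro h
    obtain ⟨d, hd, y, hy, hdy⟩ := Submodule.mem_sup.1 h
    obtain ⟨c, rfl⟩ := Submodule.mem_span_singleton.1 hy
    by_cases hc : c = 0
    · subst hc
      rw [zero_smul, add_zero] at hdy
      exact haD (hdy ▸ hd)
    · exact habA ((A.smul_mem_iff hc).1 ((A.add_mem_iff_right hd.1).1 (by rw [hdy]; exact ha)))
  obtain ⟨v, hv, hv0, hav⟩ := hQ.exists_singular_dual haW (hAm.1 a ha)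
    (fun w hw => hPm.1.polar_eq_zero (hWP hw) haP)
  have hvP : v ∉ P := fun h => by
    have h1 := hPm.1.polar_eq_zero haP h
    rw [hav] at h1
    exact one_ne_zero h1
  have hCm := hQ.isMaxTS_pivot hPm hv0
  have hWC : W ≤ pivot Q P v := fun w hw =>
    mem_pivot_of_mem (hWP hw) (by rw [polar_comm]; exact hv w hw)
  have habC : a + b ∈ pivot Q P v :=
    hWC (Submodule.mem_sup_right (Submodule.mem_span_singleton_self _))
  refine ⟨pivot Q P v, (mem_of_isFamily hQ h𝒮 hA _).2 ⟨hCm, ?_⟩, fun h => habA (h ▸ habC),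
    fun h => habB (h ▸ habC), fun d hd => hWC (Submodule.mem_sup_left hd)⟩
  have h1 := hQ.finrank_inf_pivot hAm habA
  have h2 := hQ.finrank_inf_pivot hPm hvP
  have h3 := hQ.even_finrank hAm hPm hCm
  rw [← hP] at h1 h2 h3
  rw [Nat.even_iff] at h3 ⊢
  omega

theorem map_mem_of_isometry (hQ : PlusSpace Q m) (h𝒮 : IsFamily Q m 𝒮) {g : V ≃ₗ[F] V}
    (hg : g ∈ isometryGroup Q) {A : Submodule F V} (hA : A ∈ 𝒮)
    (hgA : A.map (g : V →ₗ[F] V) = A) {C : Submodule F V} (hC : C ∈ 𝒮) :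
    C.map (g : V →ₗ[F] V) ∈ 𝒮 := by
  have hCm := isMaxTS_of_isFamily h𝒮 hC
  refine (mem_of_isFamily hQ h𝒮 hA _).2
    ⟨⟨isTotallySingular_map hg hCm.1, (LinearEquiv.finrank_map_eq g C).trans hCm.2⟩, ?_⟩
  have h1 : A ⊓ C.map (g : V →ₗ[F] V) = (A ⊓ C).map (g : V →ₗ[F] V) := by
    rw [Submodule.map_inf _ g.injective, hgA]
  rw [h1, LinearEquiv.finrank_map_eq]
  exact even_of_isFamily hQ h𝒮 hA hC

theorem third_mem_closure (hQ : PlusSpace Q m) (hq : Nat.card F = 2) (h𝒮 : IsFamily Q m 𝒮)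
    {A B C : 𝒮} (hAB : finrank F (A.1 ⊓ B.1 : Submodule F V) + 2 = m)
    (hCA : C ≠ A) (hCB : C ≠ B) (hD : A.1 ⊓ B.1 ≤ C.1) : C ∈ omegaClosure Q 𝒮 {A, B} := by
  refine mem_omegaClosure fun g hg hfix => ?_
  have hgA : A.1.map (g : V →ₗ[F] V) = A.1 := hfix A (Or.inl rfl)
  have hgB : B.1.map (g : V →ₗ[F] V) = B.1 := hfix B (Or.inr rfl)
  have hinj := Submodule.map_injective_of_injective (f := (g : V →ₗ[F] V)) g.injective
  refine eq_of_inf_le hQ hq h𝒮 A.2 B.2 hAB (map_mem_of_isometry hQ h𝒮 hg A.2 hgA C.2) C.2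
    (fun h => ?_) (fun h => ?_) (fun h => hCA (Subtype.ext h)) (fun h => hCB (Subtype.ext h)) ?_ hD
  · exact hCA (Subtype.ext (hinj (h.trans hgA.symm)))
  · exact hCB (Subtype.ext (hinj (h.trans hgB.symm)))
  · calc A.1 ⊓ B.1 = (A.1 ⊓ B.1).map (g : V →ₗ[F] V) := by
          rw [Submodule.map_inf _ g.injective, hgA, hgB]
      _ ≤ C.1.map (g : V →ₗ[F] V) := Submodule.map_mono hD

/-- For orthogonal u in A and v in B the root element of (u, v) fixes A and B, so S contains a
nontrivial combination of u and v. Taking u outside S gives B ∩ u^⊥ ≤ S + ⟨u⟩, so S meets B, and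
likewise A, in codimension at most two; this is incompatible with A and B being far apart. -/
theorem closure_pair_subset (hQ : PlusSpace Q m) (h𝒮 : IsFamily Q m 𝒮)
    {A B S : 𝒮} (hAB : finrank F (A.1 ⊓ B.1 : Submodule F V) + 4 ≤ m)
    (hS : S ∈ omegaClosure Q 𝒮 {A, B}) : S = A ∨ S = B := by
  have := hQ.finite
  by_contra! hne
  have hst := rootStable_of_isFamily hQ h𝒮
  have hm := hQ.three_le
  have hAm := isMaxTS_of_isFamily h𝒮 A.2
  have hBm := isMaxTS_of_isFamily h𝒮 B.2
  have hSm := isMaxTS_of_isFamily h𝒮 S.2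
  have key : ∀ u ∈ A.1, ∀ v ∈ B.1, polar Q u v = 0 →
      ∃ a b : F, (a ≠ 0 ∨ b ≠ 0) ∧ a • u + b • v ∈ S.1 := by
    intro u hu v hv huv
    have hs : SingularPair Q u v := ⟨hAm.1 u hu, hBm.1 v hv, huv⟩
    refine hQ.exists_mem_of_map_root_eq hSm hs
      (hst.map_eq_of_mem_omegaClosure hQ hS (root_mem_rootGroup hs) ?_)
    rintro _ (rfl | rfl)
    · exact map_root_eq_of_mem hAm.1 hs (a := 1) (b := 0) (Or.inl one_ne_zero) (by simpa using hu)
    · exact map_root_eq_of_mem hBm.1 hs (a := 0) (b := 1) (Or.inr one_ne_zero) (by simpa using hv)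
  have bound : ∀ {A B : 𝒮}, S ≠ A → (∀ u ∈ A.1, ∀ v ∈ B.1, polar Q u v = 0 →
      ∃ a b : F, (a ≠ 0 ∨ b ≠ 0) ∧ a • u + b • v ∈ S.1) →
      m ≤ finrank F (S.1 ⊓ B.1 : Submodule F V) + 2 ∧ ∃ u ∈ A.1, u ∉ S.1 := by
    intro A B hSA hkey
    have hAm := isMaxTS_of_isFamily h𝒮 A.2
    have hBm := isMaxTS_of_isFamily h𝒮 B.2
    obtain ⟨u, hu, huS⟩ : ∃ u ∈ A.1, u ∉ S.1 := by
      by_contra! hcon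
      exact hSA (Subtype.ext (hQ.eq_of_le hAm hSm hcon).symm)
    have h1 : S.1 ⊔ B.1 ⊓ perp Q (Submodule.span F {u}) ≤ S.1 ⊔ Submodule.span F {u} := by
      refine sup_le le_sup_left fun v hv => ?_
      obtain ⟨a, b, hab, hmem⟩ := hkey u hu v hv.1 (mem_perp_span.1 hv.2 u rfl)
      have hb : b ≠ 0 := by
        rintro rfl
        rw [zero_smul, add_zero, S.1.smul_mem_iff (by simpa using hab)] at hmem
        exact huS hmem
      have h2 : v = b⁻¹ • (a • u + b • v) + (-(b⁻¹ * a)) • u := by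
        rw [smul_add, smul_smul, smul_smul, inv_mul_cancel₀ hb]; module
      rw [h2]
      exact Submodule.add_mem_sup (S.1.smul_mem _ hmem)
        (Submodule.smul_mem _ _ (Submodule.mem_span_singleton_self u))
    have h2 := Submodule.finrank_mono h1
    rw [finrank_sup_span_singleton huS] at h2
    have h3 := Submodule.finrank_sup_add_finrank_inf_eq S.1 (B.1 ⊓ perp Q (Submodule.span F {u}))
    have h4 := hQ.finrank_inf_perp hBm (Submodule.span F {u})
    have h5 := finrank_span_singleton_le_one (F := F) u
    have h6 := Submodule.finrank_mono (show S.1 ⊓ (B.1 ⊓ perp Q (Submodule.span F {u})) ≤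
      S.1 ⊓ B.1 from inf_le_inf_left _ inf_le_left)
    have h8 := hSm.2
    exact ⟨by omega, u, hu, huS⟩
  obtain ⟨hB2, u, hu, huS⟩ := bound hne.1 key
  obtain ⟨hA2, -⟩ := bound hne.2 fun v hv u hu hvu => by
    obtain ⟨a, b, hab, hmem⟩ := key u hu v hv (by rw [polar_comm]; exact hvu)
    exact ⟨b, a, hab.symm, by rwa [add_comm]⟩
  have hD : A.1 ⊓ B.1 ≤ S.1 := fun w hw => hst.mem_of_mem_omegaClosure hQ hS hSm.1
    (by rw [hSm.2]; omega) (by rintro _ (rfl | rfl); exacts [hAm.1, hBm.1])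
    (by rintro _ (rfl | rfl); exacts [hw.1, hw.2]) (hAm.1 w hw.1)
  -- The dimension is at least (m - 2) + (m - 2) - (m - 4) = m.
  have hsup : S.1 ⊓ A.1 ⊔ S.1 ⊓ B.1 = S.1 := by
    refine Submodule.eq_of_le_of_finrank_le (sup_le inf_le_left inf_le_left) ?_
    have h1 := Submodule.finrank_sup_add_finrank_inf_eq (S.1 ⊓ A.1) (S.1 ⊓ B.1)
    have h2 := Submodule.finrank_mono (show S.1 ⊓ A.1 ⊓ (S.1 ⊓ B.1) ≤ A.1 ⊓ B.1 from
      inf_le_inf inf_le_right inf_le_right)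
    rw [hSm.2]
    omega
  obtain ⟨v, hv, hvS⟩ : ∃ v ∈ B.1 ⊓ perp Q (Submodule.span F {u}), v ∉ S.1 := by
    by_contra! hcon
    have h1 := Submodule.finrank_mono (show B.1 ⊓ perp Q (Submodule.span F {u}) ≤ S.1 ⊓ B.1 from
      fun v hv => ⟨hcon v hv, hv.1⟩)
    have h2 := finrank_inf_lt hQ h𝒮 S.2 B.2 fun h => hne.2 (Subtype.ext h)
    have h4 := hQ.finrank_inf_perp hBm (Submodule.span F {u})
    have h5 := finrank_span_singleton_le_one (F := F) u
    omega
  obtain ⟨a, b, hab, hmem⟩ := key u hu v hv.1 (mem_perp_span.1 hv.2 u rfl)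
  have ha : a ≠ 0 := by
    rintro rfl
    rw [zero_smul, zero_add, S.1.smul_mem_iff (by simpa using hab)] at hmem
    exact hvS hmem
  have hmem' := hmem
  rw [← hsup] at hmem'
  obtain ⟨α, hα, β, hβ, hαβ⟩ := Submodule.mem_sup.1 hmem'
  have h1 : a • u - α = β - b • v := by
    rw [sub_eq_sub_iff_add_eq_add, ← hαβ, add_comm]
  have h2 : a • u - α ∈ A.1 ⊓ B.1 := ⟨A.1.sub_mem (A.1.smul_mem _ hu) hα.2, by
    rw [h1]; exact B.1.sub_mem hβ.2 (B.1.smul_mem _ hv.1)⟩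
  have h3 := S.1.add_mem (hD h2) hα.1
  rw [sub_add_cancel, S.1.smul_mem_iff ha] at h3
  exact huS h3

end Collinear
end IbisOrth

namespace IbisOrth
section HalfSpinTwo

open QuadraticMap Module

variable {F V : Type*} [Field F] [AddCommGroup V] [Module F V] {Q : QuadraticForm F V} {m : ℕ}
  {𝒮 : Set (Submodule F V)}

/-! ### A family of maximal totally singular subspaces over the field with two elements -/

theorem HypPairs.comp {r n : ℕ} {e f : Fin n → V} (h : HypPairs Q e f) {σ : Fin r → Fin n}
    (hσ : Function.Injective σ) : HypPairs Q (e ∘ σ) (f ∘ σ) :=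
  ⟨fun i => h.qe _, fun i => h.qf _, fun i j => h.ee _ _, fun i j => h.ff _ _, fun i j => by
    change polar Q (e (σ i)) (f (σ j)) = _
    rw [h.ef]; exact if_congr hσ.eq_iff rfl rfl⟩

/-- Exchange the two members of the hyperbolic pairs with index in `s`. -/
theorem HypPairs.exchange {n : ℕ} {e f : Fin n → V} (h : HypPairs Q e f) (s : Finset (Fin n)) :
    HypPairs Q (fun i => if i ∈ s then f i else e i) (fun i => if i ∈ s then e i else f i) := by
  refine ⟨fun i => ?_, fun i => ?_, fun i j => ?_, fun i j => ?_, fun i j => ?_⟩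
  · split_ifs; exacts [h.qf i, h.qe i]
  · split_ifs; exacts [h.qe i, h.qf i]
  · split_ifs with h1 h2 h2
    · exact h.ff i j
    · rw [h.fe, if_neg (ne_of_mem_of_not_mem h1 h2)]
    · rw [h.ef, if_neg (ne_of_mem_of_not_mem h2 h1).symm]
    · exact h.ee i j
  · split_ifs with h1 h2 h2
    · exact h.ee i j
    · rw [h.ef, if_neg (ne_of_mem_of_not_mem h1 h2)]
    · rw [h.fe, if_neg (ne_of_mem_of_not_mem h2 h1).symm]
    · exact h.ff i j
  · by_cases h1 : i ∈ s <;> by_cases h2 : j ∈ s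
    · rw [if_pos h1, if_pos h2]; exact h.fe i j
    · rw [if_pos h1, if_neg h2, h.ff, if_neg (ne_of_mem_of_not_mem h1 h2)]
    · rw [if_neg h1, if_pos h2, h.ee, if_neg (ne_of_mem_of_not_mem h2 h1).symm]
    · rw [if_neg h1, if_neg h2]; exact h.ef i j

/-- The intersection of two maximal totally singular subspaces that contain dual systems. -/
theorem HypPairs.finrank_inf {r : ℕ} {b c : Fin r → V} (h : HypPairs Q b c) (hQ : PlusSpace Q m)
    {A B : Submodule F V} (hA : IsMaxTS Q m A) (hB : IsMaxTS Q m B) (hb : ∀ i, b i ∈ A)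
    (hc : ∀ i, c i ∈ B) (hle : ∀ v ∈ A, (∀ i, polar Q (c i) v = 0) → v ∈ B) :
    finrank F (A ⊓ B : Submodule F V) + r = m := by
  have h1 : A ⊓ B = A ⊓ perp Q (Submodule.span F (Set.range c)) := by
    refine le_antisymm (fun v hv => ⟨hv.1, mem_perp_span.2 ?_⟩)
      fun v hv => ⟨hv.1, hle v hv.1 fun i => mem_perp_span.1 hv.2 _ ⟨i, rfl⟩⟩
    rintro _ ⟨i, rfl⟩
    exact hB.1.polar_eq_zero (hc i) hv.2
  rw [h1]
  exact h.finrank_inf_perp hQ hA hb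

section Frame

variable {e f : Fin 4 → V} {U : Submodule F V}

/-- A subspace `U` together with four hyperbolic pairs spans the orthogonal space of `U`. -/
structure Frame (Q : QuadraticForm F V) (m : ℕ) (U : Submodule F V) (e f : Fin 4 → V) : Prop where
  ts : IsTotallySingular Q U
  dim : finrank F U + 4 = m
  hyp : HypPairs Q e f
  ue : ∀ u ∈ U, ∀ i, polar Q u (e i) = 0
  uf : ∀ u ∈ U, ∀ i, polar Q u (f i) = 0

/-- The subspace spanned by `U` and a system of vectors. -/
def extend (U : Submodule F V) (b : Fin 4 → V) : Submodule F V :=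
  U ⊔ Submodule.span F (Set.range b)

theorem Frame.isMaxTS (h : Frame Q m U e f) (hQ : PlusSpace Q m) : IsMaxTS Q m (extend U e) := by
  have := hQ.finite
  have hspan : IsTotallySingular Q (Submodule.span F (Set.range e)) :=
    isTotallySingular_span (by rintro _ ⟨i, rfl⟩; exact h.hyp.qe i)
      (by rintro _ ⟨i, rfl⟩ _ ⟨j, rfl⟩; exact h.hyp.ee i j)
  refine ⟨h.ts.sup hspan ?_, ?_⟩
  · rw [Submodule.span_le]
    rintro _ ⟨i, rfl⟩ u hu
    exact h.ue u hu i
  · have h1 := Submodule.finrank_sup_add_finrank_inf_eq U (Submodule.span F (Set.range e))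
    have h2 : U ⊓ Submodule.span F (Set.range e) = ⊥ := by
      rw [eq_bot_iff]
      rintro v ⟨hv, hve⟩
      have h3 := h.hyp.symm.eq_sum (Submodule.span_mono Set.subset_union_right hve)
      simp only [polar_comm Q _ v, h.ue v hv, h.uf v hv, zero_smul, Finset.sum_const_zero,
        add_zero] at h3
      exact h3
    rw [h2, finrank_bot, h.hyp.symm.finrank_span_right] at h1
    have h3 := h.dim
    change finrank F (U ⊔ Submodule.span F (Set.range e) : Submodule F V) = m
    omega

theorem le_extend {b : Fin 4 → V} : U ≤ extend U b := le_sup_left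

theorem mem_extend {b : Fin 4 → V} (i : Fin 4) : b i ∈ extend U b :=
  Submodule.mem_sup_right (Submodule.subset_span ⟨i, rfl⟩)

theorem extend_le {b : Fin 4 → V} {Y : Submodule F V} (hU : U ≤ Y) (hb : ∀ i, b i ∈ Y) :
    extend U b ≤ Y := sup_le hU (Submodule.span_le.2 (by rintro _ ⟨i, rfl⟩; exact hb i))

theorem Frame.mem_iff (h : Frame Q m U e f) (hQ : PlusSpace Q m) {v : V} :
    v ∈ extend U e ↔ (∀ u ∈ U, polar Q u v = 0) ∧ ∀ i, polar Q (e i) v = 0 := by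
  have hm := h.isMaxTS hQ
  refine ⟨fun hv => ⟨fun u hu => hm.1.polar_eq_zero (le_extend hu) hv,
    fun i => hm.1.polar_eq_zero (mem_extend i) hv⟩, fun hv => hQ.mem_of_perp hm fun s hs => ?_⟩
  have h1 : extend U e ≤ perp Q (Submodule.span F {v}) := extend_le
    (fun u hu => mem_perp_span.2 (by rintro _ rfl; rw [polar_comm]; exact hv.1 u hu))
    (fun i => mem_perp_span.2 (by rintro _ rfl; rw [polar_comm]; exact hv.2 i))
  rw [polar_comm]
  exact mem_perp_span.1 (h1 hs) v rfl

theorem Frame.exchange (h : Frame Q m U e f) (s : Finset (Fin 4)) :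
    Frame Q m U (fun i => if i ∈ s then f i else e i) (fun i => if i ∈ s then e i else f i) := by
  refine ⟨h.ts, h.dim, h.hyp.exchange s, fun u hu i => ?_, fun u hu i => ?_⟩ <;> split_ifs
  exacts [h.uf u hu i, h.ue u hu i, h.ue u hu i, h.uf u hu i]

theorem Frame.mem_base (h : Frame Q m U e f) (hQ : PlusSpace Q m) {v : V}
    (hv : ∀ u ∈ U, polar Q u v = 0) (hve : ∀ i, polar Q (e i) v = 0)
    (hvf : ∀ i, polar Q (f i) v = 0) : v ∈ U := by
  obtain ⟨u, hu, y, hy, rfl⟩ := Submodule.mem_sup.1 ((h.mem_iff hQ).2 ⟨hv, hve⟩)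
  have h1 := h.hyp.symm.eq_sum (Submodule.span_mono Set.subset_union_right hy)
  have h2 : ∀ i, polar Q (f i) y = 0 := fun i => by
    have h3 := hvf i
    rwa [polar_add_right, polar_comm Q (f i) u, h.uf u hu, zero_add] at h3
  have h4 : ∀ i, polar Q (e i) y = 0 := fun i => by
    have h3 := hve i
    rwa [polar_add_right, polar_comm Q (e i) u, h.ue u hu, zero_add] at h3
  simp only [h2, h4, zero_smul, Finset.sum_const_zero, add_zero] at h1
  rw [h1, add_zero]
  exact hu

/-- The member that exchanges the pairs with index in `s`. -/
def pairMember (U : Submodule F V) (e f : Fin 4 → V) (s : Finset (Fin 4)) : Submodule F V :=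
  extend U fun i => if i ∈ s then f i else e i

theorem Frame.mem_pairMember (h : Frame Q m U e f) (hQ : PlusSpace Q m) {s : Finset (Fin 4)}
    {v : V} : v ∈ pairMember U e f s ↔ (∀ u ∈ U, polar Q u v = 0) ∧
      ∀ i, polar Q (if i ∈ s then f i else e i) v = 0 := (h.exchange s).mem_iff hQ

/-- Here `σ` enumerates the symmetric difference of `s` and `t`, whose size is the codimension. -/
theorem Frame.finrank_inf_pairMember (h : Frame Q m U e f) (hQ : PlusSpace Q m)
    {s t : Finset (Fin 4)} {r : ℕ} {σ : Fin r → Fin 4} (hσ : Function.Injective σ)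
    (hst : ∀ k, (k ∈ s ↔ k ∈ t) ∨ ∃ i, σ i = k) (hσt : ∀ i, ¬ (σ i ∈ s ↔ σ i ∈ t)) :
    finrank F (pairMember U e f s ⊓ pairMember U e f t : Submodule F V) + r = m := by
  have hd : ∀ i, (if σ i ∈ s then e (σ i) else f (σ i)) =
      (if σ i ∈ t then f (σ i) else e (σ i)) := fun i => by
    have h1 := hσt i
    by_cases h2 : σ i ∈ s <;> by_cases h3 : σ i ∈ t <;> simp_all
  refine ((h.exchange s).hyp.comp hσ).finrank_inf hQ ((h.exchange s).isMaxTS hQ)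
    ((h.exchange t).isMaxTS hQ) (fun i => mem_extend (σ i)) (fun i => ?_) fun v hv hc => ?_
  · change (if σ i ∈ s then e (σ i) else f (σ i)) ∈ _
    rw [hd]
    exact mem_extend (b := fun i => if i ∈ t then f i else e i) (σ i)
  · obtain ⟨h1, h2⟩ := (h.mem_pairMember hQ).1 hv
    refine (h.mem_pairMember hQ).2 ⟨h1, fun k => ?_⟩
    rcases hst k with hk | ⟨i, rfl⟩
    · rw [← h2 k]
      exact congrArg (fun w => polar Q w v) (if_congr hk.symm rfl rfl)
    · rw [← hd]; exact hc i

/-- The member that meets four of the six exchanges of two pairs in codimension two. -/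
def twistVec (e f : Fin 4 → V) : Fin 4 → V := ![e 0 + f 1, e 1 + f 0, f 2 + e 3, f 3 + e 2]

/-- Two dual systems for the same twisted vectors: the first lies in the exchange of {0, 1}, the
second in that of {2, 3}. Each shows that the twisted member meets that exchange in U only. -/
theorem Frame.twist (hq : Nat.card F = 2) (h : Frame Q m U e f) {c : Fin 4 → V}
    (hc : c = ![f 0, f 1, e 2, e 3] ∨ c = ![e 1, e 0, f 3, f 2]) :
    Frame Q m U (twistVec e f) c := by
  have h11 := one_add_one_eq_zero hq
  have hyp := h.hyp
  refine ⟨h.ts, h.dim, ⟨fun i => ?_, fun i => ?_, fun i j => ?_, fun i j => ?_, fun i j => ?_⟩,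
    fun u hu i => ?_, fun u hu i => ?_⟩
  · fin_cases i <;>
      simp [twistVec, QuadraticMap.map_add (f := Q), hyp.qe, hyp.qf, hyp.ef, hyp.fe]
  · rcases hc with rfl | rfl <;> fin_cases i <;> simp [hyp.qe, hyp.qf]
  · fin_cases i <;> fin_cases j <;>
      simp [-polar_self, twistVec, polar_add_left, polar_add_right, hyp.ee, hyp.ff, hyp.ef, hyp.fe,
        h11]
  · rcases hc with rfl | rfl <;> fin_cases i <;> fin_cases j <;>
      simp [-polar_self, hyp.ee, hyp.ff, hyp.ef, hyp.fe]
  · rcases hc with rfl | rfl <;> fin_cases i <;> fin_cases j <;>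
      simp [-polar_self, twistVec, polar_add_left, hyp.ee, hyp.ff, hyp.ef, hyp.fe]
  · fin_cases i <;> simp [twistVec, polar_add_right, h.ue u hu, h.uf u hu]
  · rcases hc with rfl | rfl <;> fin_cases i <;> simp [h.ue u hu, h.uf u hu]

end Frame

theorem exists_frame (hQ : PlusSpace Q m) (hm : 4 ≤ m) {X : Submodule F V} (hX : IsMaxTS Q m X) :
    ∃ U e f, Frame Q m U e f ∧ pairMember U e f ∅ = X := by
  obtain ⟨e, f, h, he⟩ := hQ.exists_hypPairs hX 4 hm
  have hF : Frame Q m (X ⊓ perp Q (Submodule.span F (Set.range f))) e f :=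
    ⟨hX.1.mono inf_le_left, h.finrank_inf_perp hQ hX he, h,
      fun u hu i => hX.1.polar_eq_zero hu.1 (he i), fun u hu i => by
        rw [polar_comm]; exact mem_perp_span.1 hu.2 _ ⟨i, rfl⟩⟩
  refine ⟨_, e, f, hF, hQ.eq_of_le ((hF.exchange ∅).isMaxTS hQ) hX ?_⟩
  exact extend_le inf_le_left (fun i => by simpa using he i)

end HalfSpinTwo
end IbisOrth

namespace IbisOrth
-- Codimension-two adjacency and the position of the twisted member
section HalfSpinTwo

open QuadraticMap Module

variable {F V : Type*} [Field F] [AddCommGroup V] [Module F V] {Q : QuadraticForm F V} {m : ℕ}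
  {𝒮 : Set (Submodule F V)}

theorem forall_fin_four {P : Fin 4 → Prop} : (∀ i, P i) ↔ P 0 ∧ P 1 ∧ P 2 ∧ P 3 :=
  ⟨fun h => ⟨h 0, h 1, h 2, h 3⟩, fun ⟨h0, h1, h2, h3⟩ i => by fin_cases i <;> assumption⟩

/-- Elements normalizing `PΩ(V, Q)` preserve the relation of meeting in codimension two. -/
theorem not_finrank_inf_apply_le (hQ : PlusSpace Q m) (hq : Nat.card F = 2) (h𝒮 : IsFamily Q m 𝒮)
    {G : Subgroup (Equiv.Perm 𝒮)}
    (hnorm : ∀ g ∈ G, ∀ n ∈ inducedPerm (omegaGroup Q) 𝒮, g * n * g⁻¹ ∈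
      inducedPerm (omegaGroup Q) 𝒮) {g : Equiv.Perm 𝒮} (hg : g ∈ G) {A B : 𝒮}
    (hAB : finrank F (A.1 ⊓ B.1 : Submodule F V) + 2 = m) :
    ¬ finrank F ((g A).1 ⊓ (g B).1 : Submodule F V) + 4 ≤ m := by
  intro hfar
  obtain ⟨C, hC, hCA, hCB, hD⟩ := exists_third hQ h𝒮 A.2 B.2 hAB
  have h1 := (apply_mem_fixedClosure_iff hnorm hg).2
    (third_mem_closure hQ hq h𝒮 (C := ⟨C, hC⟩) hAB (fun h => hCA (congrArg Subtype.val h))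
      (fun h => hCB (congrArg Subtype.val h)) hD)
  rw [Set.image_pair] at h1
  rcases closure_pair_subset hQ h𝒮 hfar h1 with h2 | h2
  · exact hCA (congrArg Subtype.val (g.injective h2))
  · exact hCB (congrArg Subtype.val (g.injective h2))

theorem finrank_inf_eq_or_le (hQ : PlusSpace Q m) (h𝒮 : IsFamily Q m 𝒮) {A B : Submodule F V}
    (hA : A ∈ 𝒮) (hB : B ∈ 𝒮) (hne : A ≠ B) : finrank F (A ⊓ B : Submodule F V) + 2 = m ∨
      finrank F (A ⊓ B : Submodule F V) + 4 ≤ m := by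
  have h1 := finrank_inf_lt hQ h𝒮 hA hB hne
  have h2 := even_of_isFamily hQ h𝒮 hA hB
  rw [Nat.even_iff] at h2
  omega

section Frame

variable {e f : Fin 4 → V} {U : Submodule F V}

theorem mem_pairMember_of_mem {s : Finset (Fin 4)} {i : Fin 4} (hi : i ∈ s) :
    f i ∈ pairMember U e f s := by
  have := mem_extend (U := U) (b := fun i => if i ∈ s then f i else e i) i
  rwa [if_pos hi] at this

theorem mem_pairMember_of_notMem {s : Finset (Fin 4)} {i : Fin 4} (hi : i ∉ s) :
    e i ∈ pairMember U e f s := by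
  have := mem_extend (U := U) (b := fun i => if i ∈ s then f i else e i) i
  rwa [if_neg hi] at this

theorem Frame.polar_eq_zero_of_mem (h : Frame Q m U e f) (hQ : PlusSpace Q m)
    {s : Finset (Fin 4)} {v : V} (hv : v ∈ pairMember U e f s) :
    (∀ u ∈ U, polar Q u v = 0) ∧ (∀ i ∈ s, polar Q (f i) v = 0) ∧
      ∀ i ∉ s, polar Q (e i) v = 0 := by
  obtain ⟨h1, h2⟩ := (h.mem_pairMember hQ).1 hv
  exact ⟨h1, fun i hi => by simpa [hi] using h2 i, fun i hi => by simpa [hi] using h2 i⟩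

theorem Frame.pairMember_mem (h : Frame Q m U e f) (hQ : PlusSpace Q m) (h𝒮 : IsFamily Q m 𝒮)
    (hX : pairMember U e f ∅ ∈ 𝒮) {i j : Fin 4} (hij : i ≠ j) : pairMember U e f {i, j} ∈ 𝒮 := by
  refine (mem_of_isFamily hQ h𝒮 hX _).2 ⟨(h.exchange _).isMaxTS hQ, ?_⟩
  have h1 := h.finrank_inf_pairMember hQ (s := ∅) (t := {i, j}) (σ := ![i, j])
    (by intro a b hab; fin_cases a <;> fin_cases b <;> simp_all)
    (fun k => by
      by_cases h1 : k = i
      · exact Or.inr ⟨0, h1.symm⟩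
      · by_cases h2 : k = j
        · exact Or.inr ⟨1, h2.symm⟩
        · exact Or.inl (by simp [h1, h2]))
    (fun k => by fin_cases k <;> simp)
  rw [Nat.even_iff]
  omega

theorem Frame.mem_twist_iff (hq : Nat.card F = 2) (h : Frame Q m U e f) (hQ : PlusSpace Q m)
    {v : V} : v ∈ extend U (twistVec e f) ↔ (∀ u ∈ U, polar Q u v = 0) ∧
      polar Q (e 0) v + polar Q (f 1) v = 0 ∧ polar Q (e 1) v + polar Q (f 0) v = 0 ∧
      polar Q (f 2) v + polar Q (e 3) v = 0 ∧ polar Q (f 3) v + polar Q (e 2) v = 0 := by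
  rw [(h.twist hq (Or.inl rfl)).mem_iff hQ, forall_fin_four]
  simp only [twistVec, Matrix.cons_val_zero, Matrix.cons_val_one, Matrix.cons_val, polar_add_left]

theorem Frame.finrank_twist_inf (hq : Nat.card F = 2) (h : Frame Q m U e f) (hQ : PlusSpace Q m) :
    finrank F (extend U (twistVec e f) ⊓ pairMember U e f {0, 1} : Submodule F V) + 4 = m ∧
    finrank F (extend U (twistVec e f) ⊓ pairMember U e f {2, 3} : Submodule F V) + 4 = m := by
  have h1 := h.twist hq (Or.inl rfl)
  have h2 := h.twist hq (Or.inr rfl)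
  refine ⟨h1.hyp.finrank_inf hQ (h1.isMaxTS hQ) ((h.exchange _).isMaxTS hQ) mem_extend
    (fun i => ?_) fun v hv hc => ?_, h2.hyp.finrank_inf hQ (h2.isMaxTS hQ)
    ((h.exchange _).isMaxTS hQ) mem_extend (fun i => ?_) fun v hv hc => ?_⟩
  · fin_cases i
    exacts [mem_pairMember_of_mem (i := 0) (by decide), mem_pairMember_of_mem (i := 1) (by decide),
      mem_pairMember_of_notMem (i := 2) (by decide), mem_pairMember_of_notMem (i := 3) (by decide)]
  · refine (h.mem_pairMember hQ).2 ⟨((h.mem_twist_iff hq hQ).1 hv).1, fun i => ?_⟩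
    fin_cases i
    exacts [hc 0, hc 1, hc 2, hc 3]
  · fin_cases i
    exacts [mem_pairMember_of_notMem (i := 1) (by decide),
      mem_pairMember_of_notMem (i := 0) (by decide), mem_pairMember_of_mem (i := 3) (by decide),
      mem_pairMember_of_mem (i := 2) (by decide)]
  · refine (h.mem_pairMember hQ).2 ⟨((h.mem_twist_iff hq hQ).1 hv).1, fun i => ?_⟩
    fin_cases i
    exacts [hc 1, hc 0, hc 3, hc 2]

/-- Of the first dual system exactly f a and e c lie in this exchange, where c is the element of {2,
3} other than b; hence the codimension is two. -/
theorem Frame.finrank_twist_inf' (hq : Nat.card F = 2) (h : Frame Q m U e f) (hQ : PlusSpace Q m)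
    {a b : Fin 4} (ha : a = 0 ∨ a = 1) (hb : b = 2 ∨ b = 3) :
    finrank F (extend U (twistVec e f) ⊓ pairMember U e f {a, b} : Submodule F V) + 2 = m := by
  have h1 := h.twist hq (Or.inl rfl)
  obtain ⟨c, hc, hcb⟩ : ∃ c : Fin 4, (c = 2 ∨ c = 3) ∧ c ≠ b := by
    rcases hb with rfl | rfl <;> decide
  have hσ : Function.Injective ![a, c] := by
    rcases ha with rfl | rfl <;> rcases hc with rfl | rfl <;> decide
  refine (h1.hyp.comp hσ).finrank_inf hQ (h1.isMaxTS hQ) ((h.exchange _).isMaxTS hQ)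
    (fun i => mem_extend _) (fun i => ?_) fun v hv hcv => ?_
  · fin_cases i
    · rcases ha with rfl | rfl
      exacts [mem_pairMember_of_mem (i := 0) (by simp), mem_pairMember_of_mem (i := 1) (by simp)]
    · rcases hc with rfl | rfl <;> rcases hb with rfl | rfl <;> try exact absurd rfl hcb
      · rcases ha with rfl | rfl <;> exact mem_pairMember_of_notMem (i := 2) (by decide)
      · rcases ha with rfl | rfl <;> exact mem_pairMember_of_notMem (i := 3) (by decide)
  · obtain ⟨hu, h2, h3, h4, h5⟩ := (h.mem_twist_iff hq hQ).1 hv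
    have k0 := hcv 0
    have k1 := hcv 1
    refine (h.mem_pairMember hQ).2 ⟨hu, forall_fin_four.2 ?_⟩
    rcases ha with rfl | rfl <;> rcases hc with rfl | rfl <;> rcases hb with rfl | rfl <;>
      try exact absurd rfl hcb
    all_goals
      simp at k0 k1 ⊢
      grind

/-- The product of two commuting root elements moving a single pair member. -/
theorem Frame.exists_move (h : Frame Q m U e f) (hQ : PlusSpace Q m) (h𝒮 : IsFamily Q m 𝒮)
    {a b c d : Fin 4} (hab : a ≠ b) (hac : a ≠ c) (had : a ≠ d) (hbc : b ≠ c) (hbd : b ≠ d)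
    {x : Submodule F V}
    (hx : ∀ z ∈ x, z + (polar Q (e c) z • e d - polar Q (e d) z • e c) +
      (polar Q (f a) z • f b - polar Q (f b) z • f a) ∈ x) {L : Set 𝒮}
    (hL : ∀ Y ∈ L, Y.1 = x ∨ (f a ∈ Y.1 ∨ f b ∈ Y.1) ∧ (e c ∈ Y.1 ∨ e d ∈ Y.1)) {y : 𝒮}
    (hy : y.1 = pairMember U e f {c, d}) :
    ∃ σ ∈ inducedPerm (omegaGroup Q) 𝒮, (∀ Y ∈ L, σ Y = Y) ∧ σ y ≠ y := by
  have := hQ.finite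
  have hyp := h.hyp
  have hs1 : SingularPair Q (e c) (e d) := ⟨hyp.qe c, hyp.qe d, hyp.ee c d⟩
  have hs2 : SingularPair Q (f a) (f b) := ⟨hyp.qf a, hyp.qf b, hyp.ff a b⟩
  have hgz : ∀ z, (root _ _ hs2 * root _ _ hs1) z = z +
      (polar Q (e c) z • e d - polar Q (e d) z • e c) +
      (polar Q (f a) z • f b - polar Q (f b) z • f a) := by
    intro z
    rw [LinearEquiv.mul_apply, root_apply, root_apply]
    simp only [polar_add_right, polar_sub_right, polar_smul_right, hyp.fe, if_neg hac, if_neg had,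
      if_neg hbc, if_neg hbd, smul_zero, sub_zero, add_zero]
  have stab : ∀ {Y : Submodule F V} {u v : V} (hs : SingularPair Q u v), IsTotallySingular Q Y →
      (u ∈ Y ∨ v ∈ Y) → ∀ z ∈ Y, root u v hs z ∈ Y := by
    intro Y u v hs hY huv z hz
    have h1 : Y.map (root u v hs : V →ₗ[F] V) = Y := by
      rcases huv with hu | hv
      · exact map_root_eq_of_mem hY hs (a := 1) (b := 0) (Or.inl one_ne_zero) (by simpa using hu)
      · exact map_root_eq_of_mem hY hs (a := 0) (b := 1) (Or.inr one_ne_zero) (by simpa using hv)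
    have h2 : root u v hs z ∈ Y.map (root u v hs : V →ₗ[F] V) := ⟨z, hz, rfl⟩
    rwa [h1] at h2
  have hym := isMaxTS_of_isFamily h𝒮 y.2
  have hea : e a ∈ y.1 := hy ▸ mem_pairMember_of_notMem (by simp [hac, had])
  have heb : e b ∈ y.1 := hy ▸ mem_pairMember_of_notMem (by simp [hbc, hbd])
  refine (rootStable_of_isFamily hQ h𝒮).exists_move hQ
    (mul_mem (root_mem_rootGroup hs2) (root_mem_rootGroup hs1)) (fun Y hY z hz => ?_) hea
    fun hcon => ?_
  · rcases hL Y hY with hYx | ⟨h1, h2⟩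
    · rw [hYx] at hz ⊢
      rw [hgz]
      exact hx z hz
    · have hYm := isMaxTS_of_isFamily h𝒮 Y.2
      exact stab hs2 hYm.1 h1 _ (stab hs1 hYm.1 h2 z hz)
  -- The vector e a is sent to e a + f b, which is not orthogonal to e b.
  · have h1 := hym.1.polar_eq_zero heb hcon
    rw [hgz] at h1
    simp [polar_add_right, hyp.ee, hyp.fe, hyp.ef, hab.symm] at h1

end Frame

end HalfSpinTwo
end IbisOrth

namespace IbisOrth
-- Rigidity of the twisted member
section HalfSpinTwo

open QuadraticMap Module

variable {F V : Type*} [Field F] [AddCommGroup V] [Module F V] {Q : QuadraticForm F V} {m : ℕ}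
  {𝒮 : Set (Submodule F V)} {e f : Fin 4 → V} {U : Submodule F V}

/-- An isometry stabilizing the six exchanges of two pairs stabilizes the twisted member. -/
theorem Frame.map_twist (hq : Nat.card F = 2) (h : Frame Q m U e f) (hQ : PlusSpace Q m)
    {g : V ≃ₗ[F] V} (hg : ∀ i j, i ≠ j → ∀ v ∈ pairMember U e f {i, j},
      g v ∈ pairMember U e f {i, j}) :
    (extend U (twistVec e f)).map (g : V →ₗ[F] V) = extend U (twistVec e f) := by
  have := hQ.finite
  have avoid : ∀ i k : Fin 4, ∃ j, j ≠ i ∧ j ≠ k := by decide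
  have avoid' : ∀ i k : Fin 4, ∃ j l, j ≠ l ∧ j ≠ i ∧ l ≠ i ∧ j ≠ k ∧ l ≠ k := by decide
  have pol := fun {s : Finset (Fin 4)} {v : V} => h.polar_eq_zero_of_mem hQ (s := s) (v := v)
  have memU : ∀ {u s}, u ∈ U → u ∈ pairMember U e f s := fun hu => le_extend hu
  have hgU : ∀ u ∈ U, g u ∈ U := by
    intro u hu
    have h1 := pol (hg 0 1 (by decide) u (memU hu))
    have h2 := pol (hg 2 3 (by decide) u (memU hu))
    refine h.mem_base hQ h1.1 (forall_fin_four.2 ?_) (forall_fin_four.2 ?_)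
    · exact ⟨h2.2.2 0 (by decide), h2.2.2 1 (by decide), h1.2.2 2 (by decide), h1.2.2 3 (by decide)⟩
    · exact ⟨h1.2.1 0 (by decide), h1.2.1 1 (by decide), h2.2.1 2 (by decide), h2.2.1 3 (by decide)⟩
  have hgU' := map_eq_of_le hgU
  have hback : ∀ {p}, g p ∈ U → p ∈ U := by
    intro p hp
    rw [← hgU'] at hp
    obtain ⟨u, hu, hup⟩ := hp
    rwa [← g.injective hup]
  -- Modulo U, g p is a multiple of p; the multiple 0 would put p into U, so it is 1.
  have one : ∀ {p p' : V}, (∀ u ∈ U, polar Q u p' = 0) → polar Q p' p = 1 →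
      g p - polar Q p' (g p) • p ∈ U → g p - p ∈ U := by
    intro p p' hp' hpp hmem
    rcases eq_zero_or_eq_one hq (polar Q p' (g p)) with h0 | h1
    · rw [h0, zero_smul, sub_zero] at hmem
      have h2 := hp' p (hback hmem)
      rw [polar_comm, hpp] at h2
      exact absurd h2 one_ne_zero
    · rwa [h1, one_smul] at hmem
  -- Modulo U, f i spans the intersection of the three exchanges involving i.
  have hf : ∀ i, g (f i) - f i ∈ U := by
    intro i
    have hm : ∀ j, j ≠ i → g (f i) ∈ pairMember U e f {i, j} := fun j hj =>
      hg i j hj.symm _ (mem_pairMember_of_mem (by simp))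
    have hu : ∀ u ∈ U, polar Q u (g (f i)) = 0 := by
      obtain ⟨j, hj, -⟩ := avoid i i
      exact (pol (hm j hj)).1
    have hfk : ∀ k, polar Q (f k) (g (f i)) = 0 := by
      intro k
      obtain ⟨j, hj, -⟩ := avoid i i
      by_cases hk : k = i
      · exact (pol (hm j hj)).2.1 k (by simp [hk])
      · exact (pol (hm k hk)).2.1 k (by simp)
    have hek : ∀ k, k ≠ i → polar Q (e k) (g (f i)) = 0 := by
      intro k hk
      obtain ⟨j, hj, hjk⟩ := avoid i k
      exact (pol (hm j hj)).2.2 k (by simp [hk, hjk.symm])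
    refine one (p' := e i) (fun u hu => h.ue u hu i) (by simp [h.hyp.ef]) ?_
    refine h.mem_base hQ (fun u hu' => ?_) (fun k => ?_) fun k => ?_
    · rw [polar_sub_right, polar_smul_right, hu u hu', h.uf u hu']; simp
    · rw [polar_sub_right, polar_smul_right, h.hyp.ef]
      by_cases hk : k = i
      · subst hk; simp
      · simp [hk, hek k hk]
    · rw [polar_sub_right, polar_smul_right, h.hyp.ff, hfk]; simp
  -- Modulo U, e i spans the intersection of the three exchanges avoiding i.
  have he : ∀ i, g (e i) - e i ∈ U := by
    intro i
    have hm : ∀ j l, j ≠ l → j ≠ i → l ≠ i → g (e i) ∈ pairMember U e f {j, l} :=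
      fun j l hjl hj hl => hg j l hjl _ (mem_pairMember_of_notMem (by simp [hj.symm, hl.symm]))
    have hu : ∀ u ∈ U, polar Q u (g (e i)) = 0 := by
      obtain ⟨j, l, hjl, hj, hl, -⟩ := avoid' i i
      exact (pol (hm j l hjl hj hl)).1
    have hek : ∀ k, polar Q (e k) (g (e i)) = 0 := by
      intro k
      obtain ⟨j, l, hjl, hj, hl, hjk, hlk⟩ := avoid' i k
      exact (pol (hm j l hjl hj hl)).2.2 k (by simp [hjk.symm, hlk.symm])
    have hfk : ∀ k, k ≠ i → polar Q (f k) (g (e i)) = 0 := by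
      intro k hk
      obtain ⟨j, hj, hjk⟩ := avoid i k
      exact (pol (hm j k hjk hj hk)).2.1 k (by simp)
    refine one (p' := f i) (fun u hu => h.uf u hu i) (by simp [h.hyp.fe]) ?_
    refine h.mem_base hQ (fun u hu' => ?_) (fun k => ?_) fun k => ?_
    · rw [polar_sub_right, polar_smul_right, hu u hu', h.ue u hu']; simp
    · rw [polar_sub_right, polar_smul_right, h.hyp.ee, hek]; simp
    · rw [polar_sub_right, polar_smul_right, h.hyp.fe]
      by_cases hk : k = i
      · subst hk; simp
      · simp [hk, hfk k hk]
  have hadd : ∀ {p r}, g p - p ∈ U → g r - r ∈ U → p + r ∈ extend U (twistVec e f) →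
      g (p + r) ∈ extend U (twistVec e f) := by
    intro p r hp hr hpr
    have h1 : g (p + r) = (g p - p) + (g r - r) + (p + r) := by rw [map_add]; abel
    rw [h1]
    exact Submodule.add_mem _ (le_extend (U.add_mem hp hr)) hpr
  refine map_eq_of_le fun v hv => ?_
  have hle : extend U (twistVec e f) ≤ (extend U (twistVec e f)).comap (g : V →ₗ[F] V) :=
    extend_le (fun u hu => le_extend (hgU u hu)) (forall_fin_four.2
      ⟨hadd (he 0) (hf 1) (mem_extend 0), hadd (he 1) (hf 0) (mem_extend 1),
        hadd (hf 2) (he 3) (mem_extend 2), hadd (hf 3) (he 2) (mem_extend 3)⟩)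
  exact hle hv

/-- The twisted member is determined by its intersections with the six exchanges of two pairs. -/
theorem Frame.eq_twist (hq : Nat.card F = 2) (h : Frame Q m U e f) (hQ : PlusSpace Q m)
    {T : Submodule F V} (hT : IsMaxTS Q m T) (hUT : U ≤ T)
    (hfar : finrank F (T ⊓ pairMember U e f {0, 1} : Submodule F V) + 4 = m)
    (hfar' : finrank F (T ⊓ pairMember U e f {2, 3} : Submodule F V) + 4 = m)
    (hnear : ∀ a b : Fin 4, (a = 0 ∨ a = 1) → (b = 2 ∨ b = 3) →
      finrank F (T ⊓ pairMember U e f {a, b} : Submodule F V) + 2 = m) :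
    T = extend U (twistVec e f) := by
  have := hQ.finite
  have hdim := h.dim
  have pol := fun {s : Finset (Fin 4)} {v : V} => h.polar_eq_zero_of_mem hQ (s := s) (v := v)
  have hle : ∀ s, U ≤ pairMember U e f s := fun _ => le_extend
  have i01 : T ⊓ pairMember U e f {0, 1} = U :=
    (Submodule.eq_of_le_of_finrank_eq
      (le_inf hUT (hle _)) (by omega)).symm
  have i23 : T ⊓ pairMember U e f {2, 3} = U :=
    (Submodule.eq_of_le_of_finrank_eq
      (le_inf hUT (hle _)) (by omega)).symm
  -- Write Y for the exchanges. By dimensions Y_ab is the sum of T ∩ Y_ab and Y_ab ∩ Y_23, so p = t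
  -- + w accordingly. As T ∩ Y_23 = U, the part w is unique modulo U, so it lies in all three of
  -- Y_ab, Y_a'b' and Y_23, and by `hr` it is 0 or r modulo U.
  have key : ∀ {a b a' b' : Fin 4}, (a = 0 ∨ a = 1) → (b = 2 ∨ b = 3) → (a' = 0 ∨ a' = 1) →
      (b' = 2 ∨ b' = 3) → ∀ {p r r' : V}, p ∈ pairMember U e f {a, b} →
      p ∈ pairMember U e f {a', b'} → p ∈ pairMember U e f {0, 1} → p ∉ U →
      (∀ v, v ∈ pairMember U e f {a, b} → v ∈ pairMember U e f {a', b'} →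
        v ∈ pairMember U e f {2, 3} → v - polar Q r' v • r ∈ U) → p - r ∈ T := by
    intro a b a' b' ha hb ha' hb' p r r' hp hp' hp01 hpU hr
    have split : ∀ {a b : Fin 4}, (a = 0 ∨ a = 1) → (b = 2 ∨ b = 3) →
        p ∈ pairMember U e f {a, b} → ∃ t ∈ T, ∃ w ∈ pairMember U e f {a, b} ⊓
          pairMember U e f {2, 3}, p = t + w := by
      intro a b ha hb hp
      have hsup : T ⊓ pairMember U e f {a, b} ⊔
          pairMember U e f {a, b} ⊓ pairMember U e f {2, 3} = pairMember U e f {a, b} := by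
        refine Submodule.eq_of_le_of_finrank_le (sup_le inf_le_right inf_le_left) ?_
        obtain ⟨c, hc, hcb⟩ : ∃ c : Fin 4, (c = 2 ∨ c = 3) ∧ c ≠ b := by
          rcases hb with rfl | rfl <;> decide
        have h1 := h.finrank_inf_pairMember hQ (s := {a, b}) (t := {2, 3}) (σ := ![a, c])
          (by rcases ha with rfl | rfl <;> rcases hc with rfl | rfl <;> decide)
          (by
            rcases ha with rfl | rfl <;> rcases hc with rfl | rfl <;> rcases hb with rfl | rfl <;>
              first | exact absurd rfl hcb | decide)
          (by
            rcases ha with rfl | rfl <;> rcases hc with rfl | rfl <;> rcases hb with rfl | rfl <;>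
              first | exact absurd rfl hcb | decide)
        have h2 := hnear a b ha hb
        have h3 := Submodule.finrank_sup_add_finrank_inf_eq (T ⊓ pairMember U e f {a, b})
          (pairMember U e f {a, b} ⊓ pairMember U e f {2, 3})
        have h4 := Submodule.finrank_mono (show T ⊓ pairMember U e f {a, b} ⊓
          (pairMember U e f {a, b} ⊓ pairMember U e f {2, 3}) ≤ U from
          (inf_le_inf inf_le_left inf_le_right).trans i23.le)
        have h5 := ((h.exchange {a, b}).isMaxTS hQ).2
        change finrank F (pairMember U e f {a, b}) = m at h5
        omega
      rw [← hsup] at hp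
      obtain ⟨t, ht, w, hw, rfl⟩ := Submodule.mem_sup.1 hp
      exact ⟨t, ht.1, w, hw, rfl⟩
    obtain ⟨t, ht, w, hw, hpt⟩ := split ha hb hp
    obtain ⟨t', ht', w', hw', hpt'⟩ := split ha' hb' hp'
    have h1 : w - w' ∈ U := by
      rw [← i23]
      refine ⟨?_, Submodule.sub_mem _ hw.2 hw'.2⟩
      have h2 : w - w' = t' - t := by
        rw [sub_eq_sub_iff_add_eq_add, add_comm, ← hpt, hpt']
      rw [h2]
      exact T.sub_mem ht' ht
    have hw1 : w ∈ pairMember U e f {a', b'} := by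
      have h2 := Submodule.add_mem _ (show w - w' ∈ pairMember U e f {a', b'} from le_extend h1) hw'.1
      rwa [sub_add_cancel] at h2
    have h2 := hr w hw.1 hw1 hw.2
    have h3 : p - polar Q r' w • r ∈ T := by
      have h4 : p - polar Q r' w • r = t + (w - polar Q r' w • r) := by rw [hpt]; abel
      rw [h4]
      exact T.add_mem ht (hUT h2)
    -- The coefficient 0 would put p into T ∩ Y_01 = U.
    rcases eq_zero_or_eq_one hq (polar Q r' w) with h0 | h0
    · rw [h0, zero_smul, sub_zero] at h3
      exact absurd (i01 ▸ (⟨h3, hp01⟩ : p ∈ T ⊓ pairMember U e f {0, 1})) hpU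
    · rwa [h0, one_smul] at h3
  have hneg : ∀ {p r : V}, p - r ∈ T → p + r ∈ T := by
    intro p r hpr
    have h1 : p + r = p - r + ((1 : F) + 1) • r := by module
    rw [h1, one_add_one_eq_zero hq, zero_smul, add_zero]
    exact hpr
  have hfU : ∀ i, f i ∉ U := fun i hi => by
    have := h.ue _ hi i
    rw [h.hyp.fe] at this
    simp at this
  have heU : ∀ i, e i ∉ U := fun i hi => by
    have := h.uf _ hi i
    rw [h.hyp.ef] at this
    simp at this
  have hef := h.hyp.ef
  have hfe := h.hyp.fe
  have hee := h.hyp.ee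
  have hff := h.hyp.ff
  have k0 : f 0 - e 1 ∈ T := key (a := 0) (b := 2) (a' := 0) (b' := 3) (r' := f 1) (by decide)
    (by decide) (by decide) (by decide) (mem_pairMember_of_mem (by decide))
    (mem_pairMember_of_mem (by decide)) (mem_pairMember_of_mem (by decide)) (hfU 0)
    fun v hv1 hv2 hv3 => by
      obtain ⟨hu, h1, h1'⟩ := pol hv1
      obtain ⟨-, h2, h2'⟩ := pol hv2
      obtain ⟨-, h3, h3'⟩ := pol hv3
      refine h.mem_base hQ (fun u hu' => ?_) (forall_fin_four.2 ?_) (forall_fin_four.2 ?_) <;>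
        simp only [polar_sub_right, polar_smul_right]
      · rw [hu u hu', h.ue u hu']; simp
      · rw [h3' 0 (by decide), h1' 1 (by decide), h2' 2 (by decide), h1' 3 (by decide)]
        simp [-polar_self, hee]
      · rw [h1 0 (by decide), h1 2 (by decide), h2 3 (by decide)]
        simp [hfe]
  have k1 : f 1 - e 0 ∈ T := key (a := 1) (b := 2) (a' := 1) (b' := 3) (r' := f 0) (by decide)
    (by decide) (by decide) (by decide) (mem_pairMember_of_mem (by decide))
    (mem_pairMember_of_mem (by decide)) (mem_pairMember_of_mem (by decide)) (hfU 1)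
    fun v hv1 hv2 hv3 => by
      obtain ⟨hu, h1, h1'⟩ := pol hv1
      obtain ⟨-, h2, h2'⟩ := pol hv2
      obtain ⟨-, h3, h3'⟩ := pol hv3
      refine h.mem_base hQ (fun u hu' => ?_) (forall_fin_four.2 ?_) (forall_fin_four.2 ?_) <;>
        simp only [polar_sub_right, polar_smul_right]
      · rw [hu u hu', h.ue u hu']; simp
      · rw [h1' 0 (by decide), h3' 1 (by decide), h2' 2 (by decide), h1' 3 (by decide)]
        simp [-polar_self, hee]
      · rw [h1 1 (by decide), h1 2 (by decide), h2 3 (by decide)]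
        simp [hfe]
  have k2 : e 2 - f 3 ∈ T := key (a := 0) (b := 3) (a' := 1) (b' := 3) (r' := e 3) (by decide)
    (by decide) (by decide) (by decide) (mem_pairMember_of_notMem (by decide))
    (mem_pairMember_of_notMem (by decide)) (mem_pairMember_of_notMem (by decide)) (heU 2)
    fun v hv1 hv2 hv3 => by
      obtain ⟨hu, h1, h1'⟩ := pol hv1
      obtain ⟨-, h2, h2'⟩ := pol hv2
      obtain ⟨-, h3, h3'⟩ := pol hv3
      refine h.mem_base hQ (fun u hu' => ?_) (forall_fin_four.2 ?_) (forall_fin_four.2 ?_) <;>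
        simp only [polar_sub_right, polar_smul_right]
      · rw [hu u hu', h.uf u hu']; simp
      · rw [h2' 0 (by decide), h1' 1 (by decide), h1' 2 (by decide)]
        simp [hef]
      · rw [h1 0 (by decide), h2 1 (by decide), h3 2 (by decide), h1 3 (by decide)]
        simp [-polar_self, hff]
  have k3 : e 3 - f 2 ∈ T := key (a := 0) (b := 2) (a' := 1) (b' := 2) (r' := e 2) (by decide)
    (by decide) (by decide) (by decide) (mem_pairMember_of_notMem (by decide))
    (mem_pairMember_of_notMem (by decide)) (mem_pairMember_of_notMem (by decide)) (heU 3)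
    fun v hv1 hv2 hv3 => by
      obtain ⟨hu, h1, h1'⟩ := pol hv1
      obtain ⟨-, h2, h2'⟩ := pol hv2
      obtain ⟨-, h3, h3'⟩ := pol hv3
      refine h.mem_base hQ (fun u hu' => ?_) (forall_fin_four.2 ?_) (forall_fin_four.2 ?_) <;>
        simp only [polar_sub_right, polar_smul_right]
      · rw [hu u hu', h.uf u hu']; simp
      · rw [h2' 0 (by decide), h1' 1 (by decide), h1' 3 (by decide)]
        simp [hef]
      · rw [h1 0 (by decide), h2 1 (by decide), h1 2 (by decide), h3 3 (by decide)]
        simp [-polar_self, hff]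
  refine (hQ.eq_of_le ((h.twist hq (Or.inl rfl)).isMaxTS hQ) hT
    (extend_le hUT (forall_fin_four.2 ⟨?_, ?_, ?_, ?_⟩))).symm
  · rw [show twistVec e f 0 = f 1 + e 0 from add_comm _ _]; exact hneg k1
  · rw [show twistVec e f 1 = f 0 + e 1 from add_comm _ _]; exact hneg k0
  · rw [show twistVec e f 2 = e 3 + f 2 from add_comm _ _]; exact hneg k3
  · rw [show twistVec e f 3 = e 2 + f 3 from add_comm _ _]; exact hneg k2

/-- The twisted member x depends on the six exchanges of two pairs. Elements of G fixing these
preserve the codimension-two relation, so g x has the same distances to them as x; moreover g x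
contains U, and `Frame.eq_twist` identifies it. -/
theorem not_isIBIS_family_of_card_eq_two [Finite F] (hQ : PlusSpace Q m) (hq : Nat.card F = 2)
    (hm : 4 ≤ m) (h𝒮 : IsFamily Q m 𝒮) {G : Subgroup (Equiv.Perm 𝒮)}
    (hNG : inducedPerm (omegaGroup Q) 𝒮 ≤ G)
    (hnorm : ∀ g ∈ G, ∀ n ∈ inducedPerm (omegaGroup Q) 𝒮, g * n * g⁻¹ ∈
      inducedPerm (omegaGroup Q) 𝒮) : ¬ IsIBIS G := by
  have := hQ.finite
  have : Finite V := Module.finite_of_finite F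
  have hst := rootStable_of_isFamily hQ h𝒮
  obtain ⟨X, hX⟩ := exists_mem_of_isFamily h𝒮
  obtain ⟨U, e, f, h, rfl⟩ := exists_frame hQ hm (isMaxTS_of_isFamily h𝒮 hX)
  have hyp := h.hyp
  have hYmem := fun {i j : Fin 4} (hij : i ≠ j) => h.pairMember_mem hQ h𝒮 hX hij
  have pol := fun {s : Finset (Fin 4)} {v : V} => h.polar_eq_zero_of_mem hQ (s := s) (v := v)
  have hxm := (h.twist hq (Or.inl rfl)).isMaxTS hQ
  obtain ⟨far, far'⟩ := h.finrank_twist_inf hq hQ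
  have near := fun {a b : Fin 4} => h.finrank_twist_inf' hq hQ (a := a) (b := b)
  have hxmem : extend U (twistVec e f) ∈ 𝒮 := by
    refine (mem_of_isFamily hQ h𝒮 (hYmem (i := 0) (j := 2) (by decide)) _).2 ⟨hxm, ?_⟩
    have h1 := near (a := 0) (b := 2) (by decide) (by decide)
    rw [inf_comm] at h1
    rw [Nat.even_iff]
    omega
  set x : 𝒮 := ⟨_, hxmem⟩ with hx
  let Y : ∀ i j : Fin 4, i ≠ j → 𝒮 := fun i j hij => ⟨_, hYmem hij⟩
  set Y01 : 𝒮 := Y 0 1 (by decide) with hY01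
  set Y23 : 𝒮 := Y 2 3 (by decide) with hY23
  set y : Fin 4 → 𝒮 := ![Y 0 2 (by decide), Y 1 3 (by decide), Y 0 3 (by decide),
    Y 1 2 (by decide)] with hy
  have hirr : IrredundantList (inducedPerm (omegaGroup Q) 𝒮)
      ([0, 1, 2, 3].map y ++ x :: [Y23, Y01]) := by
    refine IrredundantList.append_map (N := inducedPerm (omegaGroup Q) 𝒮) (L := [x, Y23, Y01]) ⟨⟨⟨trivial, ?_⟩, ?_⟩, ?_⟩ (by decide) ?_
    · have h1 := hst.exists_move_root hQ (u := e 0) (v := e 1)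
        ⟨hyp.qe 0, hyp.qe 1, hyp.ee 0 1⟩ (L := ∅) (by simp) (x := Y01) (z := f 0)
        (mem_pairMember_of_mem (by decide)) (fun hcon => by
          have h2 := (pol hcon).2.1 1 (by decide)
          simp [hyp.ef, hyp.fe] at h2)
      simpa using h1
    · have h1 := hst.exists_move_root hQ (u := e 2) (v := e 3)
        ⟨hyp.qe 2, hyp.qe 3, hyp.ee 2 3⟩ (L := {Y01}) (by
          rintro _ rfl z hz
          obtain ⟨-, -, h2⟩ := pol hz
          rw [h2 2 (by decide), h2 3 (by decide)]; simp) (x := Y23) (z := f 2)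
        (mem_pairMember_of_mem (by decide)) (fun hcon => by
          have h2 := (pol hcon).2.1 3 (by decide)
          simp [hyp.ef, hyp.fe] at h2)
      simpa using h1
    · have h1 := hst.exists_move_root hQ (u := e 0) (v := e 2)
        ⟨hyp.qe 0, hyp.qe 2, hyp.ee 0 2⟩ (L := {Y23, Y01}) (by
          rintro _ (rfl | rfl) z hz
          · obtain ⟨-, -, h2⟩ := pol hz
            rw [h2 0 (by decide), zero_smul]
            exact Submodule.sub_mem _ (Submodule.zero_mem _)
              (Submodule.smul_mem _ _ (mem_pairMember_of_notMem (by decide)))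
          · obtain ⟨-, -, h2⟩ := pol hz
            rw [h2 2 (by decide), zero_smul]
            exact Submodule.sub_mem _
              (Submodule.smul_mem _ _ (mem_pairMember_of_notMem (by decide)))
              (Submodule.zero_mem _)) (x := x) (z := e 1 + f 0)
        (mem_extend 1) (fun hcon => by
          obtain ⟨-, -, -, h2, -⟩ := (h.mem_twist_iff hq hQ).1 hcon
          simp [polar_add_right, hyp.ef, hyp.fe, hyp.ee] at h2)
      obtain ⟨σ, hσ, hf, hm⟩ := h1
      exact ⟨σ, hσ, fun y hy => hf y (by
        have hy' : y ∈ [Y23, Y01] := hy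
        simpa using hy'), hm⟩
    · have move : ∀ {a b c d : Fin 4}, a ≠ b → a ≠ c → a ≠ d → b ≠ c → b ≠ d →
          (∀ z ∈ extend U (twistVec e f),
            z + (polar Q (e c) z • e d - polar Q (e d) z • e c) +
              (polar Q (f a) z • f b - polar Q (f b) z • f a) ∈ extend U (twistVec e f)) →
          ∀ {i : Fin 4}, (y i).1 = pairMember U e f {c, d} →
          (∀ j, j ≠ i → (f a ∈ (y j).1 ∨ f b ∈ (y j).1) ∧ (e c ∈ (y j).1 ∨ e d ∈ (y j).1)) →
          (f a ∈ Y23.1 ∨ f b ∈ Y23.1) ∧ (e c ∈ Y23.1 ∨ e d ∈ Y23.1) →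
          (f a ∈ Y01.1 ∨ f b ∈ Y01.1) ∧ (e c ∈ Y01.1 ∨ e d ∈ Y01.1) →
          ∃ n ∈ inducedPerm (omegaGroup Q) 𝒮, (∀ z ∈ [x, Y23, Y01], n z = z) ∧
            (∀ j ∈ [0, 1, 2, 3], j ≠ i → n (y j) = y j) ∧ n (y i) ≠ y i := by
        intro a b c d hab hac had hbc hbd hxs i hyi hyj h23 h01
        obtain ⟨σ, hσ, hf, hm⟩ := h.exists_move hQ h𝒮 hab hac had hbc hbd hxs
          (L := {z | z ∈ [x, Y23, Y01] ∨ ∃ j, j ≠ i ∧ z = y j}) (by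
            rintro z (hz | ⟨j, hj, rfl⟩)
            · simp only [List.mem_cons, List.not_mem_nil, or_false] at hz
              rcases hz with rfl | rfl | rfl
              exacts [Or.inl rfl, Or.inr h23, Or.inr h01]
            · exact Or.inr (hyj j hj)) hyi
        exact ⟨σ, hσ, fun z hz => hf z (Or.inl hz), fun j _ hj => hf _ (Or.inr ⟨j, hj, rfl⟩), hm⟩
      have hxs : ∀ {a b c d : Fin 4}, (a = 0 ∧ c = 1 ∨ a = 1 ∧ c = 0) →
          (b = 2 ∧ d = 3 ∨ b = 3 ∧ d = 2) → ∀ z ∈ extend U (twistVec e f),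
            z + (polar Q (e c) z • e d - polar Q (e d) z • e c) +
              (polar Q (f a) z • f b - polar Q (f b) z • f a) ∈ extend U (twistVec e f) := by
        intro a b c d hac hbd z hz
        obtain ⟨hu, h1, h2, h3, h4⟩ := (h.mem_twist_iff hq hQ).1 hz
        refine (h.mem_twist_iff hq hQ).2 ⟨fun u hu' => ?_, ?_⟩
        · simp only [polar_add_right, polar_sub_right, polar_smul_right, hu u hu', h.ue u hu',
            h.uf u hu']
          simp
        · simp only [polar_add_right, polar_sub_right, polar_smul_right, hyp.ee, hyp.ff, hyp.ef,
            hyp.fe, smul_eq_mul]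
          rcases hac with ⟨rfl, rfl⟩ | ⟨rfl, rfl⟩ <;> rcases hbd with ⟨rfl, rfl⟩ | ⟨rfl, rfl⟩ <;>
            simp <;> grind
      have mf : ∀ {s : Finset (Fin 4)} {k}, k ∈ s → f k ∈ pairMember U e f s :=
        mem_pairMember_of_mem
      have me : ∀ {s : Finset (Fin 4)} {k}, k ∉ s → e k ∈ pairMember U e f s :=
        mem_pairMember_of_notMem
      intro i _
      fin_cases i
      · refine move (a := 1) (b := 3) (c := 0) (d := 2) (by decide) (by decide) (by decide)
          (by decide) (by decide) (hxs (by decide) (by decide)) rfl (fun j hj => ?_)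
          ⟨Or.inr (mf (by decide)), Or.inl (me (by decide))⟩
          ⟨Or.inl (mf (by decide)), Or.inr (me (by decide))⟩
        fin_cases j
        · exact absurd rfl hj
        · exact ⟨Or.inl (mf (by decide)), Or.inl (me (by decide))⟩
        · exact ⟨Or.inr (mf (by decide)), Or.inr (me (by decide))⟩
        · exact ⟨Or.inl (mf (by decide)), Or.inl (me (by decide))⟩
      · refine move (a := 0) (b := 2) (c := 1) (d := 3) (by decide) (by decide) (by decide)
          (by decide) (by decide) (hxs (by decide) (by decide)) rfl (fun j hj => ?_)
          ⟨Or.inr (mf (by decide)), Or.inl (me (by decide))⟩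
          ⟨Or.inl (mf (by decide)), Or.inr (me (by decide))⟩
        fin_cases j
        · exact ⟨Or.inl (mf (by decide)), Or.inl (me (by decide))⟩
        · exact absurd rfl hj
        · exact ⟨Or.inl (mf (by decide)), Or.inl (me (by decide))⟩
        · exact ⟨Or.inr (mf (by decide)), Or.inr (me (by decide))⟩
      · refine move (a := 1) (b := 2) (c := 0) (d := 3) (by decide) (by decide) (by decide)
          (by decide) (by decide) (hxs (by decide) (by decide)) rfl (fun j hj => ?_)
          ⟨Or.inr (mf (by decide)), Or.inl (me (by decide))⟩
          ⟨Or.inl (mf (by decide)), Or.inr (me (by decide))⟩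
        fin_cases j
        · exact ⟨Or.inr (mf (by decide)), Or.inr (me (by decide))⟩
        · exact ⟨Or.inl (mf (by decide)), Or.inl (me (by decide))⟩
        · exact absurd rfl hj
        · exact ⟨Or.inl (mf (by decide)), Or.inl (me (by decide))⟩
      · refine move (a := 0) (b := 3) (c := 1) (d := 2) (by decide) (by decide) (by decide)
          (by decide) (by decide) (hxs (by decide) (by decide)) rfl (fun j hj => ?_)
          ⟨Or.inr (mf (by decide)), Or.inl (me (by decide))⟩
          ⟨Or.inl (mf (by decide)), Or.inr (me (by decide))⟩
        fin_cases j
        · exact ⟨Or.inl (mf (by decide)), Or.inl (me (by decide))⟩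
        · exact ⟨Or.inr (mf (by decide)), Or.inr (me (by decide))⟩
        · exact ⟨Or.inl (mf (by decide)), Or.inl (me (by decide))⟩
        · exact absurd rfl hj
  refine not_isIBIS_of_dependent (hirr.mono hNG) fun g hg hfix => ?_
  have gYlt : ∀ i j (hij : i ≠ j), i < j → g (Y i j hij) = Y i j hij := by
    intro i j hij hlt
    refine hfix _ ?_
    fin_cases i <;> fin_cases j <;> first | exact absurd hlt (by decide) | simp [hy, hY01, hY23]
  have gY : ∀ i j (hij : i ≠ j), g (Y i j hij) = Y i j hij := by
    intro i j hij
    rcases lt_or_gt_of_ne hij with h1 | h1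
    · exact gYlt i j hij h1
    · have h2 : Y i j hij = Y j i hij.symm := Subtype.ext (by
        change pairMember U e f {i, j} = pairMember U e f {j, i}
        rw [Finset.pair_comm])
      rw [h2]
      exact gYlt j i hij.symm h1
  set A : Set 𝒮 := {a | ∃ i j, ∃ hij : i ≠ j, a = Y i j hij} with hA
  have hgA : g '' A = A := by
    refine Set.EqOn.image_eq_self ?_
    rintro _ ⟨i, j, hij, rfl⟩
    exact gY i j hij
  have hxA : x ∈ omegaClosure Q 𝒮 A := by
    refine mem_omegaClosure fun n _ hn => h.map_twist hq hQ fun i j hij v hv => ?_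
    have h1 : (pairMember U e f {i, j}).map (n : V →ₗ[F] V) = pairMember U e f {i, j} :=
      hn (Y i j hij) ⟨i, j, hij, rfl⟩
    have h2 : n v ∈ (pairMember U e f {i, j}).map (n : V →ₗ[F] V) := ⟨v, hv, rfl⟩
    rwa [h1] at h2
  have hTA : g x ∈ omegaClosure Q 𝒮 A := by
    have h1 := (apply_mem_fixedClosure_iff hnorm hg).2 hxA
    rwa [hgA] at h1
  have hTm := isMaxTS_of_isFamily h𝒮 (g x).2
  -- U is contained in all six exchanges, hence in every member of their closure.
  have hUT : U ≤ (g x).1 := fun u hu => hst.mem_of_mem_omegaClosure hQ hTA hTm.1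
    (by rw [hTm.2]; omega) (fun a _ => (isMaxTS_of_isFamily h𝒮 a.2).1)
    (by rintro _ ⟨i, j, hij, rfl⟩; exact le_extend hu) (h.ts u hu)
  have hdim := h.dim
  have hTne : ∀ i j (hij : i ≠ j), x ≠ Y i j hij → (g x).1 ≠ (Y i j hij).1 := by
    intro i j hij hne heq
    exact hne (g.injective ((Subtype.ext heq).trans (gY i j hij).symm))
  have hne_of : ∀ {i j} (hij : i ≠ j), finrank F (x.1 ⊓ (Y i j hij).1 : Submodule F V) ≠ m →
      x ≠ Y i j hij := by
    rintro i j hij hd heq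
    rw [heq, inf_idem] at hd
    exact hd (isMaxTS_of_isFamily h𝒮 (Y i j hij).2).2
  -- Codimension two is excluded by applying g⁻¹, and the common subspace U bounds the codimension
  -- by four.
  have hfar : ∀ i j (hij : i ≠ j), finrank F (x.1 ⊓ (Y i j hij).1 : Submodule F V) + 4 = m →
      finrank F ((g x).1 ⊓ pairMember U e f {i, j} : Submodule F V) + 4 = m := by
    intro i j hij hd
    have h1 := Submodule.finrank_mono (show U ≤ (g x).1 ⊓ pairMember U e f {i, j} from
      le_inf hUT le_extend)
    rcases finrank_inf_eq_or_le hQ h𝒮 (g x).2 (Y i j hij).2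
      (hTne i j hij (hne_of hij (by omega))) with h2 | h2
    · have h3 := not_finrank_inf_apply_le hQ hq h𝒮 hnorm (G.inv_mem hg) h2
      rw [show g⁻¹ (g x) = x from g.symm_apply_apply x,
        show g⁻¹ (Y i j hij) = Y i j hij from (g.symm_apply_eq).2 (gY i j hij).symm] at h3
      omega
    · change finrank F ((g x).1 ⊓ pairMember U e f {i, j} : Submodule F V) + 4 ≤ m at h2
      omega
  have hnear : ∀ i j (hij : i ≠ j), finrank F (x.1 ⊓ (Y i j hij).1 : Submodule F V) + 2 = m →
      finrank F ((g x).1 ⊓ pairMember U e f {i, j} : Submodule F V) + 2 = m := by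
    intro i j hij hd
    refine (finrank_inf_eq_or_le hQ h𝒮 (g x).2 (Y i j hij).2
      (hTne i j hij (hne_of hij (by omega)))).resolve_right fun h2 => ?_
    have h3 := not_finrank_inf_apply_le hQ hq h𝒮 hnorm hg hd
    rw [gY i j hij] at h3
    exact h3 h2
  exact Subtype.ext (h.eq_twist hq hQ hTm hUT (hfar 0 1 (by decide) far)
    (hfar 2 3 (by decide) far') fun a b ha hb => hnear a b (by
      rcases ha with rfl | rfl <;> rcases hb with rfl | rfl <;> decide) (near ha hb))

end HalfSpinTwo
end IbisOrth

namespace IbisOrth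

/-! ### The half-spin action of the group of the hyperbolic quadric in five dimensions -/

section Doubling

variable {Ω : Type*}

/-- If the stabilizer of two points fixes the third point of the line joining them, then each term
of an irredundant sequence at least doubles the number of fixed points. -/
theorem two_pow_le_card_add_one [Finite Ω] {G : Subgroup (Equiv.Perm Ω)} {τ : Ω → Ω → Ω}
    (hl : ∀ a b, a ≠ b → τ a b ≠ a) (hr : ∀ a b, a ≠ b → τ a b ≠ b)
    (hll : ∀ a b, a ≠ b → τ a (τ a b) = b) (hrr : ∀ a b, a ≠ b → τ (τ a b) b = a)
    (hG : ∀ g ∈ G, ∀ a b, a ≠ b → g a = a → g b = b → g (τ a b) = τ a b) {n : ℕ} {ω : Fin n → Ω}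
    (hω : ∀ i, ∃ g ∈ G, (∀ j < i, g (ω j) = ω j) ∧ g (ω i) ≠ ω i) :
    2 ^ n ≤ Nat.card Ω + 1 := by
  set D : ℕ → Set Ω := fun i => {t | ∀ g ∈ G, (∀ j : Fin n, j.val < i → g (ω j) = ω j) → g t = t}
    with hD
  have key : ∀ i ≤ n, 2 ^ i ≤ (D i).ncard + 1 := by
    intro i
    induction i with
    | zero => intro _; simp
    | succ i ih =>
      intro hi
      have ih' := ih (by omega)
      set a := ω ⟨i, by omega⟩ with ha
      have haD : a ∉ D i := by
        intro hmem
        obtain ⟨g, hg, hfix, hmove⟩ := hω ⟨i, by omega⟩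
        exact hmove (hmem g hg fun j hj => hfix j hj)
      have hne : ∀ t ∈ D i, a ≠ t := fun t ht h => haD (h ▸ ht)
      -- The new fixed points include a and the third points of the lines joining a to the old ones,
      -- so the number of fixed points plus one at least doubles.
      have hsub : D i ∪ insert a (τ a '' D i) ⊆ D (i + 1) := by
        rintro t (ht | rfl | ⟨s, hs, rfl⟩) g hg hfix
        · exact ht g hg fun j hj => hfix j (by omega)
        · exact hfix ⟨i, by omega⟩ (by simp)
        · exact hG g hg a s (hne s hs) (hfix ⟨i, by omega⟩ (by simp))
            (hs g hg fun j hj => hfix j (by omega))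
      have hdisj : Disjoint (D i) (insert a (τ a '' D i)) := by
        rw [Set.disjoint_right]
        rintro t (rfl | ⟨s, hs, rfl⟩) ht
        · exact haD ht
        · refine haD fun g hg hfix => ?_
          have h1 := hG g hg (τ a s) s (hr a s (hne s hs)) (ht g hg hfix) (hs g hg hfix)
          rwa [hrr a s (hne s hs)] at h1
      have hnot : a ∉ τ a '' D i := by
        rintro ⟨s, hs, h⟩
        exact hl a s (hne s hs) h
      have hinj : Set.InjOn (τ a) (D i) := by
        intro s hs t ht hst
        rw [← hll a s (hne s hs), hst, hll a t (hne t ht)]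
      have h1 := Set.ncard_le_ncard hsub (Set.toFinite _)
      rw [Set.ncard_union_eq hdisj (Set.toFinite _) (Set.toFinite _),
        Set.ncard_insert_of_notMem hnot (Set.toFinite _), hinj.ncard_image] at h1
      rw [pow_succ]
      omega
  have h1 := key n le_rfl
  have h2 : (D n).ncard ≤ Nat.card Ω := Set.ncard_le_card _
  omega

end Doubling

/-! ### Six dimensions over two elements: the family as a projective 3-space -/

section HalfSpinSix

open QuadraticMap Module

variable {F V : Type*} [Field F] [AddCommGroup V] [Module F V] {Q : QuadraticForm F V}
  {𝒮 : Set (Submodule F V)}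

theorem finrank_inf_eq_one (hQ : PlusSpace Q 3) (h𝒮 : IsFamily Q 3 𝒮) {A B : Submodule F V}
    (hA : A ∈ 𝒮) (hB : B ∈ 𝒮) (hne : A ≠ B) : finrank F (A ⊓ B : Submodule F V) = 1 := by
  have h1 := finrank_inf_lt hQ h𝒮 hA hB hne
  have h2 := even_of_isFamily hQ h𝒮 hA hB
  rw [Nat.even_iff] at h2
  omega

theorem inf_eq_inf_of_le (hQ : PlusSpace Q 3) (h𝒮 : IsFamily Q 3 𝒮) {A B C D : Submodule F V}
    (hA : A ∈ 𝒮) (hB : B ∈ 𝒮) (hC : C ∈ 𝒮) (hD : D ∈ 𝒮) (hAB : A ≠ B) (hCD : C ≠ D)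
    (hle : A ⊓ B ≤ C ⊓ D) : C ⊓ D = A ⊓ B := by
  have := hQ.finite
  refine (Submodule.eq_of_le_of_finrank_eq hle ?_).symm
  rw [finrank_inf_eq_one hQ h𝒮 hA hB hAB, finrank_inf_eq_one hQ h𝒮 hC hD hCD]

/-- The stabilizer of two members fixes the third member through their intersection. -/
theorem apply_third (hQ : PlusSpace Q 3) (hq : Nat.card F = 2) (h𝒮 : IsFamily Q 3 𝒮)
    {G : Subgroup (Equiv.Perm 𝒮)}
    (hnorm : ∀ g ∈ G, ∀ n ∈ inducedPerm (omegaGroup Q) 𝒮, g * n * g⁻¹ ∈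
      inducedPerm (omegaGroup Q) 𝒮) {g : Equiv.Perm 𝒮} (hg : g ∈ G) {A B C : 𝒮} (hAB : A ≠ B)
    (hCA : C ≠ A) (hCB : C ≠ B) (hD : A.1 ⊓ B.1 ≤ C.1) (hgA : g A = A) (hgB : g B = B) :
    g C = C := by
  have hval : ∀ {X Y : 𝒮}, X ≠ Y → X.1 ≠ Y.1 := fun h h' => h (Subtype.ext h')
  have hAB1 := finrank_inf_eq_one hQ h𝒮 A.2 B.2 (hval hAB)
  have h1 := (apply_mem_fixedClosure_iff hnorm hg).2
    (third_mem_closure hQ hq h𝒮 (by omega) hCA hCB hD)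
  rw [Set.image_pair, hgA, hgB] at h1
  have hAm := isMaxTS_of_isFamily h𝒮 A.2
  have hBm := isMaxTS_of_isFamily h𝒮 B.2
  have hgCm := isMaxTS_of_isFamily h𝒮 (g C).2
  refine Subtype.ext (eq_of_inf_le hQ hq h𝒮 A.2 B.2 (by omega) (g C).2 C.2
    (hval fun h => hCA (g.injective (h.trans hgA.symm)))
    (hval fun h => hCB (g.injective (h.trans hgB.symm))) (hval hCA) (hval hCB) (fun w hw => ?_) hD)
  exact (rootStable_of_isFamily hQ h𝒮).mem_of_mem_omegaClosure hQ h1 hgCm.1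
    (by rw [hgCm.2]; omega) (by rintro _ (rfl | rfl); exacts [hAm.1, hBm.1])
    (by rintro _ (rfl | rfl); exacts [hw.1, hw.2]) (hAm.1 w hw.1)

/-- A member other than X meets X in some ⟨p⟩, and at most two such members pass through ⟨p⟩.
Letting p run over all of X, zero included, gives 1 + 2 · 8; the exact value 15 is not needed
because 17 + 1 < 2⁵. -/
theorem card_family_le [Finite F] (hQ : PlusSpace Q 3) (hq : Nat.card F = 2)
    (h𝒮 : IsFamily Q 3 𝒮) : Nat.card 𝒮 ≤ 17 := by
  have := hQ.finite
  have : Finite V := Module.finite_of_finite F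
  have : Fintype 𝒮 := Fintype.ofFinite _
  classical
  obtain ⟨X, hX⟩ := exists_mem_of_isFamily h𝒮
  have hXm := isMaxTS_of_isFamily h𝒮 hX
  have hp : ∀ Y : 𝒮, ∃ p : X, Y.1 ≠ X → X ⊓ Y.1 = Submodule.span F {p.1} := by
    intro Y
    by_cases hY : Y.1 = X
    · exact ⟨0, fun h => absurd hY h⟩
    · have h1 := finrank_inf_eq_one hQ h𝒮 hX Y.2 (Ne.symm hY)
      obtain ⟨p, hp, hp0⟩ := Submodule.exists_mem_ne_zero_of_ne_bot
        (show X ⊓ Y.1 ≠ ⊥ from fun h => by rw [h, finrank_bot] at h1; omega)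
      refine ⟨⟨p, hp.1⟩, fun _ => (Submodule.eq_of_le_of_finrank_eq
        ((Submodule.span_singleton_le_iff_mem _ _).2 hp) ?_).symm⟩
      rw [finrank_span_singleton hp0, h1]
  choose p hp using hp
  have : Fintype X := Fintype.ofFinite _
  have hfib : ∀ b ∈ (Finset.univ : Finset X),
      (({Y : 𝒮 | Y.1 ≠ X} : Finset 𝒮).filter fun Y => p Y = b).card ≤ 2 := by
    intro b _
    by_contra! hcon
    obtain ⟨A, hA, B, hB, C, hC, hAB, hAC, hBC⟩ := Finset.two_lt_card.1 hcon
    simp only [Finset.mem_filter, Finset.mem_univ, true_and] at hA hB hC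
    have hval : ∀ {X Y : 𝒮}, X ≠ Y → X.1 ≠ Y.1 := fun h h' => h (Subtype.ext h')
    have hXA := finrank_inf_eq_one hQ h𝒮 hX A.2 hA.1.symm
    have hAi := hp A hA.1
    have hBi := hp B hB.1
    have hCi := hp C hC.1
    rw [hA.2] at hAi
    rw [hB.2] at hBi
    rw [hC.2] at hCi
    exact hBC (Subtype.ext (eq_of_inf_le hQ hq h𝒮 hX A.2 (by omega) B.2 C.2 hB.1
      (hval hAB.symm) hC.1 (hval hAC.symm) (by rw [hAi, ← hBi]; exact inf_le_right)
      (by rw [hAi, ← hCi]; exact inf_le_right)))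
  have h1 := Finset.card_le_mul_card_image_of_maps_to
    (fun Y _ => Finset.mem_univ (p Y)) 2 hfib
  have h2 : Nat.card X = 8 := by
    rw [Module.natCard_eq_pow_finrank (K := F), hq, hXm.2]; norm_num
  rw [Finset.card_univ, ← Nat.card_eq_fintype_card, h2] at h1
  have h3 : (Finset.univ : Finset 𝒮) ⊆ insert ⟨X, hX⟩ ({Y : 𝒮 | Y.1 ≠ X} : Finset 𝒮) := by
    intro Y _
    by_cases hY : Y.1 = X
    · exact Finset.mem_insert.2 (Or.inl (Subtype.ext hY))
    · exact Finset.mem_insert_of_mem (by simpa using hY)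
  have h4 := (Finset.card_le_card h3).trans (Finset.card_insert_le _ _)
  rw [Finset.card_univ, ← Nat.card_eq_fintype_card] at h4
  omega

/-- A totally singular line avoids some member of the family. -/
theorem exists_mem_disjoint (hQ : PlusSpace Q 3) (h𝒮 : IsFamily Q 3 𝒮) {u v : V}
    (huv : SingularPair Q u v) (hu0 : u ≠ 0) (hv : v ∉ Submodule.span F {u}) :
    ∃ W ∈ 𝒮, ∀ a b : F, a • u + b • v ∈ W → a = 0 ∧ b = 0 := by
  have := hQ.finite
  obtain ⟨A, hA⟩ := exists_mem_of_isFamily h𝒮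
  have hAm := isMaxTS_of_isFamily h𝒮 hA
  have hind : ∀ {a b : F}, a • u + b • v = 0 → a = 0 ∧ b = 0 := by
    intro a b hab
    have hb : b = 0 := by
      by_contra hb
      refine hv (Submodule.mem_span_singleton.2 ⟨-(b⁻¹ * a), ?_⟩)
      have h1 : v = b⁻¹ • (a • u + b • v) + (-(b⁻¹ * a)) • u := by
        rw [smul_add, smul_smul, smul_smul, inv_mul_cancel₀ hb]; module
      rw [hab, smul_zero, zero_add] at h1
      exact h1.symm
    subst hb
    rw [zero_smul, add_zero] at hab
    exact ⟨(smul_eq_zero.1 hab).resolve_right hu0, rfl⟩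
  obtain ⟨Z, hZ, huvZ⟩ := hQ.exists_isMaxTS (isTotallySingular_span_pair huv.1 huv.2.1 huv.2.2)
  have huZ : u ∈ Z := huvZ (Submodule.subset_span (Or.inl rfl))
  have hvZ : v ∈ Z := huvZ (Submodule.subset_span (Or.inr rfl))
  obtain ⟨e, f, h, he⟩ := hQ.exists_hypPairs hZ 3 le_rfl
  have hZW := h.inf_span_right hZ.1 he
  set W := Submodule.span F (Set.range f) with hW
  have hWm : IsMaxTS Q 3 W := ⟨isTotallySingular_span (by rintro _ ⟨i, rfl⟩; exact h.qf i)
    (by rintro _ ⟨i, rfl⟩ _ ⟨j, rfl⟩; exact h.ff i j), h.finrank_span_right⟩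
  have hzero : ∀ {z}, z ∈ Z → z ∈ W → z = 0 := fun hz hw => by
    rw [← Submodule.mem_bot F, ← hZW]; exact ⟨hz, hw⟩
  have hmemZ : ∀ a b : F, a • u + b • v ∈ Z := fun a b =>
    Z.add_mem (Z.smul_mem _ huZ) (Z.smul_mem _ hvZ)
  by_cases hWS : W ∈ 𝒮
  · exact ⟨W, hWS, fun a b hab => hind (hzero (hmemZ a b) hab)⟩
  -- The complement W of Z belongs to the opposite family. The adjacent maximal subspace through a
  -- vector w of Z off the line is in the right family and meets Z in ⟨w⟩ only.
  obtain ⟨w, hw, hwuv⟩ : ∃ w ∈ Z, w ∉ Submodule.span F {u, v} := by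
    by_contra! hcon
    have h1 := Submodule.finrank_mono (show Z ≤ _ from hcon)
    rw [hZ.2, show ({u, v} : Set V) = insert u {v} from rfl, Submodule.span_insert] at h1
    have h2 := Submodule.finrank_add_le_finrank_add_finrank (Submodule.span F {u})
      (Submodule.span F {v})
    have h3 := finrank_span_singleton_le_one (F := F) u
    have h4 := finrank_span_singleton_le_one (F := F) v
    omega
  have hw0 : w ≠ 0 := fun h => hwuv (h ▸ Submodule.zero_mem _)
  have hwW : w ∉ W := fun hmem => hw0 (hzero hw hmem)
  have hPm := hQ.isMaxTS_pivot hWm (hZ.1 w hw)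
  refine ⟨pivot Q W w, (mem_of_isFamily hQ h𝒮 hA _).2 ⟨hPm, ?_⟩, fun a b hab => ?_⟩
  · have h1 := hQ.even_finrank hAm hWm hPm
    have h2 := hQ.finrank_inf_pivot hWm hwW
    have h3 : ¬ Even (finrank F (A ⊓ W : Submodule F V) + 3) := fun h =>
      hWS ((mem_of_isFamily hQ h𝒮 hA _).2 ⟨hWm, h⟩)
    rw [Nat.even_iff] at h1 h3 ⊢
    omega
  · obtain ⟨c, y, hy, -, hc⟩ := mem_pivot.1 hab
    have hy0 : y = 0 := hzero (by
      rw [← sub_eq_of_eq_add' hc]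
      exact Z.sub_mem (hmemZ a b) (Z.smul_mem _ hw)) hy
    rw [hy0, add_zero] at hc
    by_cases hc0 : c = 0
    · rw [hc0, zero_smul] at hc
      exact hind hc
    · refine absurd (((Submodule.span F {u, v}).smul_mem_iff hc0).1 ?_) hwuv
      rw [← hc]
      exact Submodule.add_mem _ (Submodule.smul_mem _ _ (Submodule.subset_span (Or.inl rfl)))
        (Submodule.smul_mem _ _ (Submodule.subset_span (Or.inr rfl)))

/-- The pointwise stabilizer of three members is nontrivial. -/
theorem exists_ne_one_fixing (hQ : PlusSpace Q 3) (h𝒮 : IsFamily Q 3 𝒮) (X Y T : 𝒮) :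
    ∃ σ ∈ inducedPerm (omegaGroup Q) 𝒮, σ ≠ 1 ∧ σ X = X ∧ σ Y = Y ∧ σ T = T := by
  have := hQ.finite
  have hXm := isMaxTS_of_isFamily h𝒮 X.2
  have hYm := isMaxTS_of_isFamily h𝒮 Y.2
  have hTm := isMaxTS_of_isFamily h𝒮 T.2
  -- Members intersect in odd dimension, so X ∩ Y ≠ 0. The root element of u in X ∩ Y and an
  -- orthogonal v in T stabilizes all three members.
  obtain ⟨u, hu, hu0⟩ := Submodule.exists_mem_ne_zero_of_ne_bot
    (show X.1 ⊓ Y.1 ≠ ⊥ from fun h => by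
      have h1 := even_of_isFamily hQ h𝒮 X.2 Y.2
      rw [h, finrank_bot, Nat.even_iff] at h1
      omega)
  obtain ⟨v, hv, hvu⟩ := PlusSpace.exists_ne_mem
    (U := T.1 ⊓ perp Q (Submodule.span F {u})) (by
      have h1 := hQ.finrank_inf_perp hTm (Submodule.span F {u})
      have h2 := finrank_span_singleton_le_one (F := F) u
      omega) u
  have huv : SingularPair Q u v := ⟨hXm.1 u hu.1, hTm.1 v hv.1, mem_perp_span.1 hv.2 u rfl⟩
  obtain ⟨σ, hσ, hσg⟩ := (rootStable_of_isFamily hQ h𝒮).exists_perm hQ (root_mem_rootGroup huv)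
  refine ⟨σ, hσ, ?_, Subtype.ext ?_, Subtype.ext ?_, Subtype.ext ?_⟩
  · rintro rfl
    obtain ⟨W, hW, hdis⟩ := exists_mem_disjoint hQ h𝒮 huv hu0 hvu
    obtain ⟨a, b, hab, hmem⟩ := hQ.exists_mem_of_map_root_eq (isMaxTS_of_isFamily h𝒮 hW) huv
      (hσg ⟨W, hW⟩).symm
    have h1 := hdis a b hmem
    tauto
  · rw [hσg]
    exact map_root_eq_of_mem hXm.1 huv (a := 1) (b := 0) (Or.inl one_ne_zero) (by simpa using hu.1)
  · rw [hσg]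
    exact map_root_eq_of_mem hYm.1 huv (a := 1) (b := 0) (Or.inl one_ne_zero) (by simpa using hu.2)
  · rw [hσg]
    exact map_root_eq_of_mem hTm.1 huv (a := 0) (b := 1) (Or.inr one_ne_zero) (by simpa using hv.1)

/-- Every irredundant base has exactly four points: at most four by doubling, at least four by
`exists_ne_one_fixing`. -/
theorem isIBIS_family_six [Finite F] (hQ : PlusSpace Q 3) (hq : Nat.card F = 2)
    (h𝒮 : IsFamily Q 3 𝒮) {G : Subgroup (Equiv.Perm 𝒮)}
    (hNG : inducedPerm (omegaGroup Q) 𝒮 ≤ G)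
    (hnorm : ∀ g ∈ G, ∀ n ∈ inducedPerm (omegaGroup Q) 𝒮, g * n * g⁻¹ ∈
      inducedPerm (omegaGroup Q) 𝒮) : IsIBIS G := by
  have := hQ.finite
  have : Finite V := Module.finite_of_finite F
  have hval : ∀ {X Y : 𝒮}, X ≠ Y → X.1 ≠ Y.1 := fun h h' => h (Subtype.ext h')
  -- The third point of the line AB; for A = B the value is irrelevant.
  have hτ : ∀ A B : 𝒮, ∃ C : 𝒮, A ≠ B → C ≠ A ∧ C ≠ B ∧ A.1 ⊓ B.1 ≤ C.1 := by
    intro A B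
    by_cases hAB : A = B
    · exact ⟨A, fun h => absurd hAB h⟩
    · have h1 := finrank_inf_eq_one hQ h𝒮 A.2 B.2 (hval hAB)
      obtain ⟨C, hC, hCA, hCB, hD⟩ := exists_third hQ h𝒮 A.2 B.2 (by omega)
      exact ⟨⟨C, hC⟩, fun _ => ⟨fun h => hCA (congrArg Subtype.val h),
        fun h => hCB (congrArg Subtype.val h), hD⟩⟩
  choose τ hτ using hτ
  have uniq : ∀ {A B C C' : 𝒮}, A ≠ B → C ≠ A → C ≠ B → C' ≠ A → C' ≠ B → A.1 ⊓ B.1 ≤ C.1 →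
      A.1 ⊓ B.1 ≤ C'.1 → C = C' := by
    intro A B C C' hAB h1 h2 h3 h4 h5 h6
    have h7 := finrank_inf_eq_one hQ h𝒮 A.2 B.2 (hval hAB)
    exact Subtype.ext (eq_of_inf_le hQ hq h𝒮 A.2 B.2 (by omega) C.2 C'.2 (hval h1) (hval h2)
      (hval h3) (hval h4) h5 h6)
  have hfour : ∀ (n : ℕ) (ω : Fin n → 𝒮), IsIrredundantBase G ω → n = 4 := by
    intro n ω hω
    have hle : 2 ^ n ≤ Nat.card 𝒮 + 1 := by
      refine two_pow_le_card_add_one (τ := τ) (fun a b hab => (hτ a b hab).1)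
        (fun a b hab => (hτ a b hab).2.1) (fun a b hab => ?_) (fun a b hab => ?_)
        (fun g hg a b hab ha hb => ?_) hω.irredundant
      · obtain ⟨h1, h2, h3⟩ := hτ a b hab
        obtain ⟨h4, h5, h6⟩ := hτ a (τ a b) h1.symm
        refine uniq h1.symm h4 h5 hab.symm h2.symm h6 ?_
        rw [inf_eq_inf_of_le hQ h𝒮 a.2 b.2 a.2 (τ a b).2 (hval hab) (hval h1.symm)
          (le_inf inf_le_left h3)]
        exact inf_le_right
      · obtain ⟨h1, h2, h3⟩ := hτ a b hab
        obtain ⟨h4, h5, h6⟩ := hτ (τ a b) b h2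
        refine uniq h2 h4 h5 h1.symm hab h6 ?_
        rw [inf_eq_inf_of_le hQ h𝒮 a.2 b.2 (τ a b).2 b.2 (hval hab) (hval h2)
          (le_inf h3 inf_le_right)]
        exact inf_le_left
      · obtain ⟨h1, h2, h3⟩ := hτ a b hab
        exact apply_third hQ hq h𝒮 hnorm hg hab h1 h2 h3 ha hb
    have hcard := card_family_le hQ hq h𝒮
    have hlt : n < 5 := by
      by_contra! h5
      have := Nat.pow_le_pow_right (n := 2) (by norm_num) h5
      omega
    obtain ⟨A, hA⟩ := exists_mem_of_isFamily h𝒮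
    by_contra hne
    -- A base of at most three points is padded to three members by an arbitrary one.
    obtain ⟨X, Y, T, hcover⟩ : ∃ X Y T : 𝒮, ∀ i, ω i = X ∨ ω i = Y ∨ ω i = T := by
      have hex : ∀ i : ℕ, ∃ X : 𝒮, ∀ j : Fin n, j.val = i → ω j = X := by
        intro i
        by_cases hi : i < n
        · exact ⟨ω ⟨i, hi⟩, fun j hj => congrArg ω (Fin.ext hj)⟩
        · exact ⟨⟨A, hA⟩, fun j hj => absurd j.2 (by omega)⟩
      obtain ⟨X, hX⟩ := hex 0
      obtain ⟨Y, hY⟩ := hex 1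
      obtain ⟨T, hT⟩ := hex 2
      refine ⟨X, Y, T, fun i => ?_⟩
      have h1 : i.val = 0 ∨ i.val = 1 ∨ i.val = 2 := by omega
      rcases h1 with h1 | h1 | h1
      exacts [Or.inl (hX i h1), Or.inr (Or.inl (hY i h1)), Or.inr (Or.inr (hT i h1))]
    obtain ⟨σ, hσ, hσ1, h1, h2, h3⟩ := exists_ne_one_fixing hQ h𝒮 X Y T
    refine hσ1 (hω.base σ (hNG hσ) fun i => ?_)
    rcases hcover i with h | h | h <;> rw [h] <;> assumption
  intro a b ω ω' h h'
  rw [hfour a ω h, hfour b ω' h']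

end HalfSpinSix
end IbisOrth

/-! ### The theorem, assembled from the cases -/

theorem lemma3p18 {F V : Type*} [Field F] [Finite F] [AddCommGroup V] [Module F V]
    (d q k : ℕ) (hd : 6 ≤ d) (hd_even : Even d)
    (hq : Nat.card F = q) (hV : Module.finrank F V = d)
    (Q : QuadraticForm F V) (hQ : IbisOrth.IsPlusType Q)
    (𝒮 : Set (Submodule F V))
    (h𝒮 : (1 ≤ k ∧ k < d / 2 ∧ 𝒮 = IbisOrth.totallySingular Q k) ∨
      (k = d / 2 ∧ IbisOrth.IsFamily Q k 𝒮))
    (G : Subgroup (Equiv.Perm 𝒮)) (hG : IbisOrth.IsAlmostSimple G)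
    (hsocle : (IbisOrth.socle G).map G.subtype =
      IbisOrth.inducedPerm (IbisOrth.omegaGroup Q) 𝒮) :
    IbisOrth.IsIBIS G ↔ (d, q, k) = (6, 2, 3) := by
  subst hq
  obtain ⟨m, hm⟩ := hd_even
  have hdm : d / 2 = m := by omega
  have hP : IbisOrth.PlusSpace Q m := ⟨hQ, by omega, by omega⟩
  have hNG : IbisOrth.inducedPerm (IbisOrth.omegaGroup Q) 𝒮 ≤ G :=
    hsocle ▸ Subgroup.map_subtype_le _
  have hnorm : ∀ g ∈ G, ∀ n ∈ IbisOrth.inducedPerm (IbisOrth.omegaGroup Q) 𝒮,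
      g * n * g⁻¹ ∈ IbisOrth.inducedPerm (IbisOrth.omegaGroup Q) 𝒮 := by
    intro g hg n hn
    rw [← hsocle] at hn ⊢
    exact IbisOrth.conj_mem_map_socle hg hn
  have hcard : Nat.card F = 2 ∨ 2 < Nat.card F := by
    have := Finite.one_lt_card (α := F)
    omega
  rw [hdm] at h𝒮
  simp only [Prod.mk.injEq]
  rcases h𝒮 with ⟨hk, hkm, rfl⟩ | ⟨rfl, hfam⟩
  -- Here k < m, whereas d = 6 and k = 3 would give k = m.
  · refine iff_of_false ?_ (by omega)
    rcases hk.eq_or_lt with rfl | hk2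
    · rcases hcard with h2 | h2
      exacts [IbisOrth.not_isIBIS_points_of_card_eq_two hP h2 hNG hnorm,
        IbisOrth.not_isIBIS_points hP h2 hNG hnorm]
    · exact IbisOrth.not_isIBIS_of_two_le_of_lt hP hk2 hkm hNG hnorm
  · rcases hcard with h2 | h2
    · by_cases h3 : k = 3
      · subst h3
        exact iff_of_true (IbisOrth.isIBIS_family_six hP h2 hfam hNG hnorm) ⟨by omega, h2, rfl⟩
      · exact iff_of_false (IbisOrth.not_isIBIS_family_of_card_eq_two hP h2 (by omega) hfam hNG hnorm)
          (by omega)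
    · exact iff_of_false (IbisOrth.not_isIBIS_family_of_two_lt_card hP h2 hfam hNG hnorm) (by omega)
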